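/- Let $G$ be a complex Lie group whose Lie algebra $\mathfrak g$ is reductive, $B$ a nondegenerate symmetric ${\rm Ad}(G)$-invariant bilinear form on $\mathfrak g$, $\mathfrak t\subset\mathfrak g$ a Cartan subalgebra, $\Phi\subset\mathfrak t^*$ the root system, $\Phi_+$ a system of positive roots, and $e_\alpha\in\mathfrak g_\alpha$ ($\alpha\in\Phi$) root vectors with $B(e_\alpha,e_{-\alpha})=1$. Let $\mathfrak t'=\{t\in\mathfrak t : \alpha(t)\notin 2\pi i\mathbb Z \text{ for all }\alpha\in\Phi\}$. Let $\lambda\in\mathfrak t$, let $\mathfrak h=\mathfrak g_1+\mathfrak t$ be its centralizer in $\mathfrak g$, with semisimple part $\mathfrak g_1=[\mathfrak h,\mathfrak h]$. Notation: $\Omega\in\mathfrak g\otimes\mathfrak g$ and $\Omega_{1}\in\mathfrak g_1\otimes\mathfrak g_1$ are the Casimir elements of $B$ and of $B|_{\mathfrak g_1}$; $l_g,r_g$ denote left and right translation by $g$; $u\wedge v=u\otimes v-v\otimes u$; $(t_j)$ is a basis of $\mathfrak t$ and $\partial/\partial t^j$ are the constant vector fields on $\mathfrak t$ given by the $B$-dual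 basis; the Lie bracket of $\mathfrak g$ is that of left-invariant vector fields. For $t\in\mathfrak t$, ${\rm ad}_t^{-1}$ is the inverse of ${\rm ad}_t$ on $\mathfrak g_t^\perp$, extended by $0$ on the centralizer $\mathfrak g_t$ of $t$. Put $$\pi(g,t)=\sum_j \frac{\partial}{\partial t^j}\wedge l_g(t_j)+l_g\big(({\rm id}\otimes{\rm ad}_t^{-1})(\Omega)\big),\qquad r_{\mathfrak g_1}=\frac12\sum_{\alpha\in\Phi_+,\ \alpha(\lambda)=0}e_\alpha\wedge e_{-\alpha},$$ and, with $\varphi(z)=-\frac1z+\frac12\coth\frac z2$, $\varphi(0)=0$, let $r_{{\rm AM},\mathfrak g_1}(x)=({\rm id}\otimes\varphi({\rm ad}_{x_1}))(\Omega_{1})\in\mathfrak g_1\otimes\mathfrak g_1$ for $x\in\mathfrak g$, where $x_1$ is the $B$-orthogonal projection of $x$ to $\mathfrak g_1$ and ${\rm ad}_{x_1}$ acts on $\mathfrak g_1$; this is defined whenever no eigenvalue of ${\rm ad}_{x_1}$ on $\mathfrak g_1$ lies in $2\pi i(\mathbb Z\setminus\{0\})$. Let $D\subset G\times\mathfrak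 t'$ be the set of $(g,t)$ for which $r_{{\rm AM},\mathfrak g_1}({\rm Ad}_g t)$ is defined, and on $D$ set $$\pi_{\mathfrak g_1}(g,t)=\pi(g,t)+r_g\big(r_{{\rm AM},\mathfrak g_1}({\rm Ad}_g t)\big)-r_g(r_{\mathfrak g_1}).$$ Then $D$ is open and dense in $G\times\mathfrak t'$, $\pi_{\mathfrak g_1}$ is a holomorphic Poisson bivector field on $D$, and there is an open subset $U\subset D$, dense in $G\times\mathfrak t'$, on which $\pi_{\mathfrak g_1}$ is nondegenerate. Hence $\pi_{\mathfrak g_1}$ defines a holomorphic symplectic structure on the dense open subset $U$ of $G\times\mathfrak t'$. -/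

import Mathlib

open scoped Manifold ContDiff TensorProduct

noncomputable section

namespace DynPoisson

/-! ### Holomorphic Poisson and symplectic bivector fields on complex manifolds -/

section Manifold

variable {F H M : Type*} [NormedAddCommGroup F] [NormedSpace ℂ F] [TopologicalSpace H]
  [TopologicalSpace M] [ChartedSpace H M] (I : ModelWithCorners ℂ F H)

/-- The differential at `p` of a complex-valued function, as a linear form on `T_p M`. -/
def differential (f : M → ℂ) (p : M) : Module.Dual ℂ (TangentSpace I p) :=
  (mfderiv I 𝓘(ℂ, ℂ) f p).toLinearMap

/-- The bracket `{f, h} = π(df, dh)` defined by a field `π` of contravariant 2-tensors. -/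
def bracket (π : ∀ p : M, TangentSpace I p ⊗[ℂ] TangentSpace I p) (f h : M → ℂ) (p : M) : ℂ :=
  TensorProduct.dualDistrib ℂ (TangentSpace I p) (TangentSpace I p)
    (differential I f p ⊗ₜ[ℂ] differential I h p) (π p)

/-- `π` is a holomorphic Poisson bivector field on `U`: it is skew-symmetric, the bracket of
two (local) holomorphic functions is holomorphic, and the bracket of (local) holomorphic functions
satisfies the Jacobi identity. -/
structure IsPoissonOn (π : ∀ p : M, TangentSpace I p ⊗[ℂ] TangentSpace I p) (U : Set M) :
    Prop where
  skew : ∀ p ∈ U, TensorProduct.comm ℂ (TangentSpace I p) (TangentSpace I p) (π p) = -π p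
  holomorphic : ∀ V ⊆ U, IsOpen V → ∀ f h : M → ℂ,
    ContMDiffOn I 𝓘(ℂ, ℂ) ω f V → ContMDiffOn I 𝓘(ℂ, ℂ) ω h V →
      ContMDiffOn I 𝓘(ℂ, ℂ) ω (bracket I π f h) V
  jacobi : ∀ V ⊆ U, IsOpen V → ∀ f h k : M → ℂ,
    ContMDiffOn I 𝓘(ℂ, ℂ) ω f V → ContMDiffOn I 𝓘(ℂ, ℂ) ω h V → ContMDiffOn I 𝓘(ℂ, ℂ) ω k V →
      ∀ p ∈ V, bracket I π (bracket I π f h) k p + bracket I π (bracket I π h k) f p +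
        bracket I π (bracket I π k f) h p = 0

/-- The value of a 2-tensor field at `p` is nondegenerate: contraction `T_p^* M → T_p M` with it
is an isomorphism. -/
def NondegenerateAt (π : ∀ p : M, TangentSpace I p ⊗[ℂ] TangentSpace I p) (p : M) : Prop :=
  Function.Bijective fun ξ : Module.Dual ℂ (TangentSpace I p) ↦
    TensorProduct.lid ℂ (TangentSpace I p) (LinearMap.rTensor (TangentSpace I p) ξ (π p))

/-- `π` is a holomorphic symplectic structure on `U`, i.e. a nondegenerate Poisson structure. -/
def IsSymplecticOn (π : ∀ p : M, TangentSpace I p ⊗[ℂ] TangentSpace I p) (U : Set M) : Prop :=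
  IsPoissonOn I π U ∧ ∀ p ∈ U, NondegenerateAt I π p

end Manifold

/-! ### Functional calculus for `φ(z) = -1/z + (1/2) coth(z/2)` -/

section Phi

variable {A : Type*} [Ring A] [Algebra ℂ A] [TopologicalSpace A]

/-- The entire function `sinh(z/2) / (z/2)`. -/
def phiDen (a : A) : A :=
  ∑' n : ℕ, ((2 * n + 1).factorial : ℂ)⁻¹ • ((2⁻¹ : ℂ) • a) ^ (2 * n)

/-- The entire function `(cosh(z/2) - sinh(z/2)/(z/2)) / (z/2)²`. -/
def phiNum (a : A) : A :=
  ∑' n : ℕ, (((2 * n + 2).factorial : ℂ)⁻¹ - ((2 * n + 3).factorial : ℂ)⁻¹) •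
    ((2⁻¹ : ℂ) • a) ^ (2 * n)

/-- The function `φ(z) = -1/z + (1/2) coth(z/2)`, `φ(0) = 0`, as a quotient of entire functions,
so that it can be evaluated at those elements `a` of an algebra for which the denominator
is invertible. For complex numbers see `phi_zero` and `phi_eq`. -/
def phi (a : A) : A :=
  (4⁻¹ : ℂ) • (a * phiNum a * Ring.inverse (phiDen a))

theorem phi_zero : phi (0 : ℂ) = 0 := by
  simp [phi]

theorem hasSum_phiDen (w : ℂ) (hw : w ≠ 0) :
    HasSum (fun n : ℕ ↦ ((2 * n + 1).factorial : ℂ)⁻¹ • w ^ (2 * n)) (Complex.sinh w / w) := by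
  refine ((Complex.hasSum_sinh w).div_const w).congr_fun fun n ↦ ?_
  have : ((2 * n + 1).factorial : ℂ) ≠ 0 := by exact_mod_cast Nat.factorial_ne_zero _
  rw [smul_eq_mul, pow_succ]
  field_simp

theorem hasSum_phiNum (w : ℂ) (hw : w ≠ 0) :
    HasSum (fun n : ℕ ↦ (((2 * n + 2).factorial : ℂ)⁻¹ - ((2 * n + 3).factorial : ℂ)⁻¹) •
      w ^ (2 * n)) ((Complex.cosh w - Complex.sinh w / w) / w ^ 2) := by
  have h1 := (hasSum_nat_add_iff' 1).2 (Complex.hasSum_cosh w)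
  have h2 := ((hasSum_nat_add_iff' 1).2 (Complex.hasSum_sinh w)).div_const w
  have h := (h1.sub h2).div_const (w ^ 2)
  have e : (Complex.cosh w - Complex.sinh w / w) / w ^ 2 =
      (Complex.cosh w - ∑ i ∈ Finset.range 1, w ^ (2 * i) / ((2 * i).factorial : ℂ) -
        (Complex.sinh w - ∑ i ∈ Finset.range 1, w ^ (2 * i + 1) / ((2 * i + 1).factorial : ℂ)) / w)
        / w ^ 2 := by
    simp
    field_simp
    ring
  rw [e]
  refine h.congr_fun fun n ↦ ?_
  have a1 : ((2 * n + 2).factorial : ℂ) ≠ 0 := by exact_mod_cast Nat.factorial_ne_zero _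
  have a2 : ((2 * n + 3).factorial : ℂ) ≠ 0 := by exact_mod_cast Nat.factorial_ne_zero _
  rw [smul_eq_mul, show 2 * (n + 1) = 2 * n + 2 by ring, show 2 * n + 2 + 1 = 2 * n + 3 by ring]
  field_simp
  ring

/-- On complex numbers, `phi` is the function `-1/z + (1/2) coth(z/2)`. -/
theorem phi_eq (z : ℂ) (hz : z ≠ 0) (hs : Complex.sinh (z / 2) ≠ 0) :
    phi z = -1 / z + (1 / 2) * (Complex.cosh (z / 2) / Complex.sinh (z / 2)) := by
  obtain ⟨w, rfl⟩ : ∃ w, z = 2 * w := ⟨z / 2, by ring⟩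
  have hw : w ≠ 0 := by rintro rfl; simp at hz
  have e : (2⁻¹ : ℂ) • (2 * w) = w := by rw [smul_eq_mul]; ring
  rw [mul_div_cancel_left₀ w two_ne_zero] at hs ⊢
  have h1 : phiDen (2 * w) = Complex.sinh w / w := by
    simp only [phiDen, e]; exact (hasSum_phiDen w hw).tsum_eq
  have h2 : phiNum (2 * w) = (Complex.cosh w - Complex.sinh w / w) / w ^ 2 := by
    simp only [phiNum, e]; exact (hasSum_phiNum w hw).tsum_eq
  rw [phi, h1, h2, Ring.inverse_eq_inv', smul_eq_mul]
  field_simp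
  ring

/-- `φ(T)` for an endomorphism `T` of a finite-dimensional complex vector space. -/
def phiEnd {V : Type*} [AddCommGroup V] [Module ℂ V] [FiniteDimensional ℂ V]
    (T : Module.End ℂ V) : Module.End ℂ V :=
  Matrix.toLin (Module.finBasis ℂ V) (Module.finBasis ℂ V)
    (phi (LinearMap.toMatrix (Module.finBasis ℂ V) (Module.finBasis ℂ V) T))

end Phi

/-! ### Casimir elements, dynamical r-matrices, roots -/

section Algebra

/-- The canonical element `∑ᵢ eᵢ ⊗ eⁱ` of `V ⊗ V`, for `(eᵢ)` a basis of `V` and `(eⁱ)` the dual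
basis with respect to the nondegenerate bilinear form `B`. -/
def casimir {V : Type*} [AddCommGroup V] [Module ℂ V] [FiniteDimensional ℂ V]
    (B : LinearMap.BilinForm ℂ V) : V ⊗[ℂ] V :=
  open Classical in
  if hB : B.Nondegenerate then
    ∑ i, Module.finBasis ℂ V i ⊗ₜ[ℂ] B.dualBasis hB (Module.finBasis ℂ V) i
  else 0

variable {𝔨 : Type*} [LieRing 𝔨] [LieAlgebra ℂ 𝔨]

/-- The element `ξ^∨ = (ξ ⊗ id)(Ω)` of `𝔨` corresponding to `ξ ∈ 𝔨^*`. -/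
def sharp [FiniteDimensional ℂ 𝔨] (B : LinearMap.BilinForm ℂ 𝔨) (ξ : Module.Dual ℂ 𝔨) : 𝔨 :=
  TensorProduct.lid ℂ 𝔨 (LinearMap.rTensor 𝔨 ξ (casimir B))

/-- The maximal domain of definition of the Alekseev-Meinrenken dynamical r-matrix:
no eigenvalue of `ad (ξ^∨)` lies in `2πi (ℤ \ {0})`. -/
def domAM [FiniteDimensional ℂ 𝔨] (B : LinearMap.BilinForm ℂ 𝔨) : Set (Module.Dual ℂ 𝔨) :=
  {ξ | ∀ n : ℤ, n ≠ 0 →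
    ¬ (LieAlgebra.ad ℂ 𝔨 (sharp B ξ)).HasEigenvalue (2 * Real.pi * Complex.I * n)}

/-- The Alekseev-Meinrenken dynamical r-matrix `ξ ↦ (id ⊗ φ(ad (ξ^∨)))(Ω)` of `𝔨`. -/
def rAM [FiniteDimensional ℂ 𝔨] (B : LinearMap.BilinForm ℂ 𝔨) (ξ : Module.Dual ℂ 𝔨) :
    𝔨 ⊗[ℂ] 𝔨 :=
  LinearMap.lTensor 𝔨 (phiEnd (LieAlgebra.ad ℂ 𝔨 (sharp B ξ))) (casimir B)

open Classical in
/-- The trivial extension to `𝔨` of the inverse of `ad_x : 𝔨_x^⊥ → 𝔨_x^⊥`, where `𝔨_x` is the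
centralizer of `x` and `𝔨 = 𝔨_x ⊕ 𝔨_x^⊥`. -/
def adInv (B : LinearMap.BilinForm ℂ 𝔨) (x : 𝔨) : Module.End ℂ 𝔨 :=
  if h : ∃ S : Module.End ℂ 𝔨, (∀ y, ⁅x, y⁆ = 0 → S y = 0) ∧
      ∀ y ∈ B.orthogonal (LinearMap.ker (LieAlgebra.ad ℂ 𝔨 x : Module.End ℂ 𝔨)), S ⁅x, y⁆ = y
  then h.choose else 0

/-- A (finite-dimensional) Lie algebra is reductive if every ideal has a complementary ideal. -/
def IsReductive (𝔨 : Type*) [LieRing 𝔨] [LieAlgebra ℂ 𝔨] : Prop :=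
  ∀ a : LieIdeal ℂ 𝔨, ∃ b : LieIdeal ℂ 𝔨, IsCompl a b

/-- A Cartan subalgebra of a complex reductive Lie algebra: a subalgebra which is toral
(commutative and consisting of semisimple elements) and equal to its own centralizer. -/
structure IsCartan (𝔱 : LieSubalgebra ℂ 𝔨) : Prop where
  semisimple : ∀ h ∈ 𝔱, (LieAlgebra.ad ℂ 𝔨 h).IsSemisimple
  centralizer : ∀ x : 𝔨, x ∈ 𝔱 ↔ ∀ h ∈ 𝔱, ⁅h, x⁆ = 0

/-- The restriction of a bilinear form to a Lie subalgebra. -/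
def restrictForm (B : LinearMap.BilinForm ℂ 𝔨) (𝔞 : LieSubalgebra ℂ 𝔨) :
    LinearMap.BilinForm ℂ 𝔞 :=
  LinearMap.compl₁₂ B (𝔞.incl : 𝔞 →ₗ[ℂ] 𝔨) (𝔞.incl : 𝔞 →ₗ[ℂ] 𝔨)

/-- `x` lies in the simultaneous eigenspace of `𝔱` with eigenvalue `α`. -/
def IsWeightVector (𝔱 : LieSubalgebra ℂ 𝔨) (α : Module.Dual ℂ 𝔱) (x : 𝔨) : Prop :=
  ∀ h : 𝔱, ⁅(h : 𝔨), x⁆ = α h • x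

/-- The roots of `𝔨` with respect to the Cartan subalgebra `𝔱`. -/
def roots (𝔱 : LieSubalgebra ℂ 𝔨) : Set (Module.Dual ℂ 𝔱) :=
  {α | α ≠ 0 ∧ ∃ x : 𝔨, x ≠ 0 ∧ IsWeightVector 𝔱 α x}

/-- A system of positive roots: a closed half of the set of roots. -/
structure IsPositiveSystem (𝔱 : LieSubalgebra ℂ 𝔨) (P : Set (Module.Dual ℂ 𝔱)) : Prop where
  subset : P ⊆ roots 𝔱
  partition : ∀ α ∈ roots 𝔱, Xor (α ∈ P) (-α ∈ P)
  closed : ∀ α ∈ P, ∀ β ∈ P, α + β ∈ roots 𝔱 → α + β ∈ P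

/-- A choice of root vectors `e_α ∈ 𝔨_α`, normalized by `B(e_α, e_{-α}) = 1`. -/
def IsRootVectors (B : LinearMap.BilinForm ℂ 𝔨) (𝔱 : LieSubalgebra ℂ 𝔨)
    (e : Module.Dual ℂ 𝔱 → 𝔨) : Prop :=
  ∀ α ∈ roots 𝔱, IsWeightVector 𝔱 α (e α) ∧ B (e α) (e (-α)) = 1

/-- The complement `𝔱'` of the affine root hyperplanes. -/
def tPrime (𝔱 : LieSubalgebra ℂ 𝔨) : Set 𝔱 :=
  {s | ∀ α ∈ roots 𝔱, ∀ n : ℤ, α s ≠ 2 * Real.pi * Complex.I * n}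

/-- The semisimple part `𝔤₁ = [𝔥, 𝔥]` of the centralizer `𝔥` of `lam`. -/
def leviDerived (lam : 𝔨) : LieSubalgebra ℂ 𝔨 :=
  LieSubalgebra.lieSpan ℂ 𝔨 {z | ∃ x y : 𝔨, ⁅lam, x⁆ = 0 ∧ ⁅lam, y⁆ = 0 ∧ ⁅x, y⁆ = z}

/-- The skew-symmetric part `(1/2) ∑ (e_α ⊗ e_{-α} - e_{-α} ⊗ e_α)` of the standard classical
r-matrix of `𝔤₁`; the sum is over the positive roots of `𝔤₁`, i.e. those vanishing at `lam`. -/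
def rStd (𝔱 : LieSubalgebra ℂ 𝔨) (P : Set (Module.Dual ℂ 𝔱)) (e : Module.Dual ℂ 𝔱 → 𝔨)
    (lam : 𝔱) : 𝔨 ⊗[ℂ] 𝔨 :=
  (2⁻¹ : ℂ) • ∑ᶠ α ∈ {α ∈ P | α lam = 0}, (e α ⊗ₜ[ℂ] e (-α) - e (-α) ⊗ₜ[ℂ] e α)

end Algebra

/-! ### The bivector on `G × 𝔱` -/

section Group

variable {E G : Type*} [NormedAddCommGroup E] [NormedSpace ℂ E] [FiniteDimensional ℂ E]
  [TopologicalSpace G] [ChartedSpace E G] [Group G]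

instance : FiniteDimensional ℂ (GroupLieAlgebra 𝓘(ℂ, E) G) :=
  inferInstanceAs (FiniteDimensional ℂ E)

/-- The adjoint action: the differential at `1` of conjugation by `g`. -/
def Ad (g : G) : GroupLieAlgebra 𝓘(ℂ, E) G →ₗ[ℂ] GroupLieAlgebra 𝓘(ℂ, E) G :=
  (mfderiv 𝓘(ℂ, E) 𝓘(ℂ, E) (fun h : G ↦ g * h * g⁻¹) 1).toLinearMap

variable [CompleteSpace E] [LieGroup 𝓘(ℂ, E) ω G]

/-- A subalgebra `𝔱` of the Lie algebra `T_1 G`, seen as a subspace of the model space `E` (which is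
the underlying space of `T_1 G`), so that it is a normed space and a complex manifold. -/
def space (𝔱 : LieSubalgebra ℂ (GroupLieAlgebra 𝓘(ℂ, E) G)) : Submodule ℂ E where
  carrier := {x : E | (x : GroupLieAlgebra 𝓘(ℂ, E) G) ∈ 𝔱}
  add_mem' := fun ha hb ↦ 𝔱.add_mem ha hb
  zero_mem' := 𝔱.zero_mem
  smul_mem' := fun c _ hx ↦ 𝔱.smul_mem c hx

/-- The tautological identification of `space 𝔱` with `𝔱`. -/
def spaceEquiv (𝔱 : LieSubalgebra ℂ (GroupLieAlgebra 𝓘(ℂ, E) G)) : space 𝔱 ≃ₗ[ℂ] 𝔱 where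
  toFun x := ⟨x.1, x.2⟩
  invFun x := ⟨x.1, x.2⟩
  map_add' _ _ := rfl
  map_smul' _ _ := rfl
  left_inv _ := rfl
  right_inv _ := rfl

/-- The tangent map at `1` of `h ↦ (g h, s)`: left translation of `𝔤` to `T_(g,s)(G × 𝔱)`. -/
def leftT (𝔱 : LieSubalgebra ℂ (GroupLieAlgebra 𝓘(ℂ, E) G)) (p : G × space 𝔱) :
    GroupLieAlgebra 𝓘(ℂ, E) G →ₗ[ℂ] TangentSpace (𝓘(ℂ, E).prod 𝓘(ℂ, space 𝔱)) p :=
  (mfderiv 𝓘(ℂ, E) (𝓘(ℂ, E).prod 𝓘(ℂ, space 𝔱)) (fun h : G ↦ (p.1 * h, p.2)) 1).toLinearMap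

/-- The tangent map at `1` of `h ↦ (h g, s)`: right translation of `𝔤` to `T_(g,s)(G × 𝔱)`. -/
def rightT (𝔱 : LieSubalgebra ℂ (GroupLieAlgebra 𝓘(ℂ, E) G)) (p : G × space 𝔱) :
    GroupLieAlgebra 𝓘(ℂ, E) G →ₗ[ℂ] TangentSpace (𝓘(ℂ, E).prod 𝓘(ℂ, space 𝔱)) p :=
  (mfderiv 𝓘(ℂ, E) (𝓘(ℂ, E).prod 𝓘(ℂ, space 𝔱)) (fun h : G ↦ (h * p.1, p.2)) 1).toLinearMap

/-- The inclusion of `𝔱` in `T_(g,s)(G × 𝔱)` as the directions along the second factor. -/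
def vertT (𝔱 : LieSubalgebra ℂ (GroupLieAlgebra 𝓘(ℂ, E) G)) (p : G × space 𝔱) :
    𝔱 →ₗ[ℂ] TangentSpace (𝓘(ℂ, E).prod 𝓘(ℂ, space 𝔱)) p :=
  (mfderiv 𝓘(ℂ, space 𝔱) (𝓘(ℂ, E).prod 𝓘(ℂ, space 𝔱)) (fun s : space 𝔱 ↦ (p.1, s)) p.2).toLinearMap ∘ₗ
    (spaceEquiv 𝔱).symm.toLinearMap

/-- The restriction to `𝔤₁` of the element of `𝔤^*` which `B` associates with `Ad_g s`; under
`𝔤₁^* ≅ 𝔤₁` it corresponds to the projection of `Ad_g s` to `𝔤₁`. -/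
def momentRestr (B : LinearMap.BilinForm ℂ (GroupLieAlgebra 𝓘(ℂ, E) G))
    (𝔱 : LieSubalgebra ℂ (GroupLieAlgebra 𝓘(ℂ, E) G)) (lam : 𝔱) (p : G × space 𝔱) :
    Module.Dual ℂ (leviDerived (lam : GroupLieAlgebra 𝓘(ℂ, E) G)) :=
  (B (Ad p.1 (spaceEquiv 𝔱 p.2 : GroupLieAlgebra 𝓘(ℂ, E) G))).comp
    ((leviDerived (lam : GroupLieAlgebra 𝓘(ℂ, E) G)).incl :
      leviDerived (lam : GroupLieAlgebra 𝓘(ℂ, E) G) →ₗ[ℂ] GroupLieAlgebra 𝓘(ℂ, E) G)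

/-- The Poisson bivector
`π(g,s) = ∑ⱼ ∂/∂tʲ ∧ l_g(tⱼ) + l_g((id ⊗ ad_s⁻¹)(Ω))` of the cross-section `G × 𝔱'` of `T^*G`,
where `a ∧ b = a ⊗ b - b ⊗ a`. The sum `∑ⱼ ∂/∂tʲ ⊗ tⱼ` is the canonical element of `𝔱 ⊗ 𝔱`. -/
def piSlice (B : LinearMap.BilinForm ℂ (GroupLieAlgebra 𝓘(ℂ, E) G))
    (𝔱 : LieSubalgebra ℂ (GroupLieAlgebra 𝓘(ℂ, E) G)) (p : G × space 𝔱) :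
    TangentSpace (𝓘(ℂ, E).prod 𝓘(ℂ, space 𝔱)) p ⊗[ℂ] TangentSpace (𝓘(ℂ, E).prod 𝓘(ℂ, space 𝔱)) p :=
  TensorProduct.map (vertT 𝔱 p) (leftT 𝔱 p ∘ₗ (𝔱.incl : 𝔱 →ₗ[ℂ] GroupLieAlgebra 𝓘(ℂ, E) G))
      (casimir (restrictForm B 𝔱)) -
    TensorProduct.map (leftT 𝔱 p ∘ₗ (𝔱.incl : 𝔱 →ₗ[ℂ] GroupLieAlgebra 𝓘(ℂ, E) G)) (vertT 𝔱 p)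
      (casimir (restrictForm B 𝔱)) +
    TensorProduct.map (leftT 𝔱 p) (leftT 𝔱 p)
      (LinearMap.lTensor (GroupLieAlgebra 𝓘(ℂ, E) G)
        (adInv B (spaceEquiv 𝔱 p.2 : GroupLieAlgebra 𝓘(ℂ, E) G)) (casimir B))

/-- The bivector `π_{𝔤₁}(g,s) = π(g,s) + r_g(r_{AM,𝔤₁}(Ad_g s)) - r_g(r_{𝔤₁})`. -/
def piG1 (B : LinearMap.BilinForm ℂ (GroupLieAlgebra 𝓘(ℂ, E) G))
    (𝔱 : LieSubalgebra ℂ (GroupLieAlgebra 𝓘(ℂ, E) G)) (P : Set (Module.Dual ℂ 𝔱))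
    (e : Module.Dual ℂ 𝔱 → GroupLieAlgebra 𝓘(ℂ, E) G) (lam : 𝔱) (p : G × space 𝔱) :
    TangentSpace (𝓘(ℂ, E).prod 𝓘(ℂ, space 𝔱)) p ⊗[ℂ] TangentSpace (𝓘(ℂ, E).prod 𝓘(ℂ, space 𝔱)) p :=
  piSlice B 𝔱 p +
    TensorProduct.map
      (rightT 𝔱 p ∘ₗ ((leviDerived (lam : GroupLieAlgebra 𝓘(ℂ, E) G)).incl :
        leviDerived (lam : GroupLieAlgebra 𝓘(ℂ, E) G) →ₗ[ℂ] GroupLieAlgebra 𝓘(ℂ, E) G))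
      (rightT 𝔱 p ∘ₗ ((leviDerived (lam : GroupLieAlgebra 𝓘(ℂ, E) G)).incl :
        leviDerived (lam : GroupLieAlgebra 𝓘(ℂ, E) G) →ₗ[ℂ] GroupLieAlgebra 𝓘(ℂ, E) G))
      (rAM (restrictForm B (leviDerived (lam : GroupLieAlgebra 𝓘(ℂ, E) G)))
        (momentRestr B 𝔱 lam p)) -
    TensorProduct.map (rightT 𝔱 p) (rightT 𝔱 p) (rStd 𝔱 P e lam)

/-- The subset of `G × 𝔱'` on which `r_{AM,𝔤₁}(Ad_g s)` is defined. -/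
def domG1 (B : LinearMap.BilinForm ℂ (GroupLieAlgebra 𝓘(ℂ, E) G))
    (𝔱 : LieSubalgebra ℂ (GroupLieAlgebra 𝓘(ℂ, E) G)) (lam : 𝔱) : Set (G × space 𝔱) :=
  {p | spaceEquiv 𝔱 p.2 ∈ tPrime 𝔱 ∧ momentRestr B 𝔱 lam p ∈
    domAM (restrictForm B (leviDerived (lam : GroupLieAlgebra 𝓘(ℂ, E) G)))}

end Group

end DynPoisson

end

set_option linter.unusedSectionVars false
set_option linter.unusedSimpArgs false
open scoped Manifold ContDiff TensorProduct

noncomputable section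

namespace DynPoisson

/-! ### Differential calculus for `phi` in a Banach algebra -/

section BanachAlgebra

open FormalMultilinearSeries Filter Topology

variable {𝔸 : Type*} [NormedRing 𝔸] [NormedAlgebra ℂ 𝔸]

/-! Identify `𝔤` with its dual by `B` and trivialize the tangent spaces of `G × 𝔱` by left invariant
and constant fields. At `(g, t)` put `u = Ad_g t`. The bracket then becomes an explicit expression
in first derivatives (`modelBracket`), built from the projection to `𝔱` and the operator `θ = ad_t⁻¹
+ Ad_g⁻¹ (φ(ad u₁) - r) Ad_g`, where `φ(ad u₁)` is extended by zero off `𝔤₁` and `r` is the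
endomorphism of the standard r-matrix; `bracket_piG1` is the translation. Skewness holds because `φ`
is odd and `ad_t⁻¹`, `r` are skew for `B`; holomorphy holds because `θ` is analytic in translated
charts.

Jacobi identity. In the cyclic sum second derivatives occur only antisymmetrized, and in the left
invariant frame they produce Lie brackets of Hamiltonian vectors. What remains is an identity in `𝔤`
at a single point, `IsSliceData.cyclic_sum`. It splits by degree in `φ - r`. Degree zero concerns
`π` alone and follows from invariance of `B` and the Jacobi identity of `𝔤`; degree one cancels by
invariance; in degree two, the dynamical Yang-Baxter equation for `φ(ad u₁)` and the modified
Yang-Baxter equation for `r` have the same inhomogeneous term, so their difference vanishes.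

For `r` (`IsMetricReductive.mcybe`) the equation is checked on weight vectors: `r` acts by `-1/2`
and `1/2` on positive and negative root spaces of `𝔤₁`, and three roots with sum zero cannot all
have the same sign. This needs one-dimensional root spaces and nondegeneracy of `B` on `𝔤₁`, both
resting on the trace argument `eq_zero_of_mem_span_bracket`.

For `φ` (`cdybe_eq_zero`) the equation comes from an ordinary differential equation. The Riccati
equation `z φ' = z/4 - 2φ - z φ²` shows that the defect at `t u`, evaluated on vectors transported
by the denominator `phiDen` of `φ`, satisfies `t f' = -3 f`. Hence `t³ f` is constant on the
connected set of `t` where `φ` is defined, and it vanishes at `t = 0`.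

Nondegeneracy and density. If a covector with left component dual to `X` is in the kernel of the
bivector, then `X` is orthogonal to `𝔱` and applying `ad_t` gives `(1 + ad_t ∘ Ad_g⁻¹ (φ - r) Ad_g)
X = 0`; so invertibility of this operator suffices (`IsModelled.nondegenerateAt`). Along `z ↦ (g, z
t)` the determinants of `phiDen` and of this operator are analytic with value one at `z = 0`, so `z
= 1` is a limit of points where both are nonzero (`mem_closure_nondeg`). -/

theorem radius_ofScalars_eq_top {c : ℕ → ℂ} (hc : ∀ n, ‖c n‖ ≤ ((n.factorial : ℝ))⁻¹) :
    (ofScalars 𝔸 c).radius = ⊤ := by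
  refine radius_eq_top_of_summable_norm _ fun r ↦ ?_
  -- The constant term is dropped because the norm estimate needs positive degree: the algebra need
  -- not satisfy `‖1‖ = 1`.
  refine (summable_nat_add_iff 1).1 ?_
  refine Summable.of_nonneg_of_le (fun n ↦ by positivity) (fun n ↦ ?_)
    ((summable_nat_add_iff 1).2 (Real.summable_pow_div_factorial (r : ℝ)))
  rw [div_eq_inv_mul]
  gcongr
  exact (ofScalars_norm_le 𝔸 c _ n.succ_pos).trans (hc _)

variable [CompleteSpace 𝔸]

theorem hasFPowerSeriesOnBall_ofScalarsSum {c : ℕ → ℂ}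
    (hc : ∀ n, ‖c n‖ ≤ ((n.factorial : ℝ))⁻¹) :
    HasFPowerSeriesOnBall (ofScalarsSum c : 𝔸 → 𝔸) (ofScalars 𝔸 c) 0 ⊤ := by
  have := (ofScalars 𝔸 c).hasFPowerSeriesOnBall (by simp [radius_ofScalars_eq_top hc])
  rwa [radius_ofScalars_eq_top hc] at this

theorem hasSum_ofScalarsSum {c : ℕ → ℂ} (hc : ∀ n, ‖c n‖ ≤ ((n.factorial : ℝ))⁻¹) (b : 𝔸) :
    HasSum (fun n ↦ c n • b ^ n) (ofScalarsSum c b) := by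
  have := (hasFPowerSeriesOnBall_ofScalarsSum (𝔸 := 𝔸) hc).hasSum (y := b) (by simp)
  simpa [ofScalars_apply_eq] using this

theorem analyticAt_ofScalarsSum {c : ℕ → ℂ} (hc : ∀ n, ‖c n‖ ≤ ((n.factorial : ℝ))⁻¹) (b : 𝔸) :
    AnalyticAt ℂ (ofScalarsSum c : 𝔸 → 𝔸) b :=
  (hasFPowerSeriesOnBall_ofScalarsSum hc).analyticAt_of_mem (by simp)

/-- Differentiating in the direction of the base point itself multiplies the term of degree `n` by
`n`, as in the scalar case, because `b` commutes with its own powers. This Euler derivative is what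
makes a differential equation for `phi` available in a noncommutative algebra. -/
theorem hasSum_fderiv_ofScalarsSum {c : ℕ → ℂ} (hc : ∀ n, ‖c n‖ ≤ ((n.factorial : ℝ))⁻¹) (b : 𝔸) :
    HasSum (fun n : ℕ ↦ ((n : ℂ) * c n) • b ^ n) (fderiv ℂ (ofScalarsSum c : 𝔸 → 𝔸) b b) := by
  have h := (hasFPowerSeriesOnBall_ofScalarsSum (𝔸 := 𝔸) hc).fderiv.hasSum (y := b) (by simp)
  have h2 := h.mapL (ContinuousLinearMap.apply ℂ 𝔸 b)
  rw [← hasSum_nat_add_iff' 1]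
  simp only [ContinuousLinearMap.apply_apply, derivSeries_apply_diag, ofScalars_apply_eq,
    zero_add] at h2
  simp only [Finset.range_one, Finset.sum_singleton, Nat.cast_zero, zero_mul, zero_smul, sub_zero]
  convert! h2 using 2 with n
  rw [mul_smul, ← Nat.cast_smul_eq_nsmul ℂ]

def denCoeff (n : ℕ) : ℂ := ((2 * n + 1).factorial : ℂ)⁻¹

def numCoeff (n : ℕ) : ℂ := ((2 * n + 2).factorial : ℂ)⁻¹ - ((2 * n + 3).factorial : ℂ)⁻¹

/-- Writing both coefficient sequences over `(2n+3)!` turns the differential relations between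
numerator and denominator into polynomial identities in `n`. -/
theorem numCoeff_eq (n : ℕ) : numCoeff n = (2 * n + 2) * ((2 * n + 3).factorial : ℂ)⁻¹ := by
  have a1 : ((2 * n + 2).factorial : ℂ) ≠ 0 := by exact_mod_cast Nat.factorial_ne_zero _
  have e : ((2 * n + 3).factorial : ℂ) = (2 * n + 3) * ((2 * n + 2).factorial : ℂ) := by
    rw [Nat.factorial_succ (2 * n + 2)]; push_cast; ring
  have a2 : (2 * n + 3 : ℂ) ≠ 0 := by exact_mod_cast (by omega : 2 * n + 3 ≠ 0)
  rw [numCoeff, e]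
  field_simp
  ring

theorem denCoeff_eq (n : ℕ) :
    denCoeff n = (2 * n + 2) * (2 * n + 3) * ((2 * n + 3).factorial : ℂ)⁻¹ := by
  have a1 : ((2 * n + 1).factorial : ℂ) ≠ 0 := by exact_mod_cast Nat.factorial_ne_zero _
  have e : ((2 * n + 3).factorial : ℂ) =
      (2 * n + 3) * ((2 * n + 2) * ((2 * n + 1).factorial : ℂ)) := by
    rw [Nat.factorial_succ (2 * n + 2), Nat.factorial_succ (2 * n + 1)]; push_cast; ring
  have a2 : (2 * n + 3 : ℂ) ≠ 0 := by exact_mod_cast (by omega : 2 * n + 3 ≠ 0)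
  have a3 : (2 * n + 2 : ℂ) ≠ 0 := by exact_mod_cast (by omega : 2 * n + 2 ≠ 0)
  rw [denCoeff, e]
  field_simp

theorem norm_denCoeff_le (n : ℕ) : ‖denCoeff n‖ ≤ ((n.factorial : ℝ))⁻¹ := by
  rw [denCoeff, norm_inv, Complex.norm_natCast]
  exact inv_anti₀ (by positivity) (by exact_mod_cast Nat.factorial_le (by omega))

theorem norm_numCoeff_le (n : ℕ) : ‖numCoeff n‖ ≤ ((n.factorial : ℝ))⁻¹ := by
  have h : ‖numCoeff n‖ = (2 * n + 2) * ((2 * n + 3).factorial : ℝ)⁻¹ := by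
    rw [numCoeff_eq, norm_mul, norm_inv, Complex.norm_natCast,
      show (2 * n + 2 : ℂ) = ((2 * n + 2 : ℕ) : ℂ) by push_cast; ring, Complex.norm_natCast]
    push_cast; ring
  rw [h, Nat.factorial_succ (2 * n + 2)]
  have h1 : (n.factorial : ℝ) ≤ (2 * n + 2).factorial := by
    exact_mod_cast Nat.factorial_le (by omega)
  have h0 : (0 : ℝ) < n.factorial := by positivity
  push_cast
  rw [← div_eq_mul_inv, div_le_iff₀ (by positivity), ← div_eq_inv_mul, le_div_iff₀ h0]
  nlinarith [(by positivity : (0 : ℝ) ≤ n)]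

theorem phiDen_eq_ofScalarsSum :
    (phiDen : 𝔸 → 𝔸) = fun a ↦ ofScalarsSum denCoeff (((2⁻¹ : ℂ) • a) ^ 2) := by
  ext a
  simp only [phiDen, ofScalars_sum_eq, denCoeff, pow_mul]

theorem phiNum_eq_ofScalarsSum :
    (phiNum : 𝔸 → 𝔸) = fun a ↦ ofScalarsSum numCoeff (((2⁻¹ : ℂ) • a) ^ 2) := by
  ext a
  simp only [phiNum, ofScalars_sum_eq, numCoeff, pow_mul]

theorem hasSum_phiDen' (a : 𝔸) :
    HasSum (fun n ↦ denCoeff n • ((2⁻¹ : ℂ) • a) ^ (2 * n)) (phiDen a) := by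
  simpa only [phiDen_eq_ofScalarsSum, pow_mul] using
    hasSum_ofScalarsSum norm_denCoeff_le (((2⁻¹ : ℂ) • a) ^ 2)

theorem hasSum_phiNum' (a : 𝔸) :
    HasSum (fun n ↦ numCoeff n • ((2⁻¹ : ℂ) • a) ^ (2 * n)) (phiNum a) := by
  simpa only [phiNum_eq_ofScalarsSum, pow_mul] using
    hasSum_ofScalarsSum norm_numCoeff_le (((2⁻¹ : ℂ) • a) ^ 2)

theorem analyticAt_half_sq (a : 𝔸) : AnalyticAt ℂ (fun a : 𝔸 ↦ ((2⁻¹ : ℂ) • a) ^ 2) a := by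
  fun_prop

theorem analyticAt_phiDen (a : 𝔸) : AnalyticAt ℂ (phiDen : 𝔸 → 𝔸) a := by
  rw [phiDen_eq_ofScalarsSum]
  exact (analyticAt_ofScalarsSum norm_denCoeff_le _).comp (analyticAt_half_sq a)

theorem analyticAt_phiNum (a : 𝔸) : AnalyticAt ℂ (phiNum : 𝔸 → 𝔸) a := by
  rw [phiNum_eq_ofScalarsSum]
  exact (analyticAt_ofScalarsSum norm_numCoeff_le _).comp (analyticAt_half_sq a)

/-- Squaring is homogeneous of degree two, so the Euler factor `n` becomes `2n`. -/
theorem hasSum_fderiv_comp_half_sq {c : ℕ → ℂ} (hc : ∀ n, ‖c n‖ ≤ ((n.factorial : ℝ))⁻¹) (a : 𝔸) :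
    HasSum (fun n : ℕ ↦ (2 * n * c n) • ((2⁻¹ : ℂ) • a) ^ (2 * n))
      (fderiv ℂ (fun a : 𝔸 ↦ ofScalarsSum c (((2⁻¹ : ℂ) • a) ^ 2)) a a) := by
  have hsq : fderiv ℂ (fun a : 𝔸 ↦ ((2⁻¹ : ℂ) • a) ^ 2) a a =
      (2 : ℂ) • ((2⁻¹ : ℂ) • a) ^ 2 := by
    have h : HasFDerivAt (fun a : 𝔸 ↦ (2⁻¹ : ℂ) • a) ((2⁻¹ : ℂ) • ContinuousLinearMap.id ℂ 𝔸) a :=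
      ((2⁻¹ : ℂ) • ContinuousLinearMap.id ℂ 𝔸).hasFDerivAt
    have h2 := (h.mul' h).fderiv
    have e : (fun a : 𝔸 ↦ ((2⁻¹ : ℂ) • a) ^ 2) =
        (fun a : 𝔸 ↦ (2⁻¹ : ℂ) • a) * fun a : 𝔸 ↦ (2⁻¹ : ℂ) • a := by
      ext b; rw [pow_two]; rfl
    rw [e, h2]
    simp only [_root_.add_apply, _root_.smul_apply, ContinuousLinearMap.id_apply, MulOpposite.smul_eq_mul_unop, smul_eq_mul, MulOpposite.unop_op, two_smul, pow_two]
  have h := (hasSum_fderiv_ofScalarsSum hc (((2⁻¹ : ℂ) • a) ^ 2)).const_smul (2 : ℂ)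
  have e := fderiv_fun_comp a (analyticAt_ofScalarsSum hc (((2⁻¹ : ℂ) • a) ^ 2)).differentiableAt
    (analyticAt_half_sq a).differentiableAt
  rw [e, ContinuousLinearMap.comp_apply, hsq, map_smul]
  refine h.congr_fun fun n ↦ ?_
  rw [smul_smul, ← pow_mul, mul_assoc]

/-- Scalar form, with `w = z/2`: the Euler derivative of `sinh w / w` is `cosh w - sinh w / w`,
which is `w²` times the numerator series. -/
theorem fderiv_phiDen_self (a : 𝔸) :
    fderiv ℂ (phiDen : 𝔸 → 𝔸) a a = (4⁻¹ : ℂ) • (a ^ 2 * phiNum a) := by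
  have h := hasSum_fderiv_comp_half_sq norm_denCoeff_le a
  rw [← phiDen_eq_ofScalarsSum, ← hasSum_nat_add_iff' 1] at h
  have h2 := ((hasSum_phiNum' a).mul_left (a ^ 2)).const_smul (4⁻¹ : ℂ)
  simp only [Finset.range_one, Finset.sum_singleton, Nat.cast_zero, zero_mul, zero_smul, mul_zero,
    sub_zero] at h
  refine h.unique (h2.congr_fun fun n ↦ ?_)
  have e : (2 * ((n + 1 : ℕ) : ℂ) * denCoeff (n + 1)) = numCoeff n := by
    rw [numCoeff_eq, denCoeff, show 2 * (n + 1) + 1 = 2 * n + 3 by ring]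
    push_cast; ring
  rw [e, show 2 * (n + 1) = 2 + 2 * n by ring, pow_add, mul_smul_comm, smul_comm, pow_two,
    pow_two, smul_mul_smul_comm, smul_mul_assoc]
  norm_num

/-- The scalar relation `w N' = D - 3N`, compared coefficient by coefficient. -/
theorem fderiv_phiNum_self (a : 𝔸) :
    fderiv ℂ (phiNum : 𝔸 → 𝔸) a a = phiDen a - (3 : ℂ) • phiNum a := by
  have h := hasSum_fderiv_comp_half_sq norm_numCoeff_le a
  rw [← phiNum_eq_ofScalarsSum] at h
  refine h.unique (((hasSum_phiDen' a).sub ((hasSum_phiNum' a).const_smul (3 : ℂ))).congr_fun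
    fun n ↦ ?_)
  rw [smul_smul, ← sub_smul, denCoeff_eq, numCoeff_eq]
  congr 1
  ring

theorem pow_intertwine {a b x : 𝔸} (h : a * x = x * b) (n : ℕ) : a ^ n * x = x * b ^ n := by
  have : SemiconjBy x b a := h.symm
  exact (this.pow_right n).symm

theorem phiDen_intertwine {a b x : 𝔸} (h : a * x = x * b) : phiDen a * x = x * phiDen b := by
  refine ((hasSum_phiDen' a).mul_right x).unique (((hasSum_phiDen' b).mul_left x).congr_fun
    fun n ↦ ?_)
  rw [mul_smul_comm, smul_mul_assoc, pow_intertwine]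
  rw [smul_mul_assoc, mul_smul_comm, h]

theorem phiNum_intertwine {a b x : 𝔸} (h : a * x = x * b) : phiNum a * x = x * phiNum b := by
  refine ((hasSum_phiNum' a).mul_right x).unique (((hasSum_phiNum' b).mul_left x).congr_fun
    fun n ↦ ?_)
  rw [mul_smul_comm, smul_mul_assoc, pow_intertwine]
  rw [smul_mul_assoc, mul_smul_comm, h]

theorem phi_mul_phiDen {a : 𝔸} (ha : IsUnit (phiDen a)) :
    phi a * phiDen a = (4⁻¹ : ℂ) • (a * phiNum a) := by
  rw [phi, smul_mul_assoc, mul_assoc, Ring.inverse_mul_cancel _ ha, mul_one]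

/-- Numerator and denominator are power series and so intertwine; right multiplication by the unit
`phiDen b` reduces the quotient to them. -/
theorem phi_intertwine {a b x : 𝔸} (h : a * x = x * b) (ha : IsUnit (phiDen a))
    (hb : IsUnit (phiDen b)) : phi a * x = x * phi b := by
  rw [← hb.mul_left_inj, mul_assoc (phi a), ← phiDen_intertwine h, ← mul_assoc,
    phi_mul_phiDen ha, mul_assoc x, phi_mul_phiDen hb, mul_smul_comm, smul_mul_assoc, mul_assoc,
    phiNum_intertwine h, ← mul_assoc, h, mul_assoc]

theorem eventually_isUnit_phiDen {a : 𝔸} (ha : IsUnit (phiDen a)) :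
    ∀ᶠ b in 𝓝 a, IsUnit (phiDen b) :=
  (analyticAt_phiDen a).continuousAt.eventually (Units.isOpen.mem_nhds ha)

theorem analyticAt_phi {a : 𝔸} (ha : IsUnit (phiDen a)) : AnalyticAt ℂ (phi : 𝔸 → 𝔸) a := by
  have hi : AnalyticAt ℂ Ring.inverse (phiDen a) := analyticAt_inverse (𝕜 := ℂ) ha.unit
  have := (analyticAt_id.mul (analyticAt_phiNum a)).mul (hi.comp (analyticAt_phiDen a))
  exact (analyticAt_const (v := (4⁻¹ : ℂ))).smul this

/-- The Riccati equation `z φ' = z/4 - 2φ - z φ²`, obtained by differentiating `φ D = a N / 4` along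
`a` and cancelling the unit `D`. -/
theorem fderiv_phi_self {a : 𝔸} (ha : IsUnit (phiDen a)) :
    fderiv ℂ (phi : 𝔸 → 𝔸) a a = (4⁻¹ : ℂ) • a - (2 : ℂ) • phi a - phi a * a * phi a := by
  have hD := (analyticAt_phiDen a).differentiableAt.hasFDerivAt
  have hN := (analyticAt_phiNum a).differentiableAt.hasFDerivAt
  have hφ := (analyticAt_phi ha).differentiableAt.hasFDerivAt
  have e : (fun b : 𝔸 ↦ phi b * phiDen b) =ᶠ[𝓝 a] fun b ↦ (4⁻¹ : ℂ) • (b * phiNum b) :=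
    (eventually_isUnit_phiDen ha).mono fun b hb ↦ phi_mul_phiDen hb
  have h := ((hφ.mul' hD).congr_of_eventuallyEq e.symm).unique
    (((hasFDerivAt_id a).mul' hN).const_smul (4⁻¹ : ℂ))
  have h2 := DFunLike.congr_fun h a
  simp only [_root_.add_apply, _root_.smul_apply, ContinuousLinearMap.id_apply,
    MulOpposite.smul_eq_mul_unop, smul_eq_mul, MulOpposite.unop_op, id_eq, fderiv_phiDen_self,
    fderiv_phiNum_self] at h2
  have hp := phi_mul_phiDen ha
  have e1 : (4⁻¹ : ℂ) • (a ^ 2 * phiNum a) = a * phi a * phiDen a := by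
    rw [mul_assoc, hp, pow_two, mul_smul_comm, mul_assoc]
  have e2 : (4⁻¹ : ℂ) • (a * (phiDen a - (3 : ℂ) • phiNum a) + a * phiNum a) =
      (4⁻¹ : ℂ) • a * phiDen a - (2 : ℂ) • (phi a * phiDen a) := by
    rw [hp, mul_sub, mul_smul_comm, smul_mul_assoc]
    module
  rw [e1, e2] at h2
  rw [← ha.mul_left_inj, sub_mul, sub_mul, smul_mul_assoc (2 : ℂ), ← h2]
  noncomm_ring

/-- Differentiate the Riccati equation in the direction `v`. The left side contributes an extra
first derivative, whence the coefficient `3 = 2 + 1`, and symmetry of the second derivative puts `a`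
in the first slot. -/
theorem fderiv_fderiv_phi_apply {a : 𝔸} (ha : IsUnit (phiDen a)) (v : 𝔸) :
    fderiv ℂ (fderiv ℂ (phi : 𝔸 → 𝔸)) a a v =
      (4⁻¹ : ℂ) • v - (3 : ℂ) • fderiv ℂ phi a v - fderiv ℂ phi a v * a * phi a -
        phi a * v * phi a - phi a * a * fderiv ℂ phi a v := by
  have hφ := (analyticAt_phi ha).differentiableAt.hasFDerivAt
  have hφ' := (analyticAt_phi ha).fderiv.differentiableAt.hasFDerivAt
  have e : (fun b : 𝔸 ↦ fderiv ℂ phi b b) =ᶠ[𝓝 a]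
      fun b ↦ (4⁻¹ : ℂ) • b - (2 : ℂ) • phi b - phi b * b * phi b :=
    (eventually_isUnit_phiDen ha).mono fun b hb ↦ fderiv_phi_self hb
  have h := ((hφ'.clm_apply (hasFDerivAt_id a)).congr_of_eventuallyEq e.symm).unique
    ((((hasFDerivAt_id a).const_smul (4⁻¹ : ℂ)).sub (hφ.const_smul (2 : ℂ))).sub
      ((hφ.mul' (hasFDerivAt_id a)).mul' hφ))
  have h2 := DFunLike.congr_fun h v
  simp only [_root_.add_apply, _root_.sub_apply, _root_.smul_apply, ContinuousLinearMap.id_apply,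
    MulOpposite.smul_eq_mul_unop, smul_eq_mul, MulOpposite.unop_op, id_eq,
    ContinuousLinearMap.comp_apply, ContinuousLinearMap.flip_apply] at h2
  have hs : IsSymmSndFDerivAt ℂ (phi : 𝔸 → 𝔸) a :=
    ((analyticAt_phi ha).contDiffAt (n := ω)).isSymmSndFDerivAt (by simp)
  rw [hs a v, ← sub_eq_iff_eq_add'.2 h2.symm]
  simp only [add_mul, Pi.mul_apply, id_eq]
  rw [show (3 : ℂ) = 2 + 1 by norm_num, add_smul, one_smul]
  noncomm_ring

/-- The derivative at `s = 0` of `φ(e^{-sw} a e^{sw}) = e^{-sw} φ(a) e^{sw}`. -/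
theorem fderiv_phi_commutator {a : 𝔸} (ha : IsUnit (phiDen a)) (w : 𝔸) :
    fderiv ℂ (phi : 𝔸 → 𝔸) a (a * w - w * a) = phi a * w - w * phi a := by
  have h1 : HasDerivAt (fun s : ℂ ↦ NormedSpace.exp (s • w)) w 0 := by
    simpa using hasDerivAt_exp_smul_const (𝕂 := ℂ) w (0 : ℂ)
  have h2 : HasDerivAt (fun s : ℂ ↦ NormedSpace.exp (-(s • w))) (-w) 0 := by
    simpa using hasDerivAt_exp_smul_const (𝕂 := ℂ) (-w) (0 : ℂ)
  have hc : ∀ z : 𝔸, HasDerivAt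
      (fun s : ℂ ↦ NormedSpace.exp (-(s • w)) * z * NormedSpace.exp (s • w)) (z * w - w * z) 0 := by
    intro z
    have := (h2.mul_const z).mul h1
    simp only [zero_smul, neg_zero, NormedSpace.exp_zero, mul_one, one_mul, neg_mul] at this
    rwa [neg_add_eq_sub] at this
  have h0 : NormedSpace.exp (-((0 : ℂ) • w)) * a * NormedSpace.exp ((0 : ℂ) • w) = a := by simp
  have h3 : HasFDerivAt (phi : 𝔸 → 𝔸) (fderiv ℂ phi a)
      (NormedSpace.exp (-((0 : ℂ) • w)) * a * NormedSpace.exp ((0 : ℂ) • w)) := by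
    rw [h0]; exact (analyticAt_phi ha).differentiableAt.hasFDerivAt
  have h4 := h3.comp_hasDerivAt (0 : ℂ) (hc a)
  have hu : ∀ᶠ s : ℂ in 𝓝 0, IsUnit (phiDen
      (NormedSpace.exp (-(s • w)) * a * NormedSpace.exp (s • w))) := by
    have hca := (hc a).continuousAt
    rw [ContinuousAt, h0] at hca
    exact hca.eventually (eventually_isUnit_phiDen ha)
  refine h4.unique ((hc (phi a)).congr_of_eventuallyEq (hu.mono fun s hs ↦ ?_))
  have hinv : NormedSpace.exp (s • w) * NormedSpace.exp (-(s • w)) = 1 := by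
    rw [← NormedSpace.exp_add_of_commute_of_mem_ball (𝕂 := ℂ) (Commute.neg_right (Commute.refl _))
      (by simp [NormedSpace.expSeries_radius_eq_top]) (by simp [NormedSpace.expSeries_radius_eq_top])]
    simp
  have hinv' : NormedSpace.exp (-(s • w)) * NormedSpace.exp (s • w) = 1 := by
    rw [← NormedSpace.exp_add_of_commute_of_mem_ball (𝕂 := ℂ) (Commute.neg_left (Commute.refl _))
      (by simp [NormedSpace.expSeries_radius_eq_top]) (by simp [NormedSpace.expSeries_radius_eq_top])]
    simp
  have hi := phi_intertwine (a := a) (x := NormedSpace.exp (s • w))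
    (b := NormedSpace.exp (-(s • w)) * a * NormedSpace.exp (s • w))
    (by rw [← mul_assoc, ← mul_assoc, hinv, one_mul]) ha hs
  simp only [Function.comp_apply]
  rw [mul_assoc _ (phi a), hi, ← mul_assoc, hinv', one_mul]

theorem commute_phi {a b : 𝔸} (ha : IsUnit (phiDen a)) (h : Commute a b) : Commute (phi a) b :=
  phi_intertwine h ha ha

theorem commute_phiDen {a b : 𝔸} (h : Commute a b) : Commute (phiDen a) b :=
  phiDen_intertwine h

theorem commute_phiNum {a b : 𝔸} (h : Commute a b) : Commute (phiNum a) b :=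
  phiNum_intertwine h

@[simp]
theorem phiDen_zero_alg : phiDen (0 : 𝔸) = 1 := by
  rw [phiDen_eq_ofScalarsSum]
  simp [denCoeff]

end BanachAlgebra

/-! ### Determinants of analytic families of operators -/

section Determinant

open Filter Topology

variable {V : Type*} [NormedAddCommGroup V] [NormedSpace ℂ V] [FiniteDimensional ℂ V]

theorem isUnit_iff_det_ne_zero (T : V →L[ℂ] V) : IsUnit T ↔ T.det ≠ 0 := by
  rw [← isUnit_iff_ne_zero, ContinuousLinearMap.det, ← LinearMap.isUnit_iff_isUnit_det]
  constructor
  · exact fun h ↦ h.map (ContinuousLinearMap.toLinearMapRingHom : (V →L[ℂ] V) →+* _)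
  · intro h
    have h2 := h.map (Module.End.toContinuousLinearMap V : Module.End ℂ V ≃ₐ[ℂ] _)
    convert! h2

theorem isUnit_of_injective {T : V →L[ℂ] V} (h : ∀ x, T x = 0 → x = 0) : IsUnit T := by
  rw [isUnit_iff_det_ne_zero, ← isUnit_iff_ne_zero, ContinuousLinearMap.det,
    ← LinearMap.isUnit_iff_isUnit_det, LinearMap.isUnit_iff_ker_eq_bot, LinearMap.ker_eq_bot']
  exact h

theorem analyticAt_det (T : V →L[ℂ] V) :
    AnalyticAt ℂ (fun T : V →L[ℂ] V ↦ T.det) T := by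
  let b := Module.finBasis ℂ V
  have e : (fun T : V →L[ℂ] V ↦ T.det) = fun T : V →L[ℂ] V ↦
      ∑ σ : Equiv.Perm (Fin (Module.finrank ℂ V)), ((Equiv.Perm.sign σ : ℤ) : ℂ) *
        ∏ i, b.repr (T (b i)) (σ i) := by
    ext T
    rw [ContinuousLinearMap.det, ← LinearMap.det_toMatrix b, Matrix.det_apply']
    simp [LinearMap.toMatrix_apply]
  rw [e]
  refine Finset.analyticAt_fun_sum _ fun σ _ ↦ analyticAt_const.mul
    (Finset.analyticAt_fun_prod _ fun i _ ↦ ?_)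
  let ℓ : (V →L[ℂ] V) →ₗ[ℂ] ℂ :=
    { toFun := fun T ↦ b.repr (T (b i)) (σ i)
      map_add' := by intros; simp
      map_smul' := by intros; simp }
  exact (LinearMap.toContinuousLinearMap ℓ).analyticAt T

/-- The zeros of a nontrivial entire function form a discrete subset of a Lindelöf space, hence a
countable one, and the complement of a countable set in a real plane is path connected. -/
theorem isPreconnected_setOf_ne_zero {d : ℂ → ℂ} (hd : ∀ z, AnalyticAt ℂ d z) (h0 : d 0 ≠ 0) :
    IsPreconnected {z | d z ≠ 0} := by
  have h1 : (d ⁻¹' {0})ᶜ ∈ codiscreteWithin (Set.univ : Set ℂ) :=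
    AnalyticOnNhd.preimage_zero_mem_codiscreteWithin (x := 0) (fun z _ ↦ hd z) h0 (by simp)
      isConnected_univ
  have h2 : IsDiscrete (d ⁻¹' {0}) := by simpa using isDiscrete_of_codiscreteWithin h1
  have h3 : (d ⁻¹' {0}).Countable :=
    (HereditarilyLindelofSpace.isLindelof _).countable_of_isDiscrete h2
  exact (h3.isPathConnected_compl_of_one_lt_rank (by simp)).isConnected.isPreconnected

end Determinant

/-! ### Derivatives along rays -/

section Euler

variable {V W Z : Type*} [NormedAddCommGroup V] [NormedSpace ℂ V]
  [NormedAddCommGroup W] [NormedSpace ℂ W] [NormedAddCommGroup Z] [NormedSpace ℂ Z]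

/-- The function `f` is differentiable at `τ` and `τ f'(τ) = e`. -/
def HasEulerDerivAt (f : ℂ → V) (e : V) (τ : ℂ) : Prop :=
  ∃ f', HasDerivAt f f' τ ∧ τ • f' = e

namespace HasEulerDerivAt

variable {f g : ℂ → V} {e e' : V} {h : ℂ → W} {k : W} {τ : ℂ}

theorem add (hf : HasEulerDerivAt f e τ) (hg : HasEulerDerivAt g e' τ) :
    HasEulerDerivAt (fun t ↦ f t + g t) (e + e') τ := by
  obtain ⟨f', h1, rfl⟩ := hf
  obtain ⟨g', h2, rfl⟩ := hg
  exact ⟨_, h1.add h2, smul_add _ _ _⟩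

theorem sub (hf : HasEulerDerivAt f e τ) (hg : HasEulerDerivAt g e' τ) :
    HasEulerDerivAt (fun t ↦ f t - g t) (e - e') τ := by
  obtain ⟨f', h1, rfl⟩ := hf
  obtain ⟨g', h2, rfl⟩ := hg
  exact ⟨_, h1.sub h2, smul_sub _ _ _⟩

theorem const_smul (c : ℂ) (hf : HasEulerDerivAt f e τ) :
    HasEulerDerivAt (fun t ↦ c • f t) (c • e) τ := by
  obtain ⟨f', h1, rfl⟩ := hf
  exact ⟨_, h1.const_smul c, smul_comm _ _ _⟩

theorem bilin (b : V →L[ℂ] W →L[ℂ] Z) (hf : HasEulerDerivAt f e τ) (hh : HasEulerDerivAt h k τ) :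
    HasEulerDerivAt (fun t ↦ b (f t) (h t)) (b e (h τ) + b (f τ) k) τ := by
  obtain ⟨f', h1, rfl⟩ := hf
  obtain ⟨h', h2, rfl⟩ := hh
  refine ⟨_, b.hasDerivAt_of_bilinear (fun _ ↦ h1) (fun _ ↦ h2), ?_⟩
  simp [add_comm]

theorem apply {T : ℂ → V →L[ℂ] W} {T' : V →L[ℂ] W} (hT : HasEulerDerivAt T T' τ)
    (hf : HasEulerDerivAt f e τ) :
    HasEulerDerivAt (fun t ↦ T t (f t)) (T' (f τ) + T τ e) τ :=
  hT.bilin (ContinuousLinearMap.id ℂ (V →L[ℂ] W)) hf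

theorem apply_const {T : ℂ → V →L[ℂ] W} {T' : V →L[ℂ] W} (hT : HasEulerDerivAt T T' τ) (v : V) :
    HasEulerDerivAt (fun t ↦ T t v) (T' v) τ := by
  obtain ⟨f', h1, rfl⟩ := hT
  exact ⟨_, h1.clm_apply (hasDerivAt_const τ v), by simp⟩

theorem clm (b : V →L[ℂ] W) (hf : HasEulerDerivAt f e τ) :
    HasEulerDerivAt (fun t ↦ b (f t)) (b e) τ := by
  obtain ⟨f', h1, rfl⟩ := hf
  exact ⟨_, b.hasFDerivAt.comp_hasDerivAt τ h1, by simp⟩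

theorem comp_ray {F : V → W} {a : V} (hF : DifferentiableAt ℂ F (τ • a)) :
    HasEulerDerivAt (fun t ↦ F (t • a)) (fderiv ℂ F (τ • a) (τ • a)) τ := by
  refine ⟨_, hF.hasFDerivAt.comp_hasDerivAt τ ((hasDerivAt_id τ).smul_const a), ?_⟩
  simp

theorem congr_eq (hf : HasEulerDerivAt f e τ) (he : e = e') : HasEulerDerivAt f e' τ := he ▸ hf

end HasEulerDerivAt

end Euler

/-! ### The classical dynamical Yang-Baxter equation for the Alekseev-Meinrenken r-matrix -/

section CDYBE

open Filter Topology

variable {V : Type*} [NormedAddCommGroup V] [NormedSpace ℂ V]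

/-- A continuous Lie bracket with an invariant symmetric form, on a normed space. -/
structure IsMetrized (br : V →L[ℂ] V →L[ℂ] V) (B : V →L[ℂ] V →L[ℂ] ℂ) : Prop where
  skew : ∀ x y, br x y = -br y x
  jacobi : ∀ x y z, br x (br y z) = br (br x y) z + br y (br x z)
  symm : ∀ x y, B x y = B y x
  inv : ∀ x y z, B (br x y) z = -B y (br x z)

variable [CompleteSpace V] {br : V →L[ℂ] V →L[ℂ] V} {B : V →L[ℂ] V →L[ℂ] ℂ}

/-- Only even powers of the skew operator `A` occur. -/
theorem selfAdjoint_of_hasSum {A T : V →L[ℂ] V} (hA : ∀ x y, B (A x) y = -B x (A y)) {c : ℕ → ℂ}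
    (hT : HasSum (fun n ↦ c n • ((2⁻¹ : ℂ) • A) ^ (2 * n)) T) (x y : V) :
    B (T x) y = B x (T y) := by
  have hp : ∀ (n : ℕ) (x y : V), B (((((2⁻¹ : ℂ) • A) ^ 2) ^ n) x) y =
      B x (((((2⁻¹ : ℂ) • A) ^ 2) ^ n) y) := by
    intro n
    induction n with
    | zero => simp
    | succ n ih =>
      intro x y
      have h2 : ∀ x y : V, B ((((2⁻¹ : ℂ) • A) ^ 2) x) y = B x ((((2⁻¹ : ℂ) • A) ^ 2) y) := by
        simp [pow_two, hA]
      rw [pow_succ, mul_apply_eq_comp, ih, h2, ← pow_succ, pow_succ']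
      simp only [mul_apply_eq_comp, ← pow_succ, ← pow_succ']
      rw [← mul_apply_eq_comp, ← pow_succ', pow_succ, mul_apply_eq_comp]
  have h1 := hT.mapL (((B.flip y).comp (ContinuousLinearMap.apply ℂ V x)))
  have h2 := hT.mapL ((B x).comp (ContinuousLinearMap.apply ℂ V y))
  refine h1.unique (h2.congr_fun fun n ↦ ?_)
  have := hp n x y
  rw [← pow_mul] at this
  simp only [ContinuousLinearMap.comp_apply, ContinuousLinearMap.apply_apply,
    ContinuousLinearMap.flip_apply, _root_.smul_apply, map_smul, this]

/-- `φ` is an odd function. As `phiDen A` is onto, both arguments can be taken in its image, where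
`φ` becomes `A N / 4` and all factors commute. -/
theorem phi_skewAdjoint {A : V →L[ℂ] V} (hA : ∀ x y, B (A x) y = -B x (A y))
    (hu : IsUnit (phiDen A)) (x y : V) : B (phi A x) y = -B x (phi A y) := by
  have hD := selfAdjoint_of_hasSum (B := B) hA (hasSum_phiDen' A)
  have hN := selfAdjoint_of_hasSum (B := B) hA (hasSum_phiNum' A)
  have hs : ∀ z : V, ∃ w, phiDen A w = z := fun z ↦ ⟨Ring.inverse (phiDen A) z, by
    rw [← mul_apply_eq_comp, Ring.mul_inverse_cancel _ hu]; rfl⟩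
  have hφ : ∀ w, phi A (phiDen A w) = (4⁻¹ : ℂ) • A (phiNum A w) := fun w ↦ by
    rw [← mul_apply_eq_comp, phi_mul_phiDen hu]; rfl
  obtain ⟨v, rfl⟩ := hs x
  obtain ⟨w, rfl⟩ := hs y
  have c1 := DFunLike.congr_fun (commute_phiNum (Commute.refl A)).eq
  have c2 := DFunLike.congr_fun (commute_phiDen (commute_phiNum (Commute.refl A)).symm).eq
  have c3 := DFunLike.congr_fun (commute_phiDen (Commute.refl A)).eq
  simp only [mul_apply_eq_comp] at c1 c2 c3
  rw [hφ, hφ]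
  simp only [map_smul, _root_.smul_apply, hA, hN, hD, smul_neg]
  rw [c1, c3, c2]

/-- The derivative of `phi` at `ad u`, in the direction of `ad v`. -/
def phiDeriv (br : V →L[ℂ] V →L[ℂ] V) (u v : V) : V →L[ℂ] V :=
  fderiv ℂ (phi : (V →L[ℂ] V) → V →L[ℂ] V) (br u) (br v)

/-- The defect of the classical dynamical Yang-Baxter equation for `phi (ad u)`. -/
def cdybe (br : V →L[ℂ] V →L[ℂ] V) (B : V →L[ℂ] V →L[ℂ] ℂ) (u x y z : V) : ℂ :=
  B z (br (phi (br u) x) (phi (br u) y)) + B x (br (phi (br u) y) (phi (br u) z)) +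
    B y (br (phi (br u) z) (phi (br u) x)) - B y (phiDeriv br u z x) - B z (phiDeriv br u x y) -
    B x (phiDeriv br u y z) + (4⁻¹ : ℂ) • B z (br x y)

/-- `ad` is a representation, so the direction `ad [u, v]` is a commutator with `ad u`: this is the
infinitesimal equivariance of `φ`. -/
theorem phiDeriv_bracket (h : IsMetrized br B) {u : V} (hu : IsUnit (phiDen (br u))) (v x : V) :
    phiDeriv br u (br u v) x = phi (br u) (br v x) - br v (phi (br u) x) := by
  have e : br (br u v) = br u * br v - br v * br u := by
    ext x
    simp only [_root_.sub_apply, mul_apply_eq_comp]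
    rw [h.jacobi u v x]; abel
  rw [phiDeriv, e, fderiv_phi_commutator hu]
  rfl

/-- The vectors `X = phiDen (ad (τ u)) x` act as an integrating factor: they satisfy `τ X' = W φ(W)
X` with `W = ad (τ u)`. -/
theorem hasEulerDerivAt_phiDen {u : V} {τ : ℂ} (hu : IsUnit (phiDen (br (τ • u)))) (x : V) :
    HasEulerDerivAt (fun t ↦ phiDen (br (t • u)) x)
      (br (τ • u) (phi (br (τ • u)) (phiDen (br (τ • u)) x))) τ := by
  have h := (HasEulerDerivAt.comp_ray (F := (phiDen : (V →L[ℂ] V) → _)) (a := br u) (τ := τ)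
    (analyticAt_phiDen _).differentiableAt).apply_const x
  simp only [← map_smul] at h
  refine h.congr_eq ?_
  rw [fderiv_phiDen_self, ← mul_apply_eq_comp (phi _), phi_mul_phiDen hu, pow_two,
    mul_assoc]
  simp only [_root_.smul_apply, mul_apply_eq_comp, map_smul]

/-- The motion of `X` exactly cancels the quadratic term of the Riccati equation. -/
theorem hasEulerDerivAt_phi_phiDen {u : V} {τ : ℂ} (hu : IsUnit (phiDen (br (τ • u)))) (x : V) :
    HasEulerDerivAt (fun t ↦ phi (br (t • u)) (phiDen (br (t • u)) x))
      ((4⁻¹ : ℂ) • br (τ • u) (phiDen (br (τ • u)) x) -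
        (2 : ℂ) • phi (br (τ • u)) (phiDen (br (τ • u)) x)) τ := by
  have hu' : IsUnit (phiDen (τ • br u)) := by rwa [← map_smul]
  have h := (HasEulerDerivAt.comp_ray (F := (phi : (V →L[ℂ] V) → _)) (a := br u) (τ := τ)
    (analyticAt_phi hu').differentiableAt)
  simp only [← map_smul] at h
  refine (h.apply (hasEulerDerivAt_phiDen hu x)).congr_eq ?_
  rw [fderiv_phi_self hu]
  simp only [_root_.sub_apply, _root_.smul_apply, mul_apply_eq_comp]
  abel

/-- Three contributions: the second derivative of `φ`, the moving direction `z`, handled by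
`phiDeriv_bracket`, and the moving argument `x`, which cancels one quadratic term of the second
derivative. -/
theorem hasEulerDerivAt_phiDeriv (h : IsMetrized br B) {u : V} {τ : ℂ}
    (hu : IsUnit (phiDen (br (τ • u)))) (z x : V) :
    HasEulerDerivAt (fun t ↦ phiDeriv br (t • u) (phiDen (br (t • u)) z) (phiDen (br (t • u)) x))
      ((4⁻¹ : ℂ) • br (phiDen (br (τ • u)) z) (phiDen (br (τ • u)) x) -
        (3 : ℂ) • phiDeriv br (τ • u) (phiDen (br (τ • u)) z) (phiDen (br (τ • u)) x) -
        phi (br (τ • u)) (br (phiDen (br (τ • u)) z)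
          (phi (br (τ • u)) (phiDen (br (τ • u)) x))) -
        phi (br (τ • u)) (br (τ • u)
          (phiDeriv br (τ • u) (phiDen (br (τ • u)) z) (phiDen (br (τ • u)) x))) +
        phi (br (τ • u)) (br (phi (br (τ • u)) (phiDen (br (τ • u)) z))
          (phiDen (br (τ • u)) x)) -
        br (phi (br (τ • u)) (phiDen (br (τ • u)) z))
          (phi (br (τ • u)) (phiDen (br (τ • u)) x))) τ := by
  have hu' : IsUnit (phiDen (τ • br u)) := by rwa [← map_smul]
  have hdiff : DifferentiableAt ℂ (fderiv ℂ (phi : (V →L[ℂ] V) → V →L[ℂ] V)) (τ • br u) :=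
    (analyticAt_phi hu').fderiv.differentiableAt
  have h1 := HasEulerDerivAt.comp_ray (V := V →L[ℂ] V) (W := (V →L[ℂ] V) →L[ℂ] (V →L[ℂ] V))
    (F := fderiv ℂ (phi : (V →L[ℂ] V) → V →L[ℂ] V)) hdiff
  have h2 := (hasEulerDerivAt_phiDen hu z).clm br
  have h3 := (h1.apply h2).apply (hasEulerDerivAt_phiDen hu x)
  simp only [← map_smul] at h3
  refine h3.congr_eq ?_
  have e1 := phiDeriv_bracket h hu (phi (br (τ • u)) (phiDen (br (τ • u)) z))
    (phiDen (br (τ • u)) x)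
  have e2 : fderiv ℂ phi (br (τ • u)) (br (br (τ • u) (phi (br (τ • u)) (phiDen (br (τ • u)) z)))) =
    phiDeriv br (τ • u) (br (τ • u) (phi (br (τ • u)) (phiDen (br (τ • u)) z))) := rfl
  rw [fderiv_fderiv_phi_apply hu, _root_.add_apply, e2, e1]
  simp only [_root_.sub_apply, _root_.smul_apply, mul_apply_eq_comp, Function.comp_apply, phiDeriv]
  abel

/-- The differential equation for the defect. Apart from the multiple `-3`, all terms produced by
the product rule are instances of the fact that `W` is a derivation preserving the form. -/
theorem hasEulerDerivAt_cdybe (h : IsMetrized br B) {u : V} {τ : ℂ}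
    (hu : IsUnit (phiDen (br (τ • u)))) (x y z : V) :
    HasEulerDerivAt (fun t ↦ cdybe br B (t • u) (phiDen (br (t • u)) x) (phiDen (br (t • u)) y)
        (phiDen (br (t • u)) z))
      (-(3 : ℂ) • cdybe br B (τ • u) (phiDen (br (τ • u)) x) (phiDen (br (τ • u)) y)
        (phiDen (br (τ • u)) z)) τ := by
  have hX := hasEulerDerivAt_phiDen hu x
  have hY := hasEulerDerivAt_phiDen hu y
  have hZ := hasEulerDerivAt_phiDen hu z
  have hPX := hasEulerDerivAt_phi_phiDen hu x
  have hPY := hasEulerDerivAt_phi_phiDen hu y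
  have hPZ := hasEulerDerivAt_phi_phiDen hu z
  have hd := ((((((hZ.bilin B (hPX.bilin br hPY)).add (hX.bilin B (hPY.bilin br hPZ))).add
    (hY.bilin B (hPZ.bilin br hPX))).sub (hY.bilin B (hasEulerDerivAt_phiDeriv h hu z x))).sub
    (hZ.bilin B (hasEulerDerivAt_phiDeriv h hu x y))).sub
    (hX.bilin B (hasEulerDerivAt_phiDeriv h hu y z))).add
    ((hZ.bilin B (hX.bilin br hY)).const_smul (4⁻¹ : ℂ))
  refine hd.congr_eq ?_
  clear hd hPX hPY hPZ hX hY hZ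
  have hsk : ∀ a b, B (br (τ • u) a) b = -B a (br (τ • u) b) := fun a b ↦ h.inv _ _ _
  have hφ := phi_skewAdjoint hsk hu
  have hφ' : ∀ a b, B a (phi (br (τ • u)) b) = -B (phi (br (τ • u)) a) b := fun a b ↦ by
    rw [hφ, neg_neg]
  have hsk' : ∀ a b, B a (br (τ • u) b) = -B (br (τ • u) a) b := fun a b ↦ by
    rw [hsk, neg_neg]
  have hT : ∀ a b c, B a (br b c) = B b (br c a) := fun a b c ↦ by
    rw [h.symm a, h.skew b c, map_neg, neg_apply, h.inv, neg_neg]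
  have hT' : ∀ a b c, B a (br b c) = B c (br a b) := fun a b c ↦ by rw [hT, hT]
  -- The invariant trilinear form `B(a, [b, c])` is annihilated by the derivation `ad (τ u)`.
  have hD : ∀ a b c, B (br (τ • u) a) (br b c) + B a (br (br (τ • u) b) c) +
      B a (br b (br (τ • u) c)) = 0 := fun a b c ↦ by
    rw [hsk, h.jacobi, map_add]; ring
  have hWφ : ∀ a, br (τ • u) (phi (br (τ • u)) a) = phi (br (τ • u)) (br (τ • u) a) := fun a ↦
    (DFunLike.congr_fun (commute_phi hu (Commute.refl (br (τ • u)))).eq a).symm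
  unfold cdybe
  generalize phiDen (br (τ • u)) x = X
  generalize phiDen (br (τ • u)) y = Y
  generalize phiDen (br (τ • u)) z = Z
  generalize hQ1 : phiDeriv br (τ • u) X Y = Q1
  generalize hQ2 : phiDeriv br (τ • u) Y Z = Q2
  generalize hQ3 : phiDeriv br (τ • u) Z X = Q3
  clear hu
  generalize br (τ • u) = W at *
  simp only [map_add, map_sub, map_smul, _root_.add_apply, _root_.sub_apply, _root_.smul_apply,
    smul_eq_mul, hφ']
  generalize hPX : phi (W) X = PX
  generalize hPY : phi (W) Y = PY
  generalize hPZ : phi (W) Z = PZ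
  simp only [hsk' PX, hsk' PY, hsk' PZ]
  simp only [hT Z, hT PZ, hT (W Z), hT (W PZ), hT' Y, hT' PY, hT' (W Y),
    hT' (W PY)]
  -- The cubic terms in `φ` vanish by the derivation identity on `φX, φY, φZ`; those linear in `φ`,
  -- with factor one quarter, vanish by its three instances with one such argument.
  linear_combination hD PX PY PZ + 4⁻¹ * hD X Y PZ + 4⁻¹ * hD X PY Z + 4⁻¹ * hD PX Y Z

/-- The classical dynamical Yang-Baxter equation for the Alekseev-Meinrenken r-matrix. -/
theorem cdybe_eq_zero [FiniteDimensional ℂ V] (h : IsMetrized br B) {u : V}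
    (hu : IsUnit (phiDen (br u))) (x y z : V) : cdybe br B u x y z = 0 := by
  set S : Set ℂ := {t | (phiDen (br (t • u))).det ≠ 0}
  have hS : ∀ t, t ∈ S ↔ IsUnit (phiDen (br (t • u))) := fun t ↦ (isUnit_iff_det_ne_zero _).symm
  have han : ∀ t : ℂ, AnalyticAt ℂ (fun t : ℂ ↦ (phiDen (br (t • u))).det) t := fun t ↦ by
    have h1 : AnalyticAt ℂ (fun t : ℂ ↦ br (t • u)) t :=
      (br.analyticAt _).comp (analyticAt_id.smul analyticAt_const)
    exact (analyticAt_det _).comp ((analyticAt_phiDen _).comp h1)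
  have hopen : IsOpen S := isOpen_ne.preimage
    (continuous_iff_continuousAt.2 fun t ↦ (han t).continuousAt)
  have hpre : IsPreconnected S := isPreconnected_setOf_ne_zero han
    ((isUnit_iff_det_ne_zero _).1 (by simp))
  have hinv : ∀ w, ∃ w', phiDen (br u) w' = w := fun w ↦ ⟨Ring.inverse (phiDen (br u)) w, by
    rw [← mul_apply_eq_comp, Ring.mul_inverse_cancel _ hu]; rfl⟩
  -- Every vector is of the form `phiDen (ad u) x`, so testing on the transported vectors at `t = 1`
  -- loses nothing.
  obtain ⟨x, rfl⟩ := hinv x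
  obtain ⟨y, rfl⟩ := hinv y
  obtain ⟨z, rfl⟩ := hinv z
  -- The factor `t³` compensates the degree `-3` and also forces `f 0 = 0`, so the defect at the
  -- origin need not be computed.
  set f : ℂ → ℂ := fun t ↦ t ^ 3 * cdybe br B (t • u) (phiDen (br (t • u)) x)
    (phiDen (br (t • u)) y) (phiDen (br (t • u)) z)
  have hder : ∀ t ∈ S, HasDerivAt f 0 t := fun t ht ↦ by
    obtain ⟨g', hg, he⟩ := hasEulerDerivAt_cdybe h ((hS t).1 ht) x y z
    have := (hasDerivAt_pow 3 t).mul hg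
    refine this.congr_deriv ?_
    simp only [smul_eq_mul] at he
    push_cast
    linear_combination t ^ 2 * he
  have key := hopen.is_const_of_deriv_eq_zero hpre
    (fun t ht ↦ (hder t ht).differentiableAt.differentiableWithinAt)
    (fun t ht ↦ (hder t ht).deriv) ((hS 1).2 (by simpa using hu)) ((hS 0).2 (by simp))
  simpa [f] using key

end CDYBE

/-! ### Casimir elements -/

section Casimir

variable {V M N : Type*} [AddCommGroup V] [Module ℂ V] [FiniteDimensional ℂ V]
  [AddCommGroup M] [Module ℂ M] [AddCommGroup N] [Module ℂ N]
  {B : LinearMap.BilinForm ℂ V}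

theorem sum_smul_dualBasis (hB : B.Nondegenerate) {ξ : V →ₗ[ℂ] ℂ} {x : V} (hx : B x = ξ) :
    ∑ i, ξ (Module.finBasis ℂ V i) • B.dualBasis hB (Module.finBasis ℂ V) i = x := by
  conv_rhs => rw [← (B.dualBasis hB (Module.finBasis ℂ V)).sum_repr x]
  simp only [LinearMap.BilinForm.dualBasis_repr_apply, hx]

/-- Contracting a Casimir element in its first slot with a functional returns the vector dual to
that functional. Via this rule the tensors become operators on `𝔤`. -/
theorem dualDistrib_map_casimir (hB : B.Nondegenerate) (S : V →ₗ[ℂ] M) (T : V →ₗ[ℂ] N)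
    (ξ : Module.Dual ℂ M) (η : Module.Dual ℂ N) {x : V} (hx : B x = ξ ∘ₗ S) :
    TensorProduct.dualDistrib ℂ M N (ξ ⊗ₜ η) (TensorProduct.map S T (casimir B)) = η (T x) := by
  rw [casimir, dif_pos hB, map_sum, map_sum, ← sum_smul_dualBasis hB hx, map_sum, map_sum]
  simp

theorem dualDistrib_map_lTensor_casimir (hB : B.Nondegenerate) (S : V →ₗ[ℂ] M) (T : V →ₗ[ℂ] N)
    (A : V →ₗ[ℂ] V) (ξ : Module.Dual ℂ M) (η : Module.Dual ℂ N) {x : V} (hx : B x = ξ ∘ₗ S) :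
    TensorProduct.dualDistrib ℂ M N (ξ ⊗ₜ η)
      (TensorProduct.map S T (LinearMap.lTensor V A (casimir B))) = η (T (A x)) := by
  rw [LinearMap.lTensor, ← LinearMap.comp_apply (TensorProduct.map S T),
    ← TensorProduct.map_comp, LinearMap.comp_id,
    dualDistrib_map_casimir hB S (T ∘ₗ A) ξ η hx]
  rfl

theorem dualDistrib_comm (τ : M ⊗[ℂ] N) (ξ : Module.Dual ℂ N) (η : Module.Dual ℂ M) :
    TensorProduct.dualDistrib ℂ N M (ξ ⊗ₜ η) (TensorProduct.comm ℂ M N τ) =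
      TensorProduct.dualDistrib ℂ M N (η ⊗ₜ ξ) τ := by
  induction τ with
  | zero => simp
  | tmul x y => simp [mul_comm]
  | add x y hx hy => simp [hx, hy]

/-- In finite dimension every functional on the tensor product is a sum of pure tensors of
functionals; identities of bivectors can therefore be tested on brackets. -/
theorem eq_of_dualDistrib_eq [FiniteDimensional ℂ M] [FiniteDimensional ℂ N] {σ τ : M ⊗[ℂ] N}
    (h : ∀ (ξ : Module.Dual ℂ M) (η : Module.Dual ℂ N),
      TensorProduct.dualDistrib ℂ M N (ξ ⊗ₜ η) σ = TensorProduct.dualDistrib ℂ M N (ξ ⊗ₜ η) τ) :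
    σ = τ := by
  have h2 : ∀ ζ : Module.Dual ℂ M ⊗[ℂ] Module.Dual ℂ N,
      TensorProduct.dualDistrib ℂ M N ζ σ = TensorProduct.dualDistrib ℂ M N ζ τ := by
    intro ζ
    induction ζ with
    | zero => simp
    | tmul x y => exact h x y
    | add x y hx hy => simp [hx, hy]
  rw [← sub_eq_zero, ← Module.forall_dual_apply_eq_zero_iff ℂ]
  intro f
  obtain ⟨ζ, rfl⟩ := (TensorProduct.dualDistribEquiv ℂ M N).surjective f
  rw [map_sub, sub_eq_zero]
  exact h2 ζ

theorem dualDistrib_eq_contract (ξ η : Module.Dual ℂ M) (τ : M ⊗[ℂ] M) :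
    TensorProduct.dualDistrib ℂ M M (ξ ⊗ₜ η) τ =
      η (TensorProduct.lid ℂ M (LinearMap.rTensor M ξ τ)) := by
  induction τ with
  | zero => simp
  | tmul x y => simp
  | add x y hx hy => simp only [map_add, hx, hy]

/-- The orthogonal projection to a subspace on which the form is nondegenerate. -/
theorem exists_orthogonal_projection (W : Submodule ℂ V)
    (hW : ∀ x ∈ W, (∀ y ∈ W, B x y = 0) → x = 0) :
    ∃ p : V →ₗ[ℂ] V, (∀ x, p x ∈ W) ∧ ∀ x, ∀ y ∈ W, B (p x) y = B x y := by
  let f : W →ₗ[ℂ] Module.Dual ℂ W := LinearMap.compl₁₂ B W.subtype W.subtype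
  have hf : Function.Injective f := by
    rw [← LinearMap.ker_eq_bot, LinearMap.ker_eq_bot']
    intro x hx
    refine Subtype.ext (hW x x.2 fun y hy ↦ ?_)
    exact DFunLike.congr_fun hx ⟨y, hy⟩
  let F : W ≃ₗ[ℂ] Module.Dual ℂ W :=
    LinearEquiv.ofInjectiveOfFinrankEq f hf Subspace.dual_finrank_eq.symm
  refine ⟨W.subtype ∘ₗ F.symm.toLinearMap ∘ₗ (B.compl₂ W.subtype), fun x ↦ ?_, fun x y hy ↦ ?_⟩
  · simp
  · have := DFunLike.congr_fun (F.apply_symm_apply (B.compl₂ W.subtype x)) (⟨y, hy⟩ : W)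
    exact this

end Casimir

/-! ### Reductive Lie algebras with an invariant form -/

section Reductive

variable {𝔨 : Type*} [LieRing 𝔨] [LieAlgebra ℂ 𝔨] [FiniteDimensional ℂ 𝔨]

/-- A reductive Lie algebra with a nondegenerate invariant form and a Cartan subalgebra. -/
structure IsMetricReductive (B : LinearMap.BilinForm ℂ 𝔨) (𝔱 : LieSubalgebra ℂ 𝔨) : Prop where
  reductive : IsReductive 𝔨
  symm : ∀ x y, B x y = B y x
  nondeg : ∀ x, (∀ y, B x y = 0) → x = 0
  inv : ∀ x y z : 𝔨, B ⁅x, y⁆ z = -B y ⁅x, z⁆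
  cartan : IsCartan 𝔱

/-- A complementary ideal of the center contains all brackets, so the center meets the span of
brackets trivially. -/
theorem eq_zero_of_central_of_mem_span_bracket (hred : IsReductive 𝔨) {s : 𝔨}
    (hc : ∀ x : 𝔨, ⁅s, x⁆ = 0) (hs : s ∈ Submodule.span ℂ {z | ∃ x y : 𝔨, ⁅x, y⁆ = z}) : s = 0 := by
  obtain ⟨b, hb⟩ := hred (LieAlgebra.center ℂ 𝔨)
  have hcen : s ∈ LieAlgebra.center ℂ 𝔨 := by
    rw [LieModule.mem_maxTrivSubmodule]
    intro x
    rw [← lie_skew, hc, neg_zero]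
  have hle : Submodule.span ℂ {z | ∃ x y : 𝔨, ⁅x, y⁆ = z} ≤ b.toSubmodule := by
    rw [Submodule.span_le]
    rintro _ ⟨x, y, rfl⟩
    have hx : x ∈ LieAlgebra.center ℂ 𝔨 ⊔ b := by rw [hb.sup_eq_top]; trivial
    obtain ⟨z, hz, w, hw, rfl⟩ := (LieSubmodule.mem_sup _ _ _).1 hx
    rw [LieModule.mem_maxTrivSubmodule] at hz
    rw [add_lie, ← lie_skew z, hz, neg_zero, zero_add]
    exact lie_mem_left ℂ 𝔨 b w y hw
  have : s ∈ LieAlgebra.center ℂ 𝔨 ⊓ b := ⟨hcen, hle hs⟩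
  rw [hb.inf_eq_bot] at this
  simpa using this

/-- On an eigenspace of `ad s` the brackets of elements commuting with `s` act as commutators, hence
with trace zero; but `s` acts there with trace the eigenvalue times the dimension. All eigenvalues
vanish, so `s` is central, and it is a sum of brackets. -/
theorem eq_zero_of_mem_span_bracket (hred : IsReductive 𝔨) {s : 𝔨}
    (hss : (LieAlgebra.ad ℂ 𝔨 s).IsSemisimple)
    (hs : s ∈ Submodule.span ℂ {z | ∃ x y : 𝔨, ⁅s, x⁆ = 0 ∧ ⁅s, y⁆ = 0 ∧ ⁅x, y⁆ = z}) : s = 0 := by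
  have had : LieAlgebra.ad ℂ 𝔨 s = 0 := by
    refine hss.eq_zero_iff_forall_eigenvalue.2 fun c hc ↦ ?_
    set W := (LieAlgebra.ad ℂ 𝔨 s : Module.End ℂ 𝔨).eigenspace c
    have hW : ∀ x : 𝔨, ⁅s, x⁆ = 0 → ∀ w ∈ W, LieAlgebra.ad ℂ 𝔨 x w ∈ W := fun x hx w hw ↦ by
      rw [Module.End.mem_eigenspace_iff] at hw ⊢
      simp only [LieAlgebra.ad_apply] at hw ⊢
      rw [leibniz_lie, hx, zero_lie, zero_add, hw, lie_smul]
    have key : ∃ h : ∀ w ∈ W, LieAlgebra.ad ℂ 𝔨 s w ∈ W,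
        LinearMap.trace ℂ W ((LieAlgebra.ad ℂ 𝔨 s).restrict h) = 0 := by
      refine Submodule.span_induction (p := fun z _ ↦ ∃ h : ∀ w ∈ W, LieAlgebra.ad ℂ 𝔨 z w ∈ W,
        LinearMap.trace ℂ W ((LieAlgebra.ad ℂ 𝔨 z).restrict h) = 0) ?_ ?_ ?_ ?_ hs
      · rintro _ ⟨x, y, hx, hy, rfl⟩
        refine ⟨fun w hw ↦ ?_, ?_⟩
        · rw [LieAlgebra.ad_apply, lie_lie]
          exact W.sub_mem (hW x hx _ (hW y hy w hw)) (hW y hy _ (hW x hx w hw))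
        · have e : (LieAlgebra.ad ℂ 𝔨 ⁅x, y⁆).restrict (fun w hw ↦ by
              rw [LieAlgebra.ad_apply, lie_lie]
              exact W.sub_mem (hW x hx _ (hW y hy w hw)) (hW y hy _ (hW x hx w hw))) =
              (LieAlgebra.ad ℂ 𝔨 x).restrict (hW x hx) * (LieAlgebra.ad ℂ 𝔨 y).restrict (hW y hy) -
              (LieAlgebra.ad ℂ 𝔨 y).restrict (hW y hy) *
                (LieAlgebra.ad ℂ 𝔨 x).restrict (hW x hx) := by
            ext w
            simp [LinearMap.restrict_apply]
          rw [e, map_sub, LinearMap.trace_mul_comm, sub_self]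
      · exact ⟨by simp, by
          have : (LieAlgebra.ad ℂ 𝔨 (0 : 𝔨)).restrict (p := W) (q := W) (by simp) = 0 := by
            ext; simp [LinearMap.restrict_apply]
          rw [this, map_zero]⟩
      · rintro x y - - ⟨hx, tx⟩ ⟨hy, ty⟩
        refine ⟨fun w hw ↦ by rw [map_add]; exact W.add_mem (hx w hw) (hy w hw), ?_⟩
        have : (LieAlgebra.ad ℂ 𝔨 (x + y)).restrict (p := W) (q := W)
            (fun w hw ↦ by rw [map_add]; exact W.add_mem (hx w hw) (hy w hw)) =
            (LieAlgebra.ad ℂ 𝔨 x).restrict hx + (LieAlgebra.ad ℂ 𝔨 y).restrict hy := by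
          ext; simp [LinearMap.restrict_apply]
        rw [this, map_add, tx, ty, add_zero]
      · rintro a x - ⟨hx, tx⟩
        refine ⟨fun w hw ↦ by rw [map_smul]; exact W.smul_mem a (hx w hw), ?_⟩
        have : (LieAlgebra.ad ℂ 𝔨 (a • x)).restrict (p := W) (q := W)
            (fun w hw ↦ by rw [map_smul]; exact W.smul_mem a (hx w hw)) =
            a • (LieAlgebra.ad ℂ 𝔨 x).restrict hx := by
          ext; simp [LinearMap.restrict_apply]
        rw [this, map_smul, tx, smul_zero]
    obtain ⟨h, ht⟩ := key
    have e : (LieAlgebra.ad ℂ 𝔨 s).restrict h = c • (1 : Module.End ℂ W) := by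
      ext w
      have := Module.End.mem_eigenspace_iff.1 w.2
      simpa [LinearMap.restrict_apply] using this
    rw [e, map_smul, LinearMap.trace_one, smul_eq_mul, mul_eq_zero] at ht
    refine ht.resolve_right ?_
    have : W ≠ ⊥ := hc
    have h1 := Submodule.one_le_finrank_iff.2 this
    exact_mod_cast (by omega : Module.finrank ℂ W ≠ 0)
  refine eq_zero_of_central_of_mem_span_bracket hred (fun x ↦ ?_)
    (Submodule.span_mono ?_ hs)
  · rw [← LieAlgebra.ad_apply ℂ, had]; rfl
  · rintro _ ⟨x, y, -, -, rfl⟩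
    exact ⟨x, y, rfl⟩

variable {𝔱 : LieSubalgebra ℂ 𝔨}

theorem IsCartan.lie_eq_zero (h : IsCartan 𝔱) {x y : 𝔨} (hx : x ∈ 𝔱) (hy : y ∈ 𝔱) : ⁅x, y⁆ = 0 :=
  (h.centralizer y).1 hy x hx

theorem IsCartan.mem_of_weight_zero (h : IsCartan 𝔱) {x : 𝔨} (hx : IsWeightVector 𝔱 0 x) : x ∈ 𝔱 :=
  (h.centralizer x).2 fun s hs ↦ by simpa using hx ⟨s, hs⟩

theorem IsCartan.isWeightVector_zero (h : IsCartan 𝔱) {x : 𝔨} (hx : x ∈ 𝔱) :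
    IsWeightVector 𝔱 0 x := fun s ↦ by
  rw [h.lie_eq_zero s.2 hx]; simp

theorem IsCartan.commute_ad (h : IsCartan 𝔱) (s t : 𝔱) :
    Commute (LieAlgebra.ad ℂ 𝔨 s : Module.End ℂ 𝔨) (LieAlgebra.ad ℂ 𝔨 t) := by
  ext x
  simp only [Module.End.mul_apply, LieAlgebra.ad_apply]
  rw [leibniz_lie, h.lie_eq_zero s.2 t.2, zero_lie, zero_add]

theorem IsCartan.mem_iInf_iff (h : IsCartan 𝔱) (χ : 𝔱 → ℂ) (x : 𝔨) :
    x ∈ ⨅ s : 𝔱, (LieAlgebra.ad ℂ 𝔨 s : Module.End ℂ 𝔨).maxGenEigenspace (χ s) ↔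
      ∀ s : 𝔱, ⁅(s : 𝔨), x⁆ = χ s • x := by
  rw [Submodule.mem_iInf]
  refine forall_congr' fun s ↦ ?_
  rw [(h.semisimple s s.2).isFinitelySemisimple.maxGenEigenspace_eq_eigenspace,
    Module.End.mem_eigenspace_iff, LieAlgebra.ad_apply]

theorem IsCartan.span_weightVectors (h : IsCartan 𝔱) :
    Submodule.span ℂ {x : 𝔨 | ∃ α, IsWeightVector 𝔱 α x} = ⊤ := by
  rw [eq_top_iff, ← Module.End.iSup_iInf_maxGenEigenspace_eq_top_of_iSup_maxGenEigenspace_eq_top_of_commute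
    (fun s : 𝔱 ↦ (LieAlgebra.ad ℂ 𝔨 s : Module.End ℂ 𝔨)) (fun s t _ ↦ h.commute_ad s t)
    (fun s ↦ Module.End.iSup_maxGenEigenspace_eq_top _)]
  refine iSup_le fun χ x hx ↦ ?_
  rw [h.mem_iInf_iff] at hx
  by_cases hx0 : x = 0
  · rw [hx0]; exact zero_mem _
  -- A simultaneous eigenvalue is automatically linear in `s`, since the bracket is linear and the
  -- eigenvector is nonzero.
  refine Submodule.subset_span ⟨⟨⟨χ, fun s t ↦ ?_⟩, fun c s ↦ ?_⟩, hx⟩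
  · refine smul_left_injective ℂ hx0 ?_
    simp only [add_smul, ← hx]
    simp
  · refine smul_left_injective ℂ hx0 ?_
    simp only [RingHom.id_apply, smul_eq_mul, mul_smul, ← hx]
    simp

/-- Simultaneous eigenspaces are independent, and only finitely many independent subspaces of a
finite-dimensional space are nonzero. -/
theorem IsCartan.finite_roots (h : IsCartan 𝔱) : (roots 𝔱).Finite := by
  have hind := Module.End.independent_iInf_maxGenEigenspace_of_forall_mapsTo
    (fun s : 𝔱 ↦ (LieAlgebra.ad ℂ 𝔨 s : Module.End ℂ 𝔨))
    (fun s t φ ↦ Module.End.mapsTo_maxGenEigenspace_of_comm (h.commute_ad t s) φ)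
  have hfin := WellFoundedGT.finite_ne_bot_of_iSupIndep hind
  refine Set.Finite.of_finite_image (f := fun α : Module.Dual ℂ 𝔱 ↦ (α : 𝔱 → ℂ))
    (hfin.subset ?_) DFunLike.coe_injective.injOn
  rintro _ ⟨α, ⟨-, x, hx0, hx⟩, rfl⟩ hbot
  have : x ∈ (⊥ : Submodule ℂ 𝔨) := hbot ▸ (h.mem_iInf_iff α x).2 hx
  exact hx0 (by simpa using this)


theorem IsCartan.weight_induction (h : IsCartan 𝔱) {p : 𝔨 → Prop}
    (hw : ∀ α x, IsWeightVector 𝔱 α x → p x) (h0 : p 0) (hadd : ∀ x y, p x → p y → p (x + y))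
    (hsmul : ∀ (c : ℂ) x, p x → p (c • x)) (x : 𝔨) : p x := by
  have hx : x ∈ Submodule.span ℂ {x : 𝔨 | ∃ α, IsWeightVector 𝔱 α x} := by
    rw [h.span_weightVectors]; trivial
  induction hx using Submodule.span_induction with
  | mem x hx => obtain ⟨α, hα⟩ := hx; exact hw α x hα
  | zero => exact h0
  | add x y _ _ hx hy => exact hadd x y hx hy
  | smul c x _ hx => exact hsmul c x hx

theorem IsWeightVector.smul {α : Module.Dual ℂ 𝔱} {x : 𝔨} (h : IsWeightVector 𝔱 α x) (c : ℂ) :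
    IsWeightVector 𝔱 α (c • x) := fun s ↦ by
  rw [lie_smul, h s, smul_comm]

theorem IsWeightVector.sub {α : Module.Dual ℂ 𝔱} {x y : 𝔨} (h : IsWeightVector 𝔱 α x)
    (h' : IsWeightVector 𝔱 α y) : IsWeightVector 𝔱 α (x - y) := fun s ↦ by
  rw [lie_sub, h s, h' s, smul_sub]

theorem IsWeightVector.lie {α β : Module.Dual ℂ 𝔱} {x y : 𝔨} (h : IsWeightVector 𝔱 α x)
    (h' : IsWeightVector 𝔱 β y) : IsWeightVector 𝔱 (α + β) ⁅x, y⁆ := fun s ↦ by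
  rw [leibniz_lie, h s, h' s, smul_lie, lie_smul, LinearMap.add_apply, add_smul]

variable {B : LinearMap.BilinForm ℂ 𝔨}

namespace IsMetricReductive

theorem nondegenerate (h : IsMetricReductive B 𝔱) : B.Nondegenerate :=
  ⟨h.nondeg, fun x hx ↦ h.nondeg x fun y ↦ by rw [h.symm]; exact hx y⟩

theorem inv' (h : IsMetricReductive B 𝔱) (x y z : 𝔨) : B ⁅x, y⁆ z = B x ⁅y, z⁆ := by
  rw [← lie_skew, map_neg, LinearMap.neg_apply, h.inv, neg_neg]

theorem weight_orthogonal (h : IsMetricReductive B 𝔱) {α β : Module.Dual ℂ 𝔱} {x y : 𝔨}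
    (hx : IsWeightVector 𝔱 α x) (hy : IsWeightVector 𝔱 β y) (hne : β ≠ -α) : B x y = 0 := by
  by_contra h0
  refine hne (LinearMap.ext fun s ↦ ?_)
  have := h.inv (s : 𝔨) x y
  rw [hx s, hy s] at this
  simp only [map_smul, LinearMap.smul_apply, smul_eq_mul] at this
  have h2 : (α s + β s) * B x y = 0 := by linear_combination this
  rw [LinearMap.neg_apply]
  linear_combination (mul_eq_zero.1 h2).resolve_right h0

theorem exists_opposite (h : IsMetricReductive B 𝔱) {α : Module.Dual ℂ 𝔱} {x : 𝔨}
    (hx : IsWeightVector 𝔱 α x) (h0 : x ≠ 0) : ∃ y, IsWeightVector 𝔱 (-α) y ∧ B x y ≠ 0 := by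
  by_contra! hc
  refine h0 (h.nondeg x fun y ↦ ?_)
  refine h.cartan.weight_induction (p := fun y ↦ B x y = 0) (fun β y hy ↦ ?_) (by simp)
    (fun y z hy hz ↦ by simp [hy, hz]) (fun c y hy ↦ by simp [hy]) y
  by_cases hβ : β = -α
  · exact hc y (hβ ▸ hy)
  · exact h.weight_orthogonal hx hy hβ

theorem neg_mem_roots (h : IsMetricReductive B 𝔱) {α : Module.Dual ℂ 𝔱} (hα : α ∈ roots 𝔱) :
    -α ∈ roots 𝔱 := by
  obtain ⟨h0, x, hx0, hx⟩ := hα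
  obtain ⟨y, hy, hxy⟩ := h.exists_opposite hx hx0
  exact ⟨neg_ne_zero.2 h0, y, by rintro rfl; simp at hxy, hy⟩

theorem nondeg_cartan (h : IsMetricReductive B 𝔱) {x : 𝔨} (hx : x ∈ 𝔱)
    (h0 : ∀ y ∈ 𝔱, B x y = 0) : x = 0 := by
  by_contra hne
  obtain ⟨y, hy, hxy⟩ := h.exists_opposite (h.cartan.isWeightVector_zero hx) hne
  rw [neg_zero] at hy
  exact hxy (h0 y (h.cartan.mem_of_weight_zero hy))

theorem lie_weight_opposite (h : IsMetricReductive B 𝔱) {α : Module.Dual ℂ 𝔱} {x y : 𝔨}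
    (hx : IsWeightVector 𝔱 (-α) x) (hy : IsWeightVector 𝔱 α y) (s : 𝔱) :
    B ⁅x, y⁆ s = -(α s * B x y) := by
  rw [h.symm, ← h.inv', hx s]
  simp

/-- If `α` vanished on `s = [x, y]`, then `x` and `y` would commute with the semisimple element `s`,
forcing `s = 0`; but `s` pairs with `𝔱` as a nonzero multiple of `α`. -/
theorem coroot_ne_zero (h : IsMetricReductive B 𝔱) {α : Module.Dual ℂ 𝔱} (hα : α ≠ 0) {x y : 𝔨}
    (hx : IsWeightVector 𝔱 (-α) x) (hy : IsWeightVector 𝔱 α y) (hxy : B x y ≠ 0)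
    (s : 𝔱) (hs : ⁅x, y⁆ = s) : α s ≠ 0 := by
  intro h0
  have hz : (s : 𝔨) = 0 := by
    refine eq_zero_of_mem_span_bracket h.reductive (h.cartan.semisimple s s.2)
      (Submodule.subset_span ⟨x, y, ?_, ?_, hs⟩)
    · rw [hx s]; simp [h0]
    · rw [hy s]; simp [h0]
  refine hα (LinearMap.ext fun u ↦ ?_)
  have := h.lie_weight_opposite hx hy u
  rw [hs, hz] at this
  simp only [map_zero, LinearMap.zero_apply, zero_eq_neg, mul_eq_zero] at this ⊢
  exact this.resolve_right hxy

/-- Root spaces are one-dimensional. -/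
theorem root_space_dim_one (h : IsMetricReductive B 𝔱) {α : Module.Dual ℂ 𝔱} (hα : α ≠ 0)
    {x y : 𝔨} (hx : IsWeightVector 𝔱 (-α) x) (hy : IsWeightVector 𝔱 α y) (hxy : B x y = 1)
    {z : 𝔨} (hz : IsWeightVector 𝔱 α z) : z = B x z • y := by
  have key : ∀ w, IsWeightVector 𝔱 α w → B x w = 0 → w = 0 := by
    intro w hw hxw
    by_contra hw0
    have hmem : ∀ v, IsWeightVector 𝔱 α v → ⁅x, v⁆ ∈ 𝔱 := fun v hv ↦
      h.cartan.mem_of_weight_zero (by simpa using hx.lie hv)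
    have hlie : ⁅x, w⁆ = 0 := h.nondeg_cartan (hmem w hw) fun s hs ↦ by
      rw [h.lie_weight_opposite hx hw ⟨s, hs⟩, hxw, mul_zero, neg_zero]
    set s : 𝔱 := ⟨⁅x, y⁆, hmem y hy⟩
    have hs0 : α s ≠ 0 := h.coroot_ne_zero hα hx hy (by rw [hxy]; exact one_ne_zero) s rfl
    have hsx : ⁅⁅x, y⁆, x⁆ = -(α s) • x := by
      have := hx s; rwa [LinearMap.neg_apply] at this
    have hsy : ⁅⁅x, y⁆, y⁆ = α s • y := hy s
    have hsw : ⁅⁅x, y⁆, w⁆ = α s • w := hw s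
    -- The raising element is `x`, of weight `-α`; the factor `-2 / α(s)` therefore gives `[h, x] =
    -- 2x`.
    have trip : IsSl2Triple ((-2 / α s) • ⁅x, y⁆) x ((-2 / α s) • y) := by
      refine ⟨?_, by rw [lie_smul], ?_, ?_⟩
      · refine smul_ne_zero (div_ne_zero (by norm_num) hs0) fun h0 ↦ hs0 ?_
        have : s = 0 := Subtype.ext h0
        rw [this, map_zero]
      · rw [smul_lie, hsx, smul_smul, ← Nat.cast_smul_eq_nsmul ℂ]
        congr 1
        push_cast
        field_simp
      · rw [smul_lie, lie_smul, hsy, smul_smul, ← Nat.cast_smul_eq_nsmul ℂ, smul_smul, smul_smul,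
          ← neg_smul]
        congr 1
        push_cast
        field_simp
    -- A second root vector orthogonal to `x` would be killed by the raising element and have weight
    -- `-2`, whereas primitive weights in finite dimension are natural numbers.
    have prim : trip.HasPrimitiveVectorWith w (-2 : ℂ) := by
      refine ⟨hw0, ?_, hlie⟩
      rw [smul_lie, hsw, smul_smul]
      congr 1
      field_simp
    obtain ⟨n, hn⟩ := prim.exists_nat
    have hre := congrArg Complex.re hn
    simp at hre
    have := (Nat.cast_nonneg n : (0 : ℝ) ≤ n)
    linarith
  rw [← sub_eq_zero]
  exact key _ (hz.sub (hy.smul _)) (by simp [hxy])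

end IsMetricReductive

end Reductive

/-! ### The derived algebra of the centralizer of `lam`, and orthogonal projections. -/

section Levi

variable {𝔨 : Type*} [LieRing 𝔨] [LieAlgebra ℂ 𝔨] [FiniteDimensional ℂ 𝔨]
  {𝔱 : LieSubalgebra ℂ 𝔨} {B : LinearMap.BilinForm ℂ 𝔨}

/-- `p` is the `B`-orthogonal projection to the subspace `W`, on which `B` is nondegenerate. -/
structure IsOrthProj (B : LinearMap.BilinForm ℂ 𝔨) (W : Submodule ℂ 𝔨) (p : 𝔨 →ₗ[ℂ] 𝔨) : Prop where
  nondeg : ∀ x ∈ W, (∀ y ∈ W, B x y = 0) → x = 0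
  mem : ∀ x, p x ∈ W
  pairing : ∀ x, ∀ y ∈ W, B (p x) y = B x y

namespace IsOrthProj

variable {W : Submodule ℂ 𝔨} {p : 𝔨 →ₗ[ℂ] 𝔨}

theorem eq_of_pairing (hp : IsOrthProj B W p) {x w : 𝔨} (hw : w ∈ W)
    (h : ∀ y ∈ W, B w y = B x y) : p x = w := by
  rw [← sub_eq_zero]
  refine hp.nondeg _ (W.sub_mem (hp.mem x) hw) fun y hy ↦ ?_
  rw [map_sub, LinearMap.sub_apply, hp.pairing x y hy, h y hy, sub_self]

theorem apply_of_mem (hp : IsOrthProj B W p) {w : 𝔨} (hw : w ∈ W) : p w = w :=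
  hp.eq_of_pairing hw fun _ _ ↦ rfl

theorem idem (hp : IsOrthProj B W p) (x : 𝔨) : p (p x) = p x := hp.apply_of_mem (hp.mem x)

theorem selfAdjoint (hp : IsOrthProj B W p) (hs : ∀ x y, B x y = B y x) (x y : 𝔨) :
    B (p x) y = B x (p y) := by
  rw [hs _ y, ← hp.pairing y _ (hp.mem x), hs, hp.pairing x _ (hp.mem y)]

theorem pairing' (hp : IsOrthProj B W p) (hs : ∀ x y, B x y = B y x) {x y : 𝔨} (hx : x ∈ W) :
    B x (p y) = B x y := by
  rw [← hp.selfAdjoint hs, hp.apply_of_mem hx]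

theorem apply_lie (hp : IsOrthProj B W p) (hinv : ∀ x y z : 𝔨, B ⁅x, y⁆ z = -B y ⁅x, z⁆) {s : 𝔨}
    (hs : ∀ w ∈ W, ⁅s, w⁆ ∈ W) (x : 𝔨) : p ⁅s, x⁆ = ⁅s, p x⁆ :=
  hp.eq_of_pairing (hs _ (hp.mem x)) fun y hy ↦ by
    rw [hinv, hinv, hp.pairing x _ (hs y hy)]

theorem exists_of_nondeg (hW : ∀ x ∈ W, (∀ y ∈ W, B x y = 0) → x = 0) :
    ∃ p, IsOrthProj B W p := by
  obtain ⟨p, h1, h2⟩ := exists_orthogonal_projection (B := B) W hW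
  exact ⟨p, hW, h1, h2⟩

end IsOrthProj

theorem lie_mem_leviDerived {lam x y : 𝔨} (hx : ⁅lam, x⁆ = 0) (hy : ⁅lam, y⁆ = 0) :
    ⁅x, y⁆ ∈ leviDerived lam :=
  LieSubalgebra.subset_lieSpan ⟨x, y, hx, hy, rfl⟩

/-- The linear span of the generating brackets is already a subalgebra: its elements commute with
`lam`, so their brackets are again generators. -/
theorem leviDerived_le {lam z : 𝔨} (hz : z ∈ leviDerived lam) : ⁅lam, z⁆ = 0 ∧
    z ∈ Submodule.span ℂ {z | ∃ x y : 𝔨, ⁅lam, x⁆ = 0 ∧ ⁅lam, y⁆ = 0 ∧ ⁅x, y⁆ = z} := by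
  have hcen : ∀ z ∈ Submodule.span ℂ {z | ∃ x y : 𝔨, ⁅lam, x⁆ = 0 ∧ ⁅lam, y⁆ = 0 ∧ ⁅x, y⁆ = z},
      ⁅lam, z⁆ = 0 := by
    intro z hz
    have : Submodule.span ℂ {z | ∃ x y : 𝔨, ⁅lam, x⁆ = 0 ∧ ⁅lam, y⁆ = 0 ∧ ⁅x, y⁆ = z} ≤
        LinearMap.ker (LieAlgebra.ad ℂ 𝔨 lam : 𝔨 →ₗ[ℂ] 𝔨) := by
      rw [Submodule.span_le]
      rintro _ ⟨x, y, hx, hy, rfl⟩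
      rw [SetLike.mem_coe, LinearMap.mem_ker, LieAlgebra.ad_apply, leibniz_lie, hx, hy]
      simp
    exact this hz
  let S : LieSubalgebra ℂ 𝔨 :=
    { Submodule.span ℂ {z | ∃ x y : 𝔨, ⁅lam, x⁆ = 0 ∧ ⁅lam, y⁆ = 0 ∧ ⁅x, y⁆ = z} with
      lie_mem' := fun {x y} hx hy ↦ Submodule.subset_span ⟨x, y, hcen x hx, hcen y hy, rfl⟩ }
  have hle : leviDerived lam ≤ S := LieSubalgebra.lieSpan_le.2 Submodule.subset_span
  exact ⟨hcen z (hle hz), hle hz⟩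

namespace IsMetricReductive

/-- An element `z` of the radical commutes with the whole centralizer of `lam`: weights nonzero on
`lam` pair trivially with `[z, x]`, the others because `z` is orthogonal to brackets. Then `z` lies
in `𝔱`, is semisimple, and is a sum of brackets of elements commuting with it, so it is zero. -/
theorem nondeg_leviDerived (h : IsMetricReductive B 𝔱) (lam : 𝔱) {z : 𝔨}
    (hz : z ∈ (leviDerived (lam : 𝔨)).toSubmodule)
    (h0 : ∀ y ∈ (leviDerived (lam : 𝔨)).toSubmodule, B z y = 0) : z = 0 := by
  obtain ⟨hz1, hz2⟩ := leviDerived_le hz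
  have hcomm : ∀ x : 𝔨, ⁅(lam : 𝔨), x⁆ = 0 → ⁅z, x⁆ = 0 := by
    intro x hx
    refine h.nondeg _ fun y ↦ ?_
    have hzx : ⁅(lam : 𝔨), ⁅z, x⁆⁆ = 0 := by rw [leibniz_lie, hz1, hx]; simp
    refine h.cartan.weight_induction (p := fun y ↦ B ⁅z, x⁆ y = 0) (fun α y hy ↦ ?_) (by simp)
      (fun y w hy hw ↦ by simp [hy, hw]) (fun c y hy ↦ by simp [hy]) y
    by_cases hα : α lam = 0
    · rw [h.inv']
      exact h0 _ (lie_mem_leviDerived hx (by rw [hy lam, hα, zero_smul]))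
    · have h1 := h.inv lam ⁅z, x⁆ y
      rw [hzx, hy lam] at h1
      simp only [map_zero, LinearMap.zero_apply, map_smul, smul_eq_mul, zero_eq_neg,
        mul_eq_zero] at h1
      exact h1.resolve_left hα
  have hzt : z ∈ 𝔱 := (h.cartan.centralizer z).2 fun s hs ↦ by
    rw [← lie_skew, hcomm s (h.cartan.lie_eq_zero lam.2 hs), neg_zero]
  refine eq_zero_of_mem_span_bracket h.reductive (h.cartan.semisimple z hzt)
    (Submodule.span_mono ?_ hz2)
  rintro _ ⟨x, y, hx, hy, rfl⟩
  exact ⟨x, y, hcomm x hx, hcomm y hy, rfl⟩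

/-- A root vector is recovered from its bracket with any `s` in `𝔱` on which the root does not
vanish. -/
theorem weight_mem_leviDerived (h : IsMetricReductive B 𝔱) (lam : 𝔱) {α : Module.Dual ℂ 𝔱}
    (hα : α ≠ 0) (hlam : α lam = 0) {x : 𝔨} (hx : IsWeightVector 𝔱 α x) :
    x ∈ leviDerived (lam : 𝔨) := by
  obtain ⟨s, hs⟩ : ∃ s, α s ≠ 0 := by
    by_contra! hc
    exact hα (LinearMap.ext hc)
  have h1 : ⁅(s : 𝔨), x⁆ ∈ leviDerived (lam : 𝔨) :=
    lie_mem_leviDerived (h.cartan.lie_eq_zero lam.2 s.2) (by rw [hx lam, hlam, zero_smul])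
  rw [hx s] at h1
  have h2 := (leviDerived (lam : 𝔨)).smul_mem (α s)⁻¹ h1
  rwa [inv_smul_smul₀ hs] at h2

theorem lie_cartan_mem_leviDerived (h : IsMetricReductive B 𝔱) (lam s : 𝔱) {x : 𝔨}
    (hx : x ∈ (leviDerived (lam : 𝔨)).toSubmodule) :
    ⁅(s : 𝔨), x⁆ ∈ (leviDerived (lam : 𝔨)).toSubmodule :=
  lie_mem_leviDerived (h.cartan.lie_eq_zero lam.2 s.2) (leviDerived_le hx).1

end IsMetricReductive

/-! ### The standard classical r-matrix -/

/-- The endomorphism corresponding to the standard classical r-matrix. -/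
def rStdEnd (B : LinearMap.BilinForm ℂ 𝔨) (𝔱 : LieSubalgebra ℂ 𝔨) (P : Set (Module.Dual ℂ 𝔱))
    (e : Module.Dual ℂ 𝔱 → 𝔨) (lam : 𝔱) : 𝔨 →ₗ[ℂ] 𝔨 :=
  (2⁻¹ : ℂ) • ∑ᶠ α ∈ {α ∈ P | α lam = 0},
    ((B (e α)).smulRight (e (-α)) - (B (e (-α))).smulRight (e α))

section rStd

variable {P : Set (Module.Dual ℂ 𝔱)} {e : Module.Dual ℂ 𝔱 → 𝔨} {lam : 𝔱}

theorem IsMetricReductive.finite_positive (h : IsMetricReductive B 𝔱) (hP : IsPositiveSystem 𝔱 P)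
    (lam : 𝔱) : {α ∈ P | α lam = 0}.Finite :=
  h.cartan.finite_roots.subset fun _ hα ↦ hP.subset hα.1

theorem rStdEnd_apply (h : IsMetricReductive B 𝔱) (hP : IsPositiveSystem 𝔱 P) (x : 𝔨) :
    rStdEnd B 𝔱 P e lam x = (2⁻¹ : ℂ) • ∑ α ∈ (h.finite_positive hP lam).toFinset,
      (B (e α) x • e (-α) - B (e (-α)) x • e α) := by
  rw [rStdEnd, finsum_mem_eq_finite_toFinset_sum _ (h.finite_positive hP lam)]
  simp

theorem dualDistrib_map_rStd (h : IsMetricReductive B 𝔱) (hP : IsPositiveSystem 𝔱 P)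
    {M : Type*} [AddCommGroup M] [Module ℂ M] (S : 𝔨 →ₗ[ℂ] M) (ξ η : Module.Dual ℂ M) {x : 𝔨}
    (hx : B x = ξ ∘ₗ S) :
    TensorProduct.dualDistrib ℂ M M (ξ ⊗ₜ η) (TensorProduct.map S S (rStd 𝔱 P e lam)) =
      η (S (rStdEnd B 𝔱 P e lam x)) := by
  rw [rStd, finsum_mem_eq_finite_toFinset_sum _ (h.finite_positive hP lam), rStdEnd_apply h hP]
  have hx' : ∀ y, ξ (S y) = B y x := fun y ↦ by rw [h.symm, hx]; rfl
  simp only [map_smul, map_sum, map_sub, TensorProduct.map_tmul,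
    TensorProduct.dualDistrib_apply, hx', smul_eq_mul]

theorem rStdEnd_mem (h : IsMetricReductive B 𝔱) (hP : IsPositiveSystem 𝔱 P)
    (he : IsRootVectors B 𝔱 e) (x : 𝔨) :
    rStdEnd B 𝔱 P e lam x ∈ (leviDerived (lam : 𝔨)).toSubmodule := by
  rw [rStdEnd_apply h hP]
  refine Submodule.smul_mem _ _ (Submodule.sum_mem _ fun α hα ↦ ?_)
  obtain ⟨hα1, hα2⟩ := (Set.Finite.mem_toFinset _).1 hα
  have hr := hP.subset hα1
  exact Submodule.sub_mem _
    (Submodule.smul_mem _ _ (h.weight_mem_leviDerived lam (neg_ne_zero.2 hr.1) (by simp [hα2])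
      (he _ (h.neg_mem_roots hr)).1))
    (Submodule.smul_mem _ _ (h.weight_mem_leviDerived lam hr.1 hα2 (he _ hr).1))

theorem rStdEnd_skew (h : IsMetricReductive B 𝔱) (hP : IsPositiveSystem 𝔱 P) (x y : 𝔨) :
    B (rStdEnd B 𝔱 P e lam x) y = -B x (rStdEnd B 𝔱 P e lam y) := by
  rw [rStdEnd_apply h hP, rStdEnd_apply h hP]
  simp only [map_smul, map_sum, map_sub, LinearMap.smul_apply, LinearMap.sum_apply,
    LinearMap.sub_apply, smul_eq_mul, ← mul_neg, ← Finset.sum_neg_distrib]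
  congr 1
  refine Finset.sum_congr rfl fun α _ ↦ ?_
  rw [h.symm x (e α), h.symm x (e (-α))]
  ring

open Classical in
/-- The eigenvalue of the standard r-matrix on a weight space. -/
def rStdSign (P : Set (Module.Dual ℂ 𝔱)) (lam : 𝔱) (α : Module.Dual ℂ 𝔱) : ℂ :=
  if α lam = 0 then (if α ∈ P then -2⁻¹ else if -α ∈ P then 2⁻¹ else 0) else 0

/-- By orthogonality of weight spaces at most one summand survives, and one-dimensionality of root
spaces makes it a multiple of `x`. A positive root gets `-1/2`, because there the surviving term is
the subtracted one. -/
theorem rStdEnd_weight (h : IsMetricReductive B 𝔱) (hP : IsPositiveSystem 𝔱 P)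
    (he : IsRootVectors B 𝔱 e) {β : Module.Dual ℂ 𝔱} {x : 𝔨} (hx : IsWeightVector 𝔱 β x) :
    rStdEnd B 𝔱 P e lam x = rStdSign P lam β • x := by
  have hz1 : ∀ α ∈ P, β ≠ -α → B (e α) x = 0 := fun α hα hne ↦
    h.weight_orthogonal (he α (hP.subset hα)).1 hx hne
  have hz2 : ∀ α ∈ P, β ≠ α → B (e (-α)) x = 0 := fun α hα hne ↦
    h.weight_orthogonal (he _ (h.neg_mem_roots (hP.subset hα))).1 hx (by rwa [neg_neg])
  have hmem : ∀ α, α ∈ (h.finite_positive hP lam).toFinset ↔ α ∈ P ∧ α lam = 0 := fun α ↦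
    (Set.Finite.mem_toFinset _)
  have hone : ∀ hr : β ∈ roots 𝔱, x = B (e (-β)) x • e β := fun hr ↦ by
    have h2 := (he _ (h.neg_mem_roots hr))
    rw [neg_neg] at h2
    exact h.root_space_dim_one hr.1 h2.1 (he _ hr).1 h2.2 hx
  have hxor : ∀ α ∈ P, -α ∉ P := fun α hα hα' ↦ by
    rcases hP.partition α (hP.subset hα) with h1 | h1
    · exact h1.2 hα'
    · exact h1.2 hα
  rw [rStdEnd_apply h hP, rStdSign]
  split_ifs with h1 h2 h3
  · rw [Finset.sum_eq_single_of_mem β ((hmem β).2 ⟨h2, h1⟩)]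
    · rw [hz1 β h2, zero_smul, zero_sub, ← hone (hP.subset h2)]
      · module
      · intro hc; exact hxor β h2 (hc ▸ h2)
    · intro α hα hne
      rw [hmem] at hα
      rw [hz1 α hα.1, hz2 α hα.1 hne.symm]
      · simp
      · rintro rfl; exact hxor α hα.1 h2
  · rw [Finset.sum_eq_single_of_mem (-β) ((hmem _).2 ⟨h3, by simp [h1]⟩)]
    · rw [hz2 (-β) h3, zero_smul, sub_zero, neg_neg, ← hone]
      · simpa using h.neg_mem_roots (hP.subset h3)
      · intro hc; exact h2 (hc ▸ h3)
    · intro α hα hne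
      rw [hmem] at hα
      rw [hz1 α hα.1, hz2 α hα.1]
      · simp
      · rintro rfl; exact h2 hα.1
      · rintro rfl; exact hne (by simp)
  · rw [Finset.sum_eq_zero]
    · simp
    · intro α hα
      rw [hmem] at hα
      rw [hz1 α hα.1, hz2 α hα.1]
      · simp
      · rintro rfl; exact h2 hα.1
      · rintro rfl; exact h3 (by simpa using hα.1)
  · rw [Finset.sum_eq_zero]
    · simp
    · intro α hα
      rw [hmem] at hα
      rw [hz1 α hα.1, hz2 α hα.1]
      · simp
      · rintro rfl; exact h1 hα.2
      · rintro rfl; exact h1 (by simp [hα.2])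

end rStd
end Levi

/-! ### The modified classical Yang-Baxter equation for the standard r-matrix. -/

section ModifiedCYBE

variable {𝔨 : Type*} [LieRing 𝔨] [LieAlgebra ℂ 𝔨] [FiniteDimensional ℂ 𝔨]
  {𝔱 : LieSubalgebra ℂ 𝔨} {B : LinearMap.BilinForm ℂ 𝔨}
  {P : Set (Module.Dual ℂ 𝔱)} {e : Module.Dual ℂ 𝔱 → 𝔨} {lam : 𝔱} {p : 𝔨 →ₗ[ℂ] 𝔨}

namespace IsMetricReductive

theorem cyclic (h : IsMetricReductive B 𝔱) (x y z : 𝔨) : B z ⁅x, y⁆ = B x ⁅y, z⁆ := by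
  rw [h.symm, h.inv']

theorem proj_leviDerived_weight (h : IsMetricReductive B 𝔱)
    (hp : IsOrthProj B (leviDerived (lam : 𝔨)).toSubmodule p) {α : Module.Dual ℂ 𝔱} {x : 𝔨}
    (hx : IsWeightVector 𝔱 α x) : IsWeightVector 𝔱 α (p x) := fun s ↦ by
  rw [← hp.apply_lie h.inv (fun w ↦ h.lie_cartan_mem_leviDerived lam s) x, hx s, map_smul]

theorem proj_leviDerived_eq_zero (h : IsMetricReductive B 𝔱)
    (hp : IsOrthProj B (leviDerived (lam : 𝔨)).toSubmodule p) {α : Module.Dual ℂ 𝔱} {x : 𝔨}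
    (hx : IsWeightVector 𝔱 α x) (hα : α lam ≠ 0) : p x = 0 := by
  have h1 := h.proj_leviDerived_weight hp hx lam
  rw [(leviDerived_le (hp.mem x)).1] at h1
  exact (smul_eq_zero.1 h1.symm).resolve_left hα

theorem proj_leviDerived_eq_self (h : IsMetricReductive B 𝔱)
    (hp : IsOrthProj B (leviDerived (lam : 𝔨)).toSubmodule p) {α : Module.Dual ℂ 𝔱} {x : 𝔨}
    (hx : IsWeightVector 𝔱 α x) (h0 : α ≠ 0) (hα : α lam = 0) : p x = x :=
  hp.apply_of_mem (h.weight_mem_leviDerived lam h0 hα hx)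

theorem rStdSign_of_pos (P : Set (Module.Dual ℂ 𝔱)) {α : Module.Dual ℂ 𝔱} (hl : α lam = 0)
    (hα : α ∈ P) : rStdSign P lam α = -2⁻¹ := by
  simp [rStdSign, hl, hα]

theorem rStdSign_of_neg (hP : IsPositiveSystem 𝔱 P) {α : Module.Dual ℂ 𝔱} (hl : α lam = 0)
    (hr : α ∈ roots 𝔱) (hα : α ∉ P) : rStdSign P lam α = 2⁻¹ ∧ -α ∈ P := by
  rcases hP.partition α hr with h1 | h1
  · exact absurd h1.1 hα
  · exact ⟨by simp [rStdSign, hl, hα, h1.1], h1.1⟩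

theorem rStdSign_zero (hP : IsPositiveSystem 𝔱 P) : rStdSign P lam 0 = 0 := by
  have : (0 : Module.Dual ℂ 𝔱) ∉ P := fun hc ↦ (hP.subset hc).1 rfl
  simp [rStdSign, this]

theorem rStdSign_of_ne (P : Set (Module.Dual ℂ 𝔱)) {α : Module.Dual ℂ 𝔱} (hl : α lam ≠ 0) :
    rStdSign P lam α = 0 := by
  simp [rStdSign, hl]

/-- The case of one vanishing weight: opposite roots have opposite signs, with product `-1/4`. If `α
= 0` as well, the vectors and their projections lie in the commutative algebra `𝔱` and both sides
vanish. -/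
theorem mcybe_weight_zero (h : IsMetricReductive B 𝔱) (hP : IsPositiveSystem 𝔱 P)
    (hp : IsOrthProj B (leviDerived (lam : 𝔨)).toSubmodule p) {α : Module.Dual ℂ 𝔱} {x y : 𝔨}
    (hx : IsWeightVector 𝔱 α x) (hy : IsWeightVector 𝔱 (-α) y)
    (hα : α lam = 0) (z : 𝔨) :
    rStdSign P lam α * rStdSign P lam (-α) * B z ⁅x, y⁆ = -4⁻¹ * B (p z) ⁅p x, p y⁆ := by
  by_cases h0 : α = 0
  · subst h0
    rw [neg_zero] at hy
    have hx' := h.cartan.mem_of_weight_zero hx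
    have hy' := h.cartan.mem_of_weight_zero hy
    have hpx := h.cartan.mem_of_weight_zero (h.proj_leviDerived_weight hp hx)
    have hpy := h.cartan.mem_of_weight_zero (h.proj_leviDerived_weight hp hy)
    rw [h.cartan.lie_eq_zero hx' hy', h.cartan.lie_eq_zero hpx hpy]
    simp
  · rw [h.proj_leviDerived_eq_self hp hx h0 hα,
      h.proj_leviDerived_eq_self hp hy (neg_ne_zero.2 h0) (by simp [hα]), hp.pairing]
    · by_cases hb : B z ⁅x, y⁆ = 0
      · simp [hb]
      congr 1
      have hr : α ∈ roots 𝔱 := ⟨h0, x, by rintro rfl; simp at hb, hx⟩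
      have hl : (-α) lam = 0 := by simp [hα]
      by_cases hαP : α ∈ P
      · have hn : -α ∉ P := fun hc ↦ by
          rcases hP.partition α hr with h1 | h1
          exacts [h1.2 hc, h1.2 hαP]
        rw [rStdSign_of_pos P hα hαP, (rStdSign_of_neg hP hl (h.neg_mem_roots hr) hn).1]
        norm_num
      · obtain ⟨h1, h2⟩ := rStdSign_of_neg hP hα hr hαP
        rw [h1, rStdSign_of_pos P hl h2]
        norm_num
    · exact lie_mem_leviDerived (by rw [hx lam, hα, zero_smul]) (by rw [hy lam]; simp [hα])

/-- Three numbers `±1/2`, not all equal, have second elementary symmetric function `-1/4`. Equal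
signs are excluded: for positive roots with sum zero, closedness would make `α + β = -γ` positive;
for negative roots pass to opposites. -/
theorem rStdSign_identity (h : IsMetricReductive B 𝔱) (hP : IsPositiveSystem 𝔱 P)
    {α β γ : Module.Dual ℂ 𝔱} (hs : α + β + γ = 0) (hα : α ∈ roots 𝔱) (hβ : β ∈ roots 𝔱)
    (hγ : γ ∈ roots 𝔱) (la : α lam = 0) (lb : β lam = 0) (lc : γ lam = 0) :
    rStdSign P lam α * rStdSign P lam β + rStdSign P lam β * rStdSign P lam γ +
      rStdSign P lam γ * rStdSign P lam α = -4⁻¹ := by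
  have key : ∀ α ∈ P, ∀ β ∈ P, ∀ γ ∈ P, α + β + γ ≠ 0 := by
    intro α hα β hβ γ hγ h0
    have e : α + β = -γ := by rw [← add_eq_zero_iff_eq_neg, h0]
    have h1 := hP.closed α hα β hβ (e ▸ h.neg_mem_roots (hP.subset hγ))
    rw [e] at h1
    rcases hP.partition γ (hP.subset hγ) with h2 | h2
    exacts [h2.2 h1, h2.2 hγ]
  have hs' : -α + -β + -γ = 0 := by rw [← neg_zero, ← hs]; abel
  by_cases a : α ∈ P <;> by_cases b : β ∈ P <;> by_cases c : γ ∈ P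
  · exact absurd hs (key _ a _ b _ c)
  · rw [rStdSign_of_pos P la a, rStdSign_of_pos P lb b, (rStdSign_of_neg hP lc hγ c).1]; norm_num
  · rw [rStdSign_of_pos P la a, (rStdSign_of_neg hP lb hβ b).1, rStdSign_of_pos P lc c]; norm_num
  · rw [rStdSign_of_pos P la a, (rStdSign_of_neg hP lb hβ b).1, (rStdSign_of_neg hP lc hγ c).1]
    norm_num
  · rw [(rStdSign_of_neg hP la hα a).1, rStdSign_of_pos P lb b, rStdSign_of_pos P lc c]; norm_num
  · rw [(rStdSign_of_neg hP la hα a).1, rStdSign_of_pos P lb b, (rStdSign_of_neg hP lc hγ c).1]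
    norm_num
  · rw [(rStdSign_of_neg hP la hα a).1, (rStdSign_of_neg hP lb hβ b).1, rStdSign_of_pos P lc c]
    norm_num
  · exact absurd hs' (key _ (rStdSign_of_neg hP la hα a).2 _ (rStdSign_of_neg hP lb hβ b).2 _
      (rStdSign_of_neg hP lc hγ c).2)

/-- Both sides vanish unless the weights add up to zero, and also unless all three vanish on `lam`;
if one is nonzero there, so is a second, and every product of signs is zero. The remaining cases are
those with a zero weight, reduced by cyclicity, and three roots. -/
theorem mcybe_weight (h : IsMetricReductive B 𝔱) (hP : IsPositiveSystem 𝔱 P)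
    (hp : IsOrthProj B (leviDerived (lam : 𝔨)).toSubmodule p) {α β γ : Module.Dual ℂ 𝔱} {x y z : 𝔨}
    (hx : IsWeightVector 𝔱 α x) (hy : IsWeightVector 𝔱 β y) (hz : IsWeightVector 𝔱 γ z) :
    (rStdSign P lam α * rStdSign P lam β + rStdSign P lam β * rStdSign P lam γ +
      rStdSign P lam γ * rStdSign P lam α) * B z ⁅x, y⁆ = -4⁻¹ * B (p z) ⁅p x, p y⁆ := by
  by_cases hs : α + β + γ = 0
  swap
  · have hne : α + β ≠ -γ := fun hc ↦ hs (by rw [hc]; simp)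
    rw [h.weight_orthogonal hz (hx.lie hy) hne, h.weight_orthogonal
      (h.proj_leviDerived_weight hp hz) ((h.proj_leviDerived_weight hp hx).lie
      (h.proj_leviDerived_weight hp hy)) hne]
    simp
  have hsl : α lam + β lam + γ lam = 0 := by simpa using LinearMap.congr_fun hs lam
  by_cases la : α lam = 0
  swap
  · rw [h.proj_leviDerived_eq_zero hp hx la, rStdSign_of_ne P la]
    by_cases lb : β lam = 0
    · have lc : γ lam ≠ 0 := fun hc ↦ la (by rw [lb, hc] at hsl; simpa using hsl)
      rw [rStdSign_of_ne P lc]; simp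
    · rw [rStdSign_of_ne P lb]; simp
  by_cases lb : β lam = 0
  swap
  · have lc : γ lam ≠ 0 := fun hc ↦ lb (by rw [la, hc] at hsl; simpa using hsl)
    rw [h.proj_leviDerived_eq_zero hp hy lb, rStdSign_of_ne P lb, rStdSign_of_ne P lc]
    simp
  have lc : γ lam = 0 := by simpa [la, lb] using hsl
  by_cases c0 : γ = 0
  · subst c0
    obtain rfl : β = -α := by rw [add_zero] at hs; exact (neg_eq_of_add_eq_zero_right hs).symm
    rw [rStdSign_zero hP, ← h.mcybe_weight_zero hP hp hx hy la z]
    ring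
  by_cases a0 : α = 0
  · subst a0
    obtain rfl : γ = -β := by rw [zero_add] at hs; exact (neg_eq_of_add_eq_zero_right hs).symm
    rw [rStdSign_zero hP, h.cyclic x y z, h.cyclic (p x) (p y) (p z),
      ← h.mcybe_weight_zero hP hp hy hz lb x]
    ring
  by_cases b0 : β = 0
  · subst b0
    obtain rfl : α = -γ := by rw [add_zero] at hs; exact (neg_eq_of_add_eq_zero_left hs).symm
    rw [rStdSign_zero hP, ← h.cyclic z x y, ← h.cyclic (p z) (p x) (p y),
      ← h.mcybe_weight_zero hP hp hz hx lc y]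
    ring
  rw [h.proj_leviDerived_eq_self hp hx a0 la, h.proj_leviDerived_eq_self hp hy b0 lb,
    h.proj_leviDerived_eq_self hp hz c0 lc]
  by_cases hb : B z ⁅x, y⁆ = 0
  · simp [hb]
  rw [rStdSign_identity h hP hs ⟨a0, x, by rintro rfl; simp at hb, hx⟩
    ⟨b0, y, by rintro rfl; simp at hb, hy⟩ ⟨c0, z, by rintro rfl; simp at hb, hz⟩ la lb lc]

/-- The modified classical Yang-Baxter equation for the standard r-matrix. -/
theorem mcybe (h : IsMetricReductive B 𝔱) (hP : IsPositiveSystem 𝔱 P) (he : IsRootVectors B 𝔱 e)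
    (hp : IsOrthProj B (leviDerived (lam : 𝔨)).toSubmodule p) (x y z : 𝔨) :
    B z ⁅rStdEnd B 𝔱 P e lam x, rStdEnd B 𝔱 P e lam y⁆ +
      B x ⁅rStdEnd B 𝔱 P e lam y, rStdEnd B 𝔱 P e lam z⁆ +
      B y ⁅rStdEnd B 𝔱 P e lam z, rStdEnd B 𝔱 P e lam x⁆ = -4⁻¹ * B (p z) ⁅p x, p y⁆ := by
  set r := rStdEnd B 𝔱 P e lam with hr
  -- Both sides are trilinear, so weight vectors suffice.
  refine h.cartan.weight_induction (p := fun x ↦ B z ⁅r x, r y⁆ + B x ⁅r y, r z⁆ +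
    B y ⁅r z, r x⁆ = -4⁻¹ * B (p z) ⁅p x, p y⁆) (fun α x hx ↦ ?_) (by simp)
    (fun u v hu hv ↦ ?_) (fun c u hu ↦ ?_) x
  · refine h.cartan.weight_induction (p := fun y ↦ B z ⁅r x, r y⁆ + B x ⁅r y, r z⁆ +
      B y ⁅r z, r x⁆ = -4⁻¹ * B (p z) ⁅p x, p y⁆) (fun β y hy ↦ ?_) (by simp)
      (fun u v hu hv ↦ ?_) (fun c u hu ↦ ?_) y
    · refine h.cartan.weight_induction (p := fun z ↦ B z ⁅r x, r y⁆ + B x ⁅r y, r z⁆ +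
        B y ⁅r z, r x⁆ = -4⁻¹ * B (p z) ⁅p x, p y⁆) (fun γ z hz ↦ ?_) (by simp)
        (fun u v hu hv ↦ ?_) (fun c u hu ↦ ?_) z
      · rw [hr, rStdEnd_weight h hP he hx, rStdEnd_weight h hP he hy, rStdEnd_weight h hP he hz,
          ← h.mcybe_weight hP hp hx hy hz]
        simp only [smul_lie, lie_smul, map_smul, smul_eq_mul]
        rw [← h.cyclic z x y, ← h.cyclic y z x]
        ring
      · simp only [map_add, add_lie, lie_add, LinearMap.add_apply] at hu hv ⊢
        linear_combination hu + hv
      · simp only [map_smul, smul_lie, lie_smul, LinearMap.smul_apply, smul_eq_mul] at hu ⊢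
        linear_combination c * hu
    · simp only [map_add, add_lie, lie_add, LinearMap.add_apply] at hu hv ⊢
      linear_combination hu + hv
    · simp only [map_smul, smul_lie, lie_smul, LinearMap.smul_apply, smul_eq_mul] at hu ⊢
      linear_combination c * hu
  · simp only [map_add, add_lie, lie_add, LinearMap.add_apply] at hu hv ⊢
    linear_combination hu + hv
  · simp only [map_smul, smul_lie, lie_smul, LinearMap.smul_apply, smul_eq_mul] at hu ⊢
    linear_combination c * hu

end IsMetricReductive
end ModifiedCYBE

/-! ### The inverse of `ad` on the complement of the centralizer -/

section AdInv

variable {𝔨 : Type*} [LieRing 𝔨] [LieAlgebra ℂ 𝔨] [FiniteDimensional ℂ 𝔨]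
  {𝔱 : LieSubalgebra ℂ 𝔨} {B : LinearMap.BilinForm ℂ 𝔨} {q : 𝔨 →ₗ[ℂ] 𝔨} {s : 𝔱}

theorem ne_zero_of_mem_tPrime (hs : s ∈ tPrime 𝔱) {α : Module.Dual ℂ 𝔱} (hα : α ∈ roots 𝔱) :
    α s ≠ 0 := by
  simpa using hs α hα 0

namespace IsMetricReductive

theorem exists_proj_cartan (h : IsMetricReductive B 𝔱) : ∃ q, IsOrthProj B 𝔱.toSubmodule q :=
  IsOrthProj.exists_of_nondeg fun _ hx h0 ↦ h.nondeg_cartan hx h0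

theorem proj_cartan_weight (h : IsMetricReductive B 𝔱) (hq : IsOrthProj B 𝔱.toSubmodule q)
    {α : Module.Dual ℂ 𝔱} (hα : α ≠ 0) {x : 𝔨} (hx : IsWeightVector 𝔱 α x) : q x = 0 :=
  hq.eq_of_pairing (zero_mem _) fun y hy ↦ by
    rw [h.weight_orthogonal hx (h.cartan.isWeightVector_zero hy) (neg_ne_zero.2 hα).symm]; simp

theorem proj_cartan_lie (h : IsMetricReductive B 𝔱) (hq : IsOrthProj B 𝔱.toSubmodule q)
    (s : 𝔱) (x : 𝔨) : q ⁅(s : 𝔨), x⁆ = 0 := by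
  rw [hq.apply_lie h.inv fun w hw ↦ ?_, h.cartan.lie_eq_zero s.2 (hq.mem x)]
  rw [h.cartan.lie_eq_zero s.2 hw]
  exact zero_mem _

/-- The operator `ad_s + q` is onto: it fixes `𝔱` and scales each root vector by `α(s) ≠ 0`. Its
inverse sends `[s, y]` to `y - q y`, so `[s, x] = 0` gives `x = q x`. -/
theorem centralizer_of_mem_tPrime (h : IsMetricReductive B 𝔱) (hs : s ∈ tPrime 𝔱) {x : 𝔨}
    (hx : ⁅(s : 𝔨), x⁆ = 0) : x ∈ 𝔱 := by
  obtain ⟨q, hq⟩ := h.exists_proj_cartan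
  suffices hh : ∃ T : 𝔨 →ₗ[ℂ] 𝔨, ∀ y, T ⁅(s : 𝔨), y⁆ = y - q y by
    obtain ⟨T, hT⟩ := hh
    have := hT x
    rw [hx, map_zero, eq_comm, sub_eq_zero] at this
    exact this ▸ hq.mem x
  have hsurj : Function.Surjective (LieAlgebra.ad ℂ 𝔨 (s : 𝔨) + q : 𝔨 →ₗ[ℂ] 𝔨) := by
    intro y
    refine h.cartan.weight_induction
      (p := fun y ↦ ∃ a, (LieAlgebra.ad ℂ 𝔨 (s : 𝔨) + q : 𝔨 →ₗ[ℂ] 𝔨) a = y)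
      (fun α x hx ↦ ?_) ⟨0, by simp⟩ ?_ ?_ y
    · by_cases hα : α = 0
      · subst hα
        have hm := h.cartan.mem_of_weight_zero hx
        refine ⟨x, ?_⟩
        rw [LinearMap.add_apply, LieAlgebra.ad_apply, h.cartan.lie_eq_zero s.2 hm,
          hq.apply_of_mem hm, zero_add]
      · by_cases hx0 : x = 0
        · exact ⟨0, by simp [hx0]⟩
        have hs0 := ne_zero_of_mem_tPrime hs ⟨hα, x, hx0, hx⟩
        refine ⟨(α s)⁻¹ • x, ?_⟩
        rw [LinearMap.add_apply, LieAlgebra.ad_apply, lie_smul, hx s, inv_smul_smul₀ hs0,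
          map_smul, h.proj_cartan_weight hq hα hx, smul_zero, add_zero]
    · rintro _ _ ⟨a, rfl⟩ ⟨b, rfl⟩
      exact ⟨a + b, map_add _ _ _⟩
    · rintro c _ ⟨a, rfl⟩
      exact ⟨c • a, map_smul _ _ _⟩
  let M := LinearEquiv.ofBijective (LieAlgebra.ad ℂ 𝔨 (s : 𝔨) + q : 𝔨 →ₗ[ℂ] 𝔨)
    ⟨LinearMap.injective_iff_surjective.2 hsurj, hsurj⟩
  refine ⟨(M.symm : 𝔨 →ₗ[ℂ] 𝔨), fun y ↦ ?_⟩
  rw [LinearEquiv.coe_coe, LinearEquiv.symm_apply_eq]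
  change _ = (LieAlgebra.ad ℂ 𝔨 (s : 𝔨) + q : 𝔨 →ₗ[ℂ] 𝔨) _
  rw [LinearMap.add_apply, LieAlgebra.ad_apply, map_sub, hq.idem, sub_self, add_zero, lie_sub,
    h.cartan.lie_eq_zero s.2 (hq.mem y), sub_zero]

theorem bijective_ad_add_proj (h : IsMetricReductive B 𝔱) (hq : IsOrthProj B 𝔱.toSubmodule q)
    (hs : s ∈ tPrime 𝔱) :
    Function.Bijective (LieAlgebra.ad ℂ 𝔨 (s : 𝔨) + q : 𝔨 →ₗ[ℂ] 𝔨) := by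
  have hinj : Function.Injective (LieAlgebra.ad ℂ 𝔨 (s : 𝔨) + q : 𝔨 →ₗ[ℂ] 𝔨) := by
    rw [injective_iff_map_eq_zero]
    intro x hx
    rw [LinearMap.add_apply, LieAlgebra.ad_apply] at hx
    have hq0 : q x = 0 := by
      have := congrArg q hx
      rwa [map_add, h.proj_cartan_lie hq, zero_add, hq.idem, map_zero] at this
    rw [hq0, add_zero] at hx
    rw [← hq.apply_of_mem (h.centralizer_of_mem_tPrime hs hx), hq0]
  exact ⟨hinj, LinearMap.injective_iff_surjective.1 hinj⟩

/-- `adInv` is a chosen operator, so existence has to be shown; its two defining properties then fix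
its values on `𝔱` and on all `[s, y]`. -/
theorem adInv_spec (h : IsMetricReductive B 𝔱) (hq : IsOrthProj B 𝔱.toSubmodule q)
    (hs : s ∈ tPrime 𝔱) : (∀ y ∈ 𝔱, adInv B (s : 𝔨) y = 0) ∧
      ∀ y, adInv B (s : 𝔨) ⁅(s : 𝔨), y⁆ = y - q y := by
  have hker : ∀ y, y ∈ LinearMap.ker (LieAlgebra.ad ℂ 𝔨 (s : 𝔨) : Module.End ℂ 𝔨) ↔ y ∈ 𝔱 :=
    fun y ↦ ⟨fun hy ↦ h.centralizer_of_mem_tPrime hs hy, fun hy ↦ h.cartan.lie_eq_zero s.2 hy⟩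
  have hex : ∃ S : Module.End ℂ 𝔨, (∀ y, ⁅(s : 𝔨), y⁆ = 0 → S y = 0) ∧
      ∀ y ∈ B.orthogonal (LinearMap.ker (LieAlgebra.ad ℂ 𝔨 (s : 𝔨) : Module.End ℂ 𝔨)),
        S ⁅(s : 𝔨), y⁆ = y := by
    let M := LinearEquiv.ofBijective _ (h.bijective_ad_add_proj hq hs)
    have hM : ∀ y, M y = ⁅(s : 𝔨), y⁆ + q y := fun y ↦ rfl
    -- On the complement of `𝔱` the operator `ad_s + q` is `ad_s`; on `𝔱` both it and `q` are the
    -- identity, so the difference vanishes there.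
    refine ⟨(M.symm : 𝔨 →ₗ[ℂ] 𝔨) - q, fun y hy ↦ ?_, fun y hy ↦ ?_⟩
    · have hy' := h.centralizer_of_mem_tPrime hs hy
      rw [LinearMap.sub_apply, hq.apply_of_mem hy', sub_eq_zero, LinearEquiv.coe_coe,
        LinearEquiv.symm_apply_eq, hM, hy, hq.apply_of_mem hy', zero_add]
    · have hqy : q y = 0 := hq.eq_of_pairing (zero_mem _) fun z hz ↦ by
        have : B z y = 0 := hy z ((hker z).2 hz)
        rw [h.symm y, this, map_zero, LinearMap.zero_apply]
      rw [LinearMap.sub_apply, h.proj_cartan_lie hq, sub_zero, LinearEquiv.coe_coe,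
        LinearEquiv.symm_apply_eq, hM, hqy, add_zero]
  have hspec := hex.choose_spec
  rw [adInv, dif_pos hex]
  refine ⟨fun y hy ↦ hspec.1 y (h.cartan.lie_eq_zero s.2 hy), fun y ↦ ?_⟩
  rw [← hspec.2 (y - q y), lie_sub, h.cartan.lie_eq_zero s.2 (hq.mem y), sub_zero]
  intro z hz
  change B z (y - q y) = 0
  rw [map_sub, hq.pairing' h.symm ((hker z).1 hz), sub_self]

/-- `adInv` is determined by a two-sided inverse relation. -/
theorem adInv_apply_add (h : IsMetricReductive B 𝔱) (hq : IsOrthProj B 𝔱.toSubmodule q)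
    (hs : s ∈ tPrime 𝔱) (y : 𝔨) : adInv B (s : 𝔨) (⁅(s : 𝔨), y⁆ + q y) = y - q y := by
  rw [map_add, (h.adInv_spec hq hs).2, (h.adInv_spec hq hs).1 _ (hq.mem y), add_zero]

end IsMetricReductive
end AdInv

/-! ### The functional calculus on endomorphisms -/

section PhiEnd

variable {V W : Type*} [NormedAddCommGroup V] [NormedSpace ℂ V] [CompleteSpace V]
  [NormedAddCommGroup W] [NormedSpace ℂ W] [CompleteSpace W]

theorem hasSum_phiDen_apply (a : V →L[ℂ] V) (v : V) :
    HasSum (fun n ↦ denCoeff n • (((2⁻¹ : ℂ) • a) ^ (2 * n)) v) (phiDen a v) :=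
  (hasSum_phiDen' a).mapL (ContinuousLinearMap.apply ℂ V v)

theorem hasSum_phiNum_apply (a : V →L[ℂ] V) (v : V) :
    HasSum (fun n ↦ numCoeff n • (((2⁻¹ : ℂ) • a) ^ (2 * n)) v) (phiNum a v) :=
  (hasSum_phiNum' a).mapL (ContinuousLinearMap.apply ℂ V v)

theorem pow_comp_intertwine {a : V →L[ℂ] V} {b : W →L[ℂ] W} {ι : W →L[ℂ] V}
    (h : ∀ w, a (ι w) = ι (b w)) (n : ℕ) (w : W) : (a ^ n) (ι w) = ι ((b ^ n) w) := by
  induction n generalizing w with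
  | zero => rfl
  | succ n ih => rw [pow_succ, pow_succ, mul_apply_eq_comp, mul_apply_eq_comp, h, ih]

theorem half_smul_intertwine {a : V →L[ℂ] V} {b : W →L[ℂ] W} {ι : W →L[ℂ] V}
    (h : ∀ w, a (ι w) = ι (b w)) (w : W) :
    ((2⁻¹ : ℂ) • a) (ι w) = ι (((2⁻¹ : ℂ) • b) w) := by
  rw [_root_.smul_apply, _root_.smul_apply, h, map_smul]

theorem phiDen_comp_intertwine {a : V →L[ℂ] V} {b : W →L[ℂ] W} {ι : W →L[ℂ] V}
    (h : ∀ w, a (ι w) = ι (b w)) (w : W) : phiDen a (ι w) = ι (phiDen b w) := by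
  refine (hasSum_phiDen_apply a (ι w)).unique (((hasSum_phiDen_apply b w).mapL ι).congr_fun
    fun n ↦ ?_)
  rw [pow_comp_intertwine (half_smul_intertwine h), map_smul]

theorem phiNum_comp_intertwine {a : V →L[ℂ] V} {b : W →L[ℂ] W} {ι : W →L[ℂ] V}
    (h : ∀ w, a (ι w) = ι (b w)) (w : W) : phiNum a (ι w) = ι (phiNum b w) := by
  refine (hasSum_phiNum_apply a (ι w)).unique (((hasSum_phiNum_apply b w).mapL ι).congr_fun
    fun n ↦ ?_)
  rw [pow_comp_intertwine (half_smul_intertwine h), map_smul]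

theorem phi_phiDen_apply {a : V →L[ℂ] V} (ha : IsUnit (phiDen a)) (v : V) :
    phi a (phiDen a v) = (4⁻¹ : ℂ) • a (phiNum a v) := by
  rw [← mul_apply_eq_comp, phi_mul_phiDen ha, _root_.smul_apply, mul_apply_eq_comp]

theorem phi_comp_intertwine {a : V →L[ℂ] V} {b : W →L[ℂ] W} {ι : W →L[ℂ] V}
    (h : ∀ w, a (ι w) = ι (b w)) (ha : IsUnit (phiDen a)) (hb : IsUnit (phiDen b)) (w : W) :
    phi a (ι w) = ι (phi b w) := by
  obtain ⟨c, hc⟩ := hb.exists_right_inv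
  obtain ⟨w, rfl⟩ : ∃ u, w = phiDen b u := ⟨c w, by rw [← mul_apply_eq_comp, hc]; rfl⟩
  rw [← phiDen_comp_intertwine h, phi_phiDen_apply ha, phi_phiDen_apply hb,
    phiNum_comp_intertwine h, h, map_smul]

theorem phiDen_apply_of_eigen {a : V →L[ℂ] V} {μ : ℂ} {v : V} (h : a v = μ • v) :
    phiDen a v = phiDen μ • v := by
  refine (hasSum_phiDen_apply a v).unique (((hasSum_phiDen' μ).smul_const v).congr_fun fun n ↦ ?_)
  have h2 : ∀ k : ℕ, (((2⁻¹ : ℂ) • a) ^ k) v = ((2⁻¹ : ℂ) • μ) ^ k • v := fun k ↦ by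
    induction k with
    | zero => simp
    | succ k ih =>
      rw [pow_succ, pow_succ, mul_apply_eq_comp, _root_.smul_apply, h, map_smul, map_smul, ih,
        smul_smul, smul_smul, smul_eq_mul]
      congr 1
      ring
  rw [h2, smul_assoc]

/-- The zeros of `sinh w` with `w = μ/2`, except `w = 0`, where the quotient takes the value one. -/
theorem phiDen_eq_zero_iff (μ : ℂ) :
    phiDen μ = 0 ↔ ∃ n : ℤ, n ≠ 0 ∧ μ = 2 * Real.pi * Complex.I * n := by
  by_cases hμ : μ = 0
  · subst hμ
    simp [phiDen_zero_alg, Real.pi_ne_zero, Complex.I_ne_zero]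
  obtain ⟨w, rfl⟩ : ∃ w, μ = 2 * w := ⟨μ / 2, by ring⟩
  have hw : w ≠ 0 := by rintro rfl; simp at hμ
  have e : (2⁻¹ : ℂ) • (2 * w) = w := by rw [smul_eq_mul]; ring
  have h1 : phiDen (2 * w) = Complex.sinh w / w := by
    simp only [phiDen, e]; exact (hasSum_phiDen w hw).tsum_eq
  rw [h1, div_eq_zero_iff, or_iff_left hw]
  have h2 : Complex.sinh w = 0 ↔ ∃ k : ℤ, w * Complex.I = k * Real.pi := by
    rw [← Complex.sin_eq_zero_iff, Complex.sin_mul_I]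
    simp [Complex.I_ne_zero]
  rw [h2]
  constructor
  · rintro ⟨k, hk⟩
    have hw' : w = -(k * Real.pi * Complex.I) := by
      linear_combination (-Complex.I) * hk + w * Complex.I_sq
    refine ⟨-k, ?_, ?_⟩
    · rintro h0
      obtain rfl : k = 0 := by simpa using h0
      exact hw (by simpa using hw')
    · rw [hw']; push_cast; ring
  · rintro ⟨n, -, hn⟩
    refine ⟨-n, ?_⟩
    push_cast
    linear_combination (Complex.I / 2) * hn + Real.pi * n * Complex.I_sq

/-- If `phiDen a` is singular, its kernel is invariant under `a` and contains an eigenvector of `a`;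
the eigenvalue must be a zero of the scalar function. -/
theorem isUnit_phiDen_iff [FiniteDimensional ℂ V] (a : V →L[ℂ] V) :
    IsUnit (phiDen a) ↔ ∀ n : ℤ, n ≠ 0 →
      ¬ Module.End.HasEigenvalue (a : Module.End ℂ V) (2 * Real.pi * Complex.I * n) := by
  constructor
  · rintro hu n hn hev
    obtain ⟨v, hv⟩ := hev.exists_hasEigenvector
    have h1 := phiDen_apply_of_eigen (a := a) hv.apply_eq_smul
    rw [(phiDen_eq_zero_iff _).2 ⟨n, hn, rfl⟩, zero_smul] at h1
    obtain ⟨c, hc⟩ := hu.exists_left_inv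
    have h2 : c (phiDen a v) = v := by rw [← mul_apply_eq_comp, hc]; rfl
    rw [h1, map_zero] at h2
    exact hv.2 h2.symm
  · intro h
    refine isUnit_of_injective ?_
    by_contra! hc
    obtain ⟨v, hv, hv0⟩ := hc
    let K : Submodule ℂ V := LinearMap.ker ((phiDen a : V →L[ℂ] V) : V →ₗ[ℂ] V)
    have hK : ∀ x ∈ K, (a : V →ₗ[ℂ] V) x ∈ K := fun x hx ↦ by
      have hx' : phiDen a x = 0 := hx
      change phiDen a (a x) = 0
      rw [← mul_apply_eq_comp, (commute_phiDen (Commute.refl a)).eq, mul_apply_eq_comp, hx',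
        map_zero]
    have : Nontrivial K := ⟨⟨⟨v, hv⟩, 0, fun h0 ↦ hv0 (congrArg Subtype.val h0)⟩⟩
    obtain ⟨μ, hμ⟩ := Module.End.exists_eigenvalue ((a : V →ₗ[ℂ] V).restrict hK)
    obtain ⟨w, hw⟩ := hμ.exists_hasEigenvector
    have hw1 : a w = μ • (w : V) := congrArg Subtype.val hw.apply_eq_smul
    have hw0 : (w : V) ≠ 0 := fun h0 ↦ hw.2 (Subtype.ext h0)
    have h1 := phiDen_apply_of_eigen hw1
    have hw2 : phiDen a w = 0 := w.2
    rw [hw2, eq_comm, smul_eq_zero, or_iff_left hw0, phiDen_eq_zero_iff] at h1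
    obtain ⟨n, hn, rfl⟩ := h1
    exact h n hn (Module.End.hasEigenvalue_of_hasEigenvector
      ⟨Module.End.mem_eigenspace_iff.2 hw1, hw0⟩)

theorem phiDen_apply_of_apply_eq_zero {a : V →L[ℂ] V} {v : V} (h : a v = 0) : phiDen a v = v := by
  rw [phiDen_apply_of_eigen (μ := 0) (by rw [h, zero_smul]), phiDen_zero_alg, one_smul]

/-- `φ` kills the kernel of `a`. -/
theorem phi_apply_of_apply_eq_zero {a : V →L[ℂ] V} (ha : IsUnit (phiDen a)) {v : V}
    (h : a v = 0) : phi a v = 0 := by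
  conv_lhs => rw [← phiDen_apply_of_apply_eq_zero h]
  rw [phi_phiDen_apply ha, ← mul_apply_eq_comp, ← (commute_phiNum (Commute.refl a)).eq,
    mul_apply_eq_comp, h, map_zero, smul_zero]

/-- Here `a` is `b` on a direct summand, extended by zero. Since the denominator is one at zero, the
complement imposes no condition. -/
theorem isUnit_phiDen_conj [FiniteDimensional ℂ V] [FiniteDimensional ℂ W] {a : V →L[ℂ] V}
    {b : W →L[ℂ] W} (ι : W →L[ℂ] V) (π : V →L[ℂ] W) (hπ : ∀ w, π (ι w) = w)
    (h : ∀ v, a v = ι (b (π v))) : IsUnit (phiDen a) ↔ IsUnit (phiDen b) := by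
  have h1 : ∀ w, a (ι w) = ι (b w) := fun w ↦ by rw [h, hπ]
  have h2 : ∀ v, b (π v) = π (a v) := fun v ↦ by rw [h, hπ]
  constructor
  · intro hu
    obtain ⟨d, hd⟩ := hu.exists_left_inv
    refine isUnit_of_injective fun w hw ↦ ?_
    have h3 := phiDen_comp_intertwine h1 w
    rw [hw, map_zero] at h3
    have h4 : d (phiDen a (ι w)) = ι w := by rw [← mul_apply_eq_comp, hd]; rfl
    rw [← hπ w, ← h4, h3, map_zero, map_zero]
  · intro hu
    obtain ⟨d, hd⟩ := hu.exists_left_inv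
    refine isUnit_of_injective fun v hv ↦ ?_
    have h3 := phiDen_comp_intertwine h2 v
    rw [hv, map_zero] at h3
    have h4 : d (phiDen b (π v)) = π v := by rw [← mul_apply_eq_comp, hd]; rfl
    have h5 : π v = 0 := by rw [← h4, h3, map_zero]
    rw [← phiDen_apply_of_apply_eq_zero (a := a) (v := v) (by rw [h, h5, map_zero, map_zero]), hv]

/-- Because `φ(0) = 0`, extending the operator by zero also extends `φ` of it by zero. -/
theorem phi_conj [FiniteDimensional ℂ V] [FiniteDimensional ℂ W] {a : V →L[ℂ] V}
    {b : W →L[ℂ] W} (ι : W →L[ℂ] V) (π : V →L[ℂ] W) (hπ : ∀ w, π (ι w) = w)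
    (h : ∀ v, a v = ι (b (π v))) (ha : IsUnit (phiDen a)) (v : V) :
    phi a v = ι (phi b (π v)) := by
  have hb := (isUnit_phiDen_conj ι π hπ h).1 ha
  rw [← phi_comp_intertwine (fun w ↦ by rw [h, hπ]) ha hb, ← sub_eq_zero, ← map_sub]
  refine phi_apply_of_apply_eq_zero ha ?_
  rw [h, map_sub, hπ, sub_self, map_zero, map_zero]

end PhiEnd

/-! ### Transport of the functional calculus to matrices and direct summands. -/

section Transport

variable {A A' : Type*} [Ring A] [Algebra ℂ A] [TopologicalSpace A] [Ring A'] [Algebra ℂ A']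
  [TopologicalSpace A']

theorem ringInverse_map_algEquiv (L : A ≃ₐ[ℂ] A') (a : A) :
    Ring.inverse (L a) = L (Ring.inverse a) := by
  by_cases ha : IsUnit a
  · obtain ⟨u, rfl⟩ := ha
    rw [Ring.inverse_unit]
    exact Ring.inverse_unit (Units.map (L : A →* A') u)
  · rw [Ring.inverse_non_unit a ha, Ring.inverse_non_unit, map_zero]
    intro hc
    exact ha ((MulEquiv.isUnit_map L).1 hc)

theorem phi_map_algEquiv [T2Space A] [T2Space A'] (L : A ≃ₐ[ℂ] A') (h1 : Continuous L)
    (h2 : Continuous L.symm) (a : A) : phi (L a) = L (phi a) := by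
  let L' : A ≃ₜ A' := ⟨L.toEquiv, h1, h2⟩
  have key : ∀ (c : ℕ → ℂ), ∑' n, c n • ((2⁻¹ : ℂ) • L a) ^ (2 * n) =
      L (∑' n, c n • ((2⁻¹ : ℂ) • a) ^ (2 * n)) := fun c ↦ by
    have := Function.LeftInverse.map_tsum (fun n ↦ c n • ((2⁻¹ : ℂ) • a) ^ (2 * n)) (g := L)
      (g' := L.symm) h1 h2 L.symm_apply_apply (L := SummationFilter.unconditional ℕ)
    rw [this]
    simp only [map_smul, map_pow]
  simp only [phi, phiDen, phiNum]
  rw [key, key, ringInverse_map_algEquiv, map_smul, map_mul, map_mul]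

end Transport

section PhiEndLink

variable {V W : Type*} [NormedAddCommGroup V] [NormedSpace ℂ V] [FiniteDimensional ℂ V]
  [CompleteSpace V] [AddCommGroup W] [Module ℂ W] [FiniteDimensional ℂ W]

/-- The functional calculus `phiEnd` on a direct summand `W` of `V`. -/
theorem phiEnd_conj (ι : W →ₗ[ℂ] V) (π : V →ₗ[ℂ] W) (hπ : ∀ w, π (ι w) = w) (T : Module.End ℂ W)
    (a : V →L[ℂ] V) (h : ∀ v, a v = ι (T (π v))) :
    (IsUnit (phiDen a) ↔ ∀ n : ℤ, n ≠ 0 → ¬ T.HasEigenvalue (2 * Real.pi * Complex.I * n)) ∧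
      (IsUnit (phiDen a) → ∀ v, phi a v = ι (phiEnd T (π v))) := by
  let b := Module.finBasis ℂ W
  let n := Fin (Module.finrank ℂ W)
  -- `W` carries no norm, so the Banach algebra calculus is applied on the coordinate space of the
  -- basis used in `phiEnd`.
  let L : Matrix n n ℂ ≃ₐ[ℂ] ((n → ℂ) →L[ℂ] (n → ℂ)) :=
    Matrix.toLinAlgEquiv'.trans (Module.End.toContinuousLinearMap (n → ℂ))
  have h1 : Continuous L := L.toLinearMap.continuous_of_finiteDimensional
  have h2 : Continuous L.symm := L.symm.toLinearMap.continuous_of_finiteDimensional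
  let ι' : (n → ℂ) →L[ℂ] V := LinearMap.toContinuousLinearMap (ι ∘ₗ b.equivFun.symm.toLinearMap)
  let π' : V →L[ℂ] (n → ℂ) := LinearMap.toContinuousLinearMap (b.equivFun.toLinearMap ∘ₗ π)
  have hπ' : ∀ w, π' (ι' w) = w := fun w ↦ by
    change b.equivFun (π (ι (b.equivFun.symm w))) = w
    rw [hπ, LinearEquiv.apply_symm_apply]
  have hL : ∀ S w, L (LinearMap.toMatrix b b S) w = b.equivFun (S (b.equivFun.symm w)) :=
    fun S w ↦ by
      change Matrix.mulVec (LinearMap.toMatrix b b S) w = _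
      have := LinearMap.toMatrix_mulVec_repr b b S (b.equivFun.symm w)
      rw [← Module.Basis.equivFun_apply, LinearEquiv.apply_symm_apply] at this
      rw [this]
      rfl
  have hL' : ∀ M w, Matrix.toLin b b M w = b.equivFun.symm (L M (b.equivFun w)) := fun M w ↦ by
    conv_rhs => rw [← LinearMap.toMatrix_toLin b b M]
    rw [hL]
    simp
  have ha : ∀ v, a v = ι' (L (LinearMap.toMatrix b b T) (π' v)) := fun v ↦ by
    rw [h, hL]
    change _ = ι (b.equivFun.symm (b.equivFun (T (b.equivFun.symm (b.equivFun (π v))))))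
    rw [LinearEquiv.symm_apply_apply, LinearEquiv.symm_apply_apply]
  refine ⟨?_, fun hu v ↦ ?_⟩
  · rw [isUnit_phiDen_conj ι' π' hπ' ha, isUnit_phiDen_iff]
    refine forall_congr' fun k ↦ imp_congr_right fun _ ↦ not_congr ?_
    constructor
    · intro hev
      obtain ⟨w, hw⟩ := hev.exists_hasEigenvector
      refine Module.End.hasEigenvalue_of_hasEigenvector (x := b.equivFun.symm w)
        ⟨Module.End.mem_eigenspace_iff.2 ?_, fun h0 ↦ hw.2 (by simpa only [map_eq_zero_iff, EmbeddingLike.map_eq_zero_iff] using h0)⟩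
      have := hw.apply_eq_smul
      change L _ w = _ at this
      rw [hL] at this
      rw [← map_smul, ← this, LinearEquiv.symm_apply_apply]
    · intro hev
      obtain ⟨w, hw⟩ := hev.exists_hasEigenvector
      refine Module.End.hasEigenvalue_of_hasEigenvector (x := b.equivFun w)
        ⟨Module.End.mem_eigenspace_iff.2 ?_, fun h0 ↦ hw.2 (by simpa only [map_eq_zero_iff, EmbeddingLike.map_eq_zero_iff] using h0)⟩
      change L _ (b.equivFun w) = _
      rw [hL, LinearEquiv.symm_apply_apply, hw.apply_eq_smul, map_smul]
  · rw [phi_conj ι' π' hπ' ha hu, phi_map_algEquiv L h1 h2, phiEnd, hL']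
    rfl

end PhiEndLink

/-! ### Lie groups in the preferred chart at the identity -/

section LieGroupChart

open Filter Topology

variable (E G : Type*) [NormedAddCommGroup E] [NormedSpace ℂ E] [FiniteDimensional ℂ E]
  [CompleteSpace E] [TopologicalSpace G] [ChartedSpace E G] [Group G] [LieGroup 𝓘(ℂ, E) ω G]

/-- The coordinates of the identity. -/
def org : E := extChartAt 𝓘(ℂ, E) (1 : G) 1

variable {G}

/-- The preferred chart at the identity. -/
def cht (g : G) : E := extChartAt 𝓘(ℂ, E) (1 : G) g

variable {E}

/-- The parametrization inverse to the preferred chart at the identity. -/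
def par (x : E) : G := (extChartAt 𝓘(ℂ, E) (1 : G)).symm x

theorem par_org : (par (org E G) : G) = 1 := extChartAt_to_inv (I := 𝓘(ℂ, E)) (1 : G)

theorem cht_one : cht E (1 : G) = org E G := rfl

theorem contMDiffAt_cht : ContMDiffAt 𝓘(ℂ, E) 𝓘(ℂ, E) ω (cht E : G → E) 1 :=
  contMDiffAt_extChartAt

theorem contMDiffAt_par : ContMDiffAt 𝓘(ℂ, E) 𝓘(ℂ, E) ω (par : E → G) (org E G) := by
  exact (contMDiffOn_extChartAt_symm (1 : G)).contMDiffAt (extChartAt_target_mem_nhds (1 : G))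

theorem eventually_cht_par : ∀ᶠ x in 𝓝 (org E G), cht E (par x : G) = x :=
  Filter.Eventually.mono (extChartAt_target_mem_nhds (I := 𝓘(ℂ, E)) (1 : G))
    fun _ hx ↦ (extChartAt 𝓘(ℂ, E) (1 : G)).right_inv hx

theorem eventually_par_cht : ∀ᶠ g in 𝓝 (1 : G), par (cht E g) = g :=
  Filter.Eventually.mono (extChartAt_source_mem_nhds (I := 𝓘(ℂ, E)) (1 : G))
    fun _ hx ↦ (extChartAt 𝓘(ℂ, E) (1 : G)).left_inv hx

variable (G) in
/-- The multiplication in the chart at the identity. -/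
def locMul (v : E × E) : E := cht E (par v.1 * par v.2 : G)

variable (G) in
/-- The conjugation in the chart at the identity. -/
def locConj (v : E × E) : E := cht E (par v.1 * par v.2 * (par v.1)⁻¹ : G)

theorem contMDiffAt_par_fst : ContMDiffAt 𝓘(ℂ, E × E) 𝓘(ℂ, E) ω (fun v : E × E ↦ (par v.1 : G))
    (org E G, org E G) :=
  ContMDiffAt.comp (x := (org E G, org E G)) (g := (par : E → G)) (f := fun v : E × E ↦ v.1)
    contMDiffAt_par contDiffAt_fst.contMDiffAt

theorem contMDiffAt_par_snd : ContMDiffAt 𝓘(ℂ, E × E) 𝓘(ℂ, E) ω (fun v : E × E ↦ (par v.2 : G))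
    (org E G, org E G) :=
  ContMDiffAt.comp (x := (org E G, org E G)) (g := (par : E → G)) (f := fun v : E × E ↦ v.2)
    contMDiffAt_par contDiffAt_snd.contMDiffAt

theorem analyticAt_locMul : AnalyticAt ℂ (locMul G : E × E → E) (org E G, org E G) := by
  have h1 : ContMDiffAt 𝓘(ℂ, E × E) 𝓘(ℂ, E) ω (fun v : E × E ↦ (par v.1 * par v.2 : G))
    (org E G, org E G) := contMDiffAt_par_fst.mul contMDiffAt_par_snd
  have h2 := ContMDiffAt.comp_of_eq (contMDiffAt_cht (E := E) (G := G)) h1 (by simp [par_org])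
  exact (contMDiffAt_iff_contDiffAt.1 h2).analyticAt

theorem analyticAt_locConj : AnalyticAt ℂ (locConj G : E × E → E) (org E G, org E G) := by
  have h1 : ContMDiffAt 𝓘(ℂ, E × E) 𝓘(ℂ, E) ω
    (fun v : E × E ↦ (par v.1 * par v.2 * (par v.1)⁻¹ : G)) (org E G, org E G) :=
    (contMDiffAt_par_fst.mul contMDiffAt_par_snd).mul contMDiffAt_par_fst.inv
  have h2 := ContMDiffAt.comp_of_eq (contMDiffAt_cht (E := E) (G := G)) h1 (by simp [par_org])
  exact (contMDiffAt_iff_contDiffAt.1 h2).analyticAt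

theorem locMul_org_right : ∀ᶠ x in 𝓝 (org E G), locMul G (x, org E G) = x := by
  filter_upwards [eventually_cht_par (E := E) (G := G)] with x hx
  simp [locMul, par_org, hx]

theorem locMul_org_left : ∀ᶠ x in 𝓝 (org E G), locMul G (org E G, x) = x := by
  filter_upwards [eventually_cht_par (E := E) (G := G)] with x hx
  simp [locMul, par_org, hx]

theorem eventually_par_locMul : ∀ᶠ v in 𝓝 (org E G, org E G),
    (par (locMul G v) : G) = par v.1 * par v.2 := by
  have h1 : ContinuousAt (fun v : E × E ↦ (par v.1 * par v.2 : G)) (org E G, org E G) :=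
    (contMDiffAt_par_fst.mul contMDiffAt_par_snd).continuousAt
  have h2 : Tendsto (fun v : E × E ↦ (par v.1 * par v.2 : G)) (𝓝 (org E G, org E G)) (𝓝 1) := by
    have := h1.tendsto
    simpa [par_org] using this
  exact h2.eventually eventually_par_cht

variable (G) in
/-- The left invariant frame in the chart at the identity. -/
def leftFrame (x : E) : E →L[ℂ] E := fderiv ℂ (fun y ↦ locMul G (x, y)) (org E G)

theorem hasFDerivAt_partial_right {F : E × E → E} {x y : E} (h : AnalyticAt ℂ F (x, y)) :
    HasFDerivAt (fun y ↦ F (x, y)) ((fderiv ℂ F (x, y)).comp (ContinuousLinearMap.inr ℂ E E)) y :=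
  h.differentiableAt.hasFDerivAt.comp y (hasFDerivAt_prodMk_right x y)

theorem hasFDerivAt_partial_left {F : E × E → E} {x y : E} (h : AnalyticAt ℂ F (x, y)) :
    HasFDerivAt (fun x ↦ F (x, y)) ((fderiv ℂ F (x, y)).comp (ContinuousLinearMap.inl ℂ E E)) x :=
  h.differentiableAt.hasFDerivAt.comp x (hasFDerivAt_prodMk_left x y)

theorem eventually_slice {F : E × E → E} {x y : E} (h : AnalyticAt ℂ F (x, y)) :
    ∀ᶠ x' in 𝓝 x, AnalyticAt ℂ F (x', y) :=
  (Continuous.prodMk_left y).continuousAt.eventually h.eventually_analyticAt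

theorem eventually_slice' {F : E × E → E} {x y : E} (h : AnalyticAt ℂ F (x, y)) :
    ∀ᶠ y' in 𝓝 y, AnalyticAt ℂ F (x, y') :=
  (Continuous.prodMk_right x).continuousAt.eventually h.eventually_analyticAt

theorem leftFrame_eventually_eq : leftFrame G =ᶠ[𝓝 (org E G)]
    fun x ↦ (fderiv ℂ (locMul G) (x, org E G)).comp (ContinuousLinearMap.inr ℂ E E) := by
  filter_upwards [eventually_slice (analyticAt_locMul (E := E) (G := G))] with x hx
  exact (hasFDerivAt_partial_right hx).fderiv

theorem analyticAt_fderiv_slice_right {F : E × E → E} {x y : E} (h : AnalyticAt ℂ F (x, y)) :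
    AnalyticAt ℂ (fun x ↦ (fderiv ℂ F (x, y)).comp (ContinuousLinearMap.inr ℂ E E)) x := by
  have h1 : AnalyticAt ℂ (fun x ↦ fderiv ℂ F (x, y)) x :=
    h.fderiv.comp₂ analyticAt_id analyticAt_const
  exact ((ContinuousLinearMap.compL ℂ E (E × E) E).flip
    (ContinuousLinearMap.inr ℂ E E)).analyticAt _ |>.comp h1

theorem analyticAt_leftFrame : AnalyticAt ℂ (leftFrame G : E → E →L[ℂ] E) (org E G) :=
  (analyticAt_fderiv_slice_right analyticAt_locMul).congr leftFrame_eventually_eq.symm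

theorem leftFrame_org : leftFrame G (org E G) = ContinuousLinearMap.id ℂ E := by
  rw [leftFrame]
  exact ((hasFDerivAt_id _).congr_of_eventuallyEq locMul_org_left).fderiv

/-- The adjoint action in the chart at the identity. -/
def adj (g : G) : E →L[ℂ] E := fderiv ℂ (fun y ↦ cht E (g * par y * g⁻¹)) (org E G)

theorem contMDiffAt_conj (g h : G) :
    ContMDiffAt 𝓘(ℂ, E) 𝓘(ℂ, E) ω (fun k : G ↦ g * k * g⁻¹) h :=
  (contMDiffAt_const.mul contMDiffAt_id).mul contMDiffAt_const

theorem differentiableAt_conj (g : G) :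
    DifferentiableAt ℂ (fun y ↦ cht E (g * par y * g⁻¹)) (org E G) := by
  have h1 := ContMDiffAt.comp_of_eq (contMDiffAt_conj (E := E) g 1) contMDiffAt_par par_org
  have h2 := ContMDiffAt.comp_of_eq (contMDiffAt_cht (E := E) (G := G)) h1 (by simp [par_org])
  exact (contMDiffAt_iff_contDiffAt.1 h2).differentiableAt (by simp)

theorem Ad_apply (g : G) (x : E) : (Ad g (x : GroupLieAlgebra 𝓘(ℂ, E) G) : E) = adj g x := by
  have h : MDifferentiableAt 𝓘(ℂ, E) 𝓘(ℂ, E) (fun k : G ↦ g * k * g⁻¹) 1 :=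
    (contMDiffAt_conj g 1).mdifferentiableAt (by simp)
  have e : writtenInExtChartAt 𝓘(ℂ, E) 𝓘(ℂ, E) 1 (fun k : G ↦ g * k * g⁻¹) =
      fun y ↦ cht E (g * par y * g⁻¹) := by
    have : (fun k : G ↦ g * k * g⁻¹) 1 = 1 := by group
    unfold writtenInExtChartAt
    rw [this]
    rfl
  have h2 : fderivWithin ℂ (writtenInExtChartAt 𝓘(ℂ, E) 𝓘(ℂ, E) 1 (fun k : G ↦ g * k * g⁻¹))
      (Set.range 𝓘(ℂ, E)) (org E G) x = adj g x := by
    rw [e, modelWithCornersSelf_coe, Set.range_id, fderivWithin_univ, adj]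
  exact (DFunLike.congr_fun h.mfderiv _).trans h2

theorem tendsto_conj (g : G) : Tendsto (fun y : E ↦ g * par y * g⁻¹) (𝓝 (org E G)) (𝓝 1) := by
  have h1 := (ContMDiffAt.comp_of_eq (contMDiffAt_conj (E := E) g 1) contMDiffAt_par
    par_org).continuousAt.tendsto
  simpa [Function.comp_def, par_org] using h1

/-- Chain rule; locally the chart and its parametrization cancel between the two conjugations. -/
theorem adj_mul (g h : G) : (adj (g * h) : E →L[ℂ] E) = (adj g).comp (adj h) := by
  have e : (fun y : E ↦ cht E (g * h * par y * (g * h)⁻¹)) =ᶠ[𝓝 (org E G)]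
      (fun y ↦ cht E (g * par y * g⁻¹)) ∘ fun y ↦ cht E (h * par y * h⁻¹) := by
    filter_upwards [(tendsto_conj h).eventually (eventually_par_cht (E := E))] with y hy
    rw [Function.comp_apply, hy]
    congr 1
    group
  have hh : cht E (h * par (org E G) * h⁻¹) = org E G := by simp [par_org, cht_one]
  rw [adj, e.fderiv_eq, fderiv_comp, hh]
  · rfl
  · rw [hh]; exact differentiableAt_conj g
  · exact differentiableAt_conj h

theorem adj_one : (adj (1 : G) : E →L[ℂ] E) = ContinuousLinearMap.id ℂ E := by
  have e : (fun y : E ↦ cht E (1 * par y * (1 : G)⁻¹)) =ᶠ[𝓝 (org E G)] id := by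
    filter_upwards [eventually_cht_par (E := E) (G := G)] with y hy
    simpa using hy
  rw [adj, e.fderiv_eq, fderiv_id]

theorem adj_inv_adj (g : G) (x : E) : adj g⁻¹ (adj g x) = x := by
  rw [← ContinuousLinearMap.comp_apply, ← adj_mul, inv_mul_cancel, adj_one]; rfl

theorem adj_adj_inv (g : G) (x : E) : adj g (adj g⁻¹ x) = x := by
  rw [← ContinuousLinearMap.comp_apply, ← adj_mul, mul_inv_cancel, adj_one]; rfl

theorem analyticAt_adj_par : AnalyticAt ℂ (fun x : E ↦ (adj (par x : G) : E →L[ℂ] E))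
    (org E G) := by
  refine (analyticAt_fderiv_slice_right analyticAt_locConj).congr ?_
  filter_upwards [eventually_slice (analyticAt_locConj (E := E) (G := G))] with x hx
  exact (hasFDerivAt_partial_right hx).fderiv.symm

end LieGroupChart

/-! ### The Lie bracket in the chart and its relation to the adjoint action. -/

section LieBracketChart

open Filter Topology VectorField

variable {E G : Type*} [NormedAddCommGroup E] [NormedSpace ℂ E] [FiniteDimensional ℂ E]
  [CompleteSpace E] [TopologicalSpace G] [ChartedSpace E G] [Group G] [LieGroup 𝓘(ℂ, E) ω G]

variable (E G) in
/-- The tautological identification of the Lie algebra with the model space. -/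
def toModel : GroupLieAlgebra 𝓘(ℂ, E) G ≃ₗ[ℂ] E where
  toFun x := x
  invFun x := x
  map_add' _ _ := rfl
  map_smul' _ _ := rfl
  left_inv _ := rfl
  right_inv _ := rfl

instance isManifold_one_of_lieGroup : IsManifold 𝓘(ℂ, E) 1 G :=
  IsManifold.of_le (n := ω) (by simp)

theorem mfderiv_par_org (v : E) :
    (mfderiv 𝓘(ℂ, E) 𝓘(ℂ, E) (par : E → G) (org E G) v : E) = v := by
  have h := mfderivWithin_range_extChartAt_symm (I := 𝓘(ℂ, E)) (x := (1 : G))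
  rw [modelWithCornersSelf_coe, Set.range_id, mfderivWithin_univ] at h
  exact DFunLike.congr_fun h v

theorem mdifferentiableAt_mul_left' (g h : G) :
    MDifferentiableAt 𝓘(ℂ, E) 𝓘(ℂ, E) (fun k : G ↦ g * k) h :=
  (contMDiff_mul_left (I := 𝓘(ℂ, E)) (n := ω)).contMDiffAt.mdifferentiableAt (by simp)

/-- Differentiate `par (locMul (x, y)) = par x * par y` in `y` at the identity; this identity is
needed near every `x` close to the origin. -/
theorem mfderiv_par_leftFrame (v : E) : ∀ᶠ x in 𝓝 (org E G),
    (mfderiv 𝓘(ℂ, E) 𝓘(ℂ, E) (par : E → G) x (leftFrame G x v) : E) =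
      mulInvariantVectorField (I := 𝓘(ℂ, E)) ((toModel E G).symm v) (par x) := by
  have hpar : ∀ᶠ x in 𝓝 (org E G), MDifferentiableAt 𝓘(ℂ, E) 𝓘(ℂ, E) (par : E → G) x := by
    filter_upwards [extChartAt_target_mem_nhds (I := 𝓘(ℂ, E)) (1 : G)] with x hx
    have := mdifferentiableWithinAt_extChartAt_symm (I := 𝓘(ℂ, E)) hx
    rwa [modelWithCornersSelf_coe, Set.range_id, mdifferentiableWithinAt_univ] at this
  have hmul : ∀ᶠ x in 𝓝 (org E G), ∀ᶠ y in 𝓝 (org E G),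
      (par (locMul G (x, y)) : G) = par x * par y := by
    have h1 := (eventually_par_locMul (E := E) (G := G)).eventually_nhds
    have h2 : ∀ᶠ x in 𝓝 (org E G), ∀ᶠ v in 𝓝 (x, org E G),
        (par (locMul G v) : G) = par v.1 * par v.2 :=
      (Continuous.prodMk_left (org E G)).continuousAt.eventually h1
    filter_upwards [h2] with x hx
    exact (Continuous.prodMk_right x).continuousAt.eventually hx
  filter_upwards [hpar, hmul, locMul_org_right,
    eventually_slice (analyticAt_locMul (E := E) (G := G))] with x hx hm hxo hxa
  have e : (par ∘ fun y ↦ locMul G (x, y) : E → G) =ᶠ[𝓝 (org E G)]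
      (fun k : G ↦ par x * k) ∘ par := hm
  have hd : MDifferentiableAt 𝓘(ℂ, E) 𝓘(ℂ, E) (fun y ↦ locMul G (x, y)) (org E G) :=
    (hasFDerivAt_partial_right hxa).differentiableAt.mdifferentiableAt
  have hp0 : MDifferentiableAt 𝓘(ℂ, E) 𝓘(ℂ, E) (par : E → G) (org E G) := hpar.self_of_nhds
  have h1 := mfderiv_comp_of_eq hx hd hxo
  have h2 := mfderiv_comp_of_eq (mdifferentiableAt_mul_left' (E := E) (par x : G) 1) hp0 par_org
  have h3 := e.mfderiv_eq (I := 𝓘(ℂ, E)) (I' := 𝓘(ℂ, E))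
  have h4 : (mfderiv 𝓘(ℂ, E) 𝓘(ℂ, E) (fun y ↦ locMul G (x, y)) (org E G) v : E) =
    leftFrame G x v := by rw [mfderiv_eq_fderiv]; rfl
  have h5 : (mfderiv 𝓘(ℂ, E) 𝓘(ℂ, E) (par ∘ fun y ↦ locMul G (x, y) : E → G) (org E G) v : E) =
      mfderiv 𝓘(ℂ, E) 𝓘(ℂ, E) ((fun k : G ↦ par x * k) ∘ par) (org E G) v :=
    DFunLike.congr_fun h3 v
  have h8 : ∀ z : E, z = x → ∀ u : E, (mfderiv 𝓘(ℂ, E) 𝓘(ℂ, E) (par : E → G) z u : E) =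
      mfderiv 𝓘(ℂ, E) 𝓘(ℂ, E) (par : E → G) x u := by rintro _ rfl u; rfl
  have h9 : ∀ k : G, k = 1 → ∀ u : E, (mfderiv 𝓘(ℂ, E) 𝓘(ℂ, E) (fun k : G ↦ par x * k) k u : E) =
      mfderiv 𝓘(ℂ, E) 𝓘(ℂ, E) (fun k : G ↦ par x * k) 1 u := by rintro _ rfl u; rfl
  have h6 : (mfderiv 𝓘(ℂ, E) 𝓘(ℂ, E) (par ∘ fun y ↦ locMul G (x, y) : E → G) (org E G) v : E) =
      mfderiv 𝓘(ℂ, E) 𝓘(ℂ, E) (par : E → G) x (leftFrame G x v) :=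
    (DFunLike.congr_fun h1 v).trans ((h8 _ hxo _).trans
      (congrArg (mfderiv 𝓘(ℂ, E) 𝓘(ℂ, E) (par : E → G) x) h4))
  have h7 : (mfderiv 𝓘(ℂ, E) 𝓘(ℂ, E) ((fun k : G ↦ par x * k) ∘ par) (org E G) v : E) =
      mfderiv 𝓘(ℂ, E) 𝓘(ℂ, E) (fun k : G ↦ par x * k) 1 v :=
    (DFunLike.congr_fun h2 v).trans ((h9 _ par_org _).trans
      (congrArg (mfderiv 𝓘(ℂ, E) 𝓘(ℂ, E) (fun k : G ↦ par x * k) 1) (mfderiv_par_org v)))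
  exact h6.symm.trans (h5.trans h7)

theorem mpullback_mulInvariantVectorField_par (v : E) : ∀ᶠ x in 𝓝 (org E G),
    (mpullbackWithin 𝓘(ℂ, E) 𝓘(ℂ, E) (extChartAt 𝓘(ℂ, E) (1 : G)).symm
      (mulInvariantVectorField ((toModel E G).symm v)) (Set.range 𝓘(ℂ, E)) x : E) =
      leftFrame G x v := by
  filter_upwards [mfderiv_par_leftFrame (G := G) v,
    extChartAt_target_mem_nhds (I := 𝓘(ℂ, E)) (1 : G)] with x hx hxt
  have hinv := isInvertible_mfderivWithin_extChartAt_symm (I := 𝓘(ℂ, E)) hxt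
  refine hinv.inverse_apply_eq.2 ?_
  have e : mfderivWithin 𝓘(ℂ, E) 𝓘(ℂ, E) (extChartAt 𝓘(ℂ, E) (1 : G)).symm (Set.range 𝓘(ℂ, E)) x =
      mfderiv 𝓘(ℂ, E) 𝓘(ℂ, E) (extChartAt 𝓘(ℂ, E) (1 : G)).symm x := by
    rw [modelWithCornersSelf_coe, Set.range_id, mfderivWithin_univ]
  rw [e]
  exact hx.symm

theorem lieBracketWithin_leftFrame {V W : E → E} {v w : E}
    (hV : ∀ᶠ x in 𝓝 (org E G), V x = leftFrame G x v)
    (hW : ∀ᶠ x in 𝓝 (org E G), W x = leftFrame G x w) :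
    lieBracketWithin ℂ V W Set.univ (org E G) =
      fderiv ℂ (leftFrame G) (org E G) v w - fderiv ℂ (leftFrame G) (org E G) w v := by
  have hd : ∀ u : E, fderiv ℂ (fun x ↦ leftFrame G x u) (org E G) =
      (fderiv ℂ (leftFrame G) (org E G)).flip u := fun u ↦ by
    have := (analyticAt_leftFrame (E := E) (G := G)).differentiableAt.hasFDerivAt.clm_apply
      (hasFDerivAt_const u (org E G))
    rw [this.fderiv]
    ext z
    simp
  rw [lieBracketWithin_univ, Filter.EventuallyEq.lieBracket_vectorField_eq (𝕜 := ℂ) hV hW,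
    lieBracket_eq]
  simp only [hd, leftFrame_org, ContinuousLinearMap.flip_apply, ContinuousLinearMap.id_apply]

/-- In the chart the invariant fields are `x ↦ leftFrame x v`, and the frame is the identity at the
origin, so their commutator is the antisymmetrized derivative of the frame. -/
theorem toModel_lie (v w : GroupLieAlgebra 𝓘(ℂ, E) G) :
    toModel E G ⁅v, w⁆ =
      fderiv ℂ (leftFrame G) (org E G) (toModel E G v) (toModel E G w) -
        fderiv ℂ (leftFrame G) (org E G) (toModel E G w) (toModel E G v) := by
  have e1 := lieBracketWithin_leftFrame (G := G)
    (mpullback_mulInvariantVectorField_par (G := G) (toModel E G v))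
    (mpullback_mulInvariantVectorField_par (G := G) (toModel E G w))
  have hs : (extChartAt 𝓘(ℂ, E) (1 : G)).symm ⁻¹' Set.univ ∩ Set.range 𝓘(ℂ, E) = Set.univ := by
    simp
  rw [← hs] at e1
  have e2 := mfderiv_extChartAt_self (I := 𝓘(ℂ, E)) (x := (1 : G))
  have e3 := isInvertible_mfderiv_extChartAt (I := 𝓘(ℂ, E)) (mem_extChartAt_source (1 : G))
  have e4 : ∀ z : E, ((mfderiv 𝓘(ℂ, E) 𝓘(ℂ, E) (extChartAt 𝓘(ℂ, E) (1 : G)) 1).inverse z : E) = z :=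
    fun z ↦ e3.inverse_apply_eq.2 (DFunLike.congr_fun e2 z).symm
  exact (e4 _).trans e1

/-- The differential of the adjoint action is the adjoint action of the Lie algebra. -/
theorem fderiv_adj_par (v w : GroupLieAlgebra 𝓘(ℂ, E) G) :
    fderiv ℂ (fun x : E ↦ (adj (par x : G) : E →L[ℂ] E)) (org E G) (toModel E G v) (toModel E G w) =
      toModel E G ⁅v, w⁆ := by
  set o := org E G with ho
  set m := locMul G (E := E) with hm
  have ha : AnalyticAt ℂ m (o, o) := analyticAt_locMul
  -- `x y = (Ad_x y) x`, differentiated in `y`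
  have hkey : ∀ᶠ x in 𝓝 o, leftFrame G x =
      ((fderiv ℂ m (o, x)).comp (ContinuousLinearMap.inl ℂ E E)).comp (adj (par x : G)) := by
    have h1 : ∀ᶠ v in 𝓝 (o, o), m (locConj G v, v.1) = m v := by
      have h2 : Tendsto (fun v : E × E ↦ (par v.1 * par v.2 * (par v.1)⁻¹ : G)) (𝓝 (o, o))
          (𝓝 1) := by
        have := ((contMDiffAt_par_fst.mul contMDiffAt_par_snd).mul
          (contMDiffAt_par_fst (E := E) (G := G)).inv).continuousAt.tendsto
        simpa [par_org, Pi.mul_def] using this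
      filter_upwards [h2.eventually (eventually_par_cht (E := E))] with v hv
      rw [hm, locMul, locMul, locConj, hv]
      simp
    have h3 : ∀ᶠ x in 𝓝 o, ∀ᶠ y in 𝓝 o, m (locConj G (x, y), x) = m (x, y) := by
      have h2 : ∀ᶠ x in 𝓝 o, ∀ᶠ v in 𝓝 (x, o), m (locConj G v, v.1) = m v :=
        (Continuous.prodMk_left o).continuousAt.eventually h1.eventually_nhds
      filter_upwards [h2] with x hx
      exact (Continuous.prodMk_right x).continuousAt.eventually hx
    filter_upwards [h3, eventually_slice (analyticAt_locConj (E := E) (G := G)),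
      eventually_slice' ha] with x h4 h5 h6
    have h7 : HasFDerivAt (fun y ↦ locConj G (x, y)) (adj (par x : G)) o :=
      (hasFDerivAt_partial_right h5).differentiableAt.hasFDerivAt
    have h8 : locConj G (x, o) = o := by simp [locConj, ho, par_org, cht_one]
    have h9 : HasFDerivAt (fun z ↦ m (z, x)) ((fderiv ℂ m (o, x)).comp
      (ContinuousLinearMap.inl ℂ E E)) (locConj G (x, o)) := by
      rw [h8]; exact hasFDerivAt_partial_left h6
    have h11 : HasFDerivAt (fun y ↦ m (locConj G (x, y), x)) _ o :=
      HasFDerivAt.comp (g := fun z ↦ m (z, x)) (f := fun y ↦ locConj G (x, y)) o h9 h7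
    have h10 := h11.congr_of_eventuallyEq (f₁ := fun y ↦ m (x, y)) (h4.mono fun y hy ↦ hy.symm)
    exact h10.fderiv
  have hA : HasFDerivAt (fun x : E ↦ (adj (par x : G) : E →L[ℂ] E))
    (fderiv ℂ (fun x : E ↦ (adj (par x : G) : E →L[ℂ] E)) o) o :=
    (analyticAt_adj_par (E := E) (G := G)).differentiableAt.hasFDerivAt
  have hd2 : HasFDerivAt (fderiv ℂ m) (fderiv ℂ (fderiv ℂ m) (o, o)) (o, o) :=
    ha.fderiv.differentiableAt.hasFDerivAt
  have hsym : ∀ a b, fderiv ℂ (fderiv ℂ m) (o, o) a b = fderiv ℂ (fderiv ℂ m) (o, o) b a := by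
    have := ha.contDiffAt (n := ω) |>.isSymmSndFDerivAt (by simp)
    exact fun a b ↦ this a b
  -- The derivative of the left frame is a mixed second derivative of the multiplication. Computing
  -- it a second time through `x y = (Ad_x y) x` gives the opposite mixed derivative plus the
  -- derivative of `Ad`; symmetry then identifies the latter with the bracket.
  have hL : ∀ a b, fderiv ℂ (leftFrame G) o a b =
      fderiv ℂ (fderiv ℂ m) (o, o) (a, 0) (0, b) := fun a b ↦ by
    have h0 : HasFDerivAt (fun x ↦ fderiv ℂ m (x, o)) _ o :=
      HasFDerivAt.comp (g := fderiv ℂ m) (f := fun x : E ↦ (x, o)) o hd2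
        (hasFDerivAt_prodMk_left o o)
    have h1 : HasFDerivAt (fun x ↦ fderiv ℂ m (x, o) (0, b)) _ o :=
      h0.clm_apply (hasFDerivAt_const ((0 : E), b) o)
    have h2 := (analyticAt_leftFrame (E := E) (G := G)).differentiableAt.hasFDerivAt.clm_apply
      (hasFDerivAt_const b o)
    have h3 : (fun x ↦ leftFrame G x b) =ᶠ[𝓝 o] fun x ↦ fderiv ℂ m (x, o) (0, b) := by
      filter_upwards [leftFrame_eventually_eq (E := E) (G := G)] with x hx
      rw [hx]; rfl
    have h4 := DFunLike.congr_fun ((h1.congr_of_eventuallyEq h3).unique h2) a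
    simp at h4
    exact h4.symm
  have hR : ∀ a b, fderiv ℂ (leftFrame G) o a b =
      fderiv ℂ (fderiv ℂ m) (o, o) (0, a) (b, 0) +
        fderiv ℂ (fun x : E ↦ (adj (par x : G) : E →L[ℂ] E)) o a b := fun a b ↦ by
    have h0 : HasFDerivAt (fun x ↦ fderiv ℂ m (o, x)) _ o :=
      hd2.comp o (hasFDerivAt_prodMk_right o o)
    have h0' := hA.clm_apply (hasFDerivAt_const b o)
    have hpair : HasFDerivAt (fun x ↦ ((adj (par x : G) b : E), (0 : E))) _ o :=
      h0'.prodMk (hasFDerivAt_const (0 : E) o)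
    have h1 := h0.clm_apply hpair
    have h2 := (analyticAt_leftFrame (E := E) (G := G)).differentiableAt.hasFDerivAt.clm_apply
      (hasFDerivAt_const b o)
    have h3 : (fun x ↦ leftFrame G x b) =ᶠ[𝓝 o] fun x ↦ fderiv ℂ m (o, x) (adj (par x : G) b, 0) := by
      filter_upwards [hkey] with x hx
      rw [hx]; rfl
    have h4 := DFunLike.congr_fun ((h1.congr_of_eventuallyEq h3).unique h2) a
    have h5 : ∀ c : E, fderiv ℂ m (o, o) (c, 0) = c := fun c ↦ by
      have h6 : HasFDerivAt (fun z ↦ m (z, o)) (ContinuousLinearMap.id ℂ E) o :=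
        (hasFDerivAt_id _).congr_of_eventuallyEq locMul_org_right
      exact DFunLike.congr_fun ((hasFDerivAt_partial_left ha).unique h6) c
    have h7 : (adj (par o : G) : E →L[ℂ] E) b = b := by rw [ho, par_org, adj_one]; rfl
    simp [h7] at h4
    rw [h5] at h4
    rw [← h4]
    abel
  rw [toModel_lie]
  have e1 := hR (toModel E G v) (toModel E G w)
  have e2 := hL (toModel E G w) (toModel E G v)
  rw [hsym] at e1
  rw [← e2] at e1
  rw [e1]
  abel

end LieBracketChart

/-! ### The algebraic identity behind the Jacobi identity -/

section JacobiCore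

variable {V : Type*} [NormedAddCommGroup V] [NormedSpace ℂ V] [FiniteDimensional ℂ V]
  {br : V →L[ℂ] V →L[ℂ] V} {B : V →L[ℂ] V →L[ℂ] ℂ}

namespace IsMetrized

theorem rotate (h : IsMetrized br B) (a b c : V) : B a (br b c) = B b (br c a) := by
  rw [h.symm b, h.inv c a b, h.skew c b, map_neg, neg_neg]

theorem swap (h : IsMetrized br B) (a b c : V) : B a (br b c) = -B a (br c b) := by
  rw [h.skew, map_neg]

end IsMetrized

/-- The restriction of a bracket to the image of a projection. -/
def projBr (br : V →L[ℂ] V →L[ℂ] V) (p : V →L[ℂ] V) : V →L[ℂ] V →L[ℂ] V :=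
  (br.comp p).flip.comp p |>.flip

theorem projBr_apply (p : V →L[ℂ] V) (x y : V) : projBr br p x y = br (p x) (p y) := rfl

/-- `p` is a self-adjoint projection onto a subalgebra. -/
structure IsSubalgProj (br : V →L[ℂ] V →L[ℂ] V) (B : V →L[ℂ] V →L[ℂ] ℂ) (p : V →L[ℂ] V) :
    Prop where
  symm : ∀ x y, B (p x) y = B x (p y)
  idem : ∀ x, p (p x) = p x
  lie : ∀ x y, p (br (p x) (p y)) = br (p x) (p y)

namespace IsSubalgProj

variable {p : V →L[ℂ] V}

theorem isMetrized (h : IsMetrized br B) (hp : IsSubalgProj br B p) :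
    IsMetrized (projBr br p) B where
  skew x y := by rw [projBr_apply, projBr_apply, h.skew]
  jacobi x y z := by
    simp only [projBr_apply, hp.lie]
    exact h.jacobi _ _ _
  symm := h.symm
  inv x y z := by
    rw [projBr_apply, projBr_apply, ← hp.lie x y, hp.symm, h.inv, hp.symm, hp.lie]

/-- By its formula as a quotient, `φ` takes values in the image of the projected bracket, which lies
in the subalgebra. -/
theorem proj_phi (hp : IsSubalgProj br B p) {u : V} (hu : IsUnit (phiDen (projBr br p u))) (x : V) :
    p (phi (projBr br p u) x) = phi (projBr br p u) x := by
  obtain ⟨c, hc⟩ := hu.exists_right_inv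
  obtain ⟨w, rfl⟩ : ∃ w, x = phiDen (projBr br p u) w :=
    ⟨c x, by rw [← mul_apply_eq_comp, hc]; rfl⟩
  rw [phi_phiDen_apply hu, projBr_apply, map_smul, hp.lie]

/-- The projection intertwines the bracket with an element of the subalgebra. -/
theorem projBr_br (h : IsMetrized br B) (hB : ∀ x, (∀ y, B x y = 0) → x = 0)
    (hp : IsSubalgProj br B p) {w : V} (hw : p w = w) (u : V) :
    p (br u w) = br (p u) w := by
  rw [← sub_eq_zero]
  refine hB _ fun y ↦ ?_
  have e1 : br (p u) w = p (br (p u) (p w)) := by rw [hp.lie, hw]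
  have e2 : B (br u w) (p y) = B (br (p u) w) (p y) := by
    have e3 : br w (p y) = p (br w (p y)) := by rw [← hw, hp.lie]
    rw [h.skew u, h.skew (p u), map_neg, map_neg, _root_.neg_apply, _root_.neg_apply, h.inv, h.inv,
      e3, ← hp.symm u, ← hp.symm, hp.idem]
  rw [map_sub, _root_.sub_apply, hp.symm, e2, ← hp.symm, e1, hp.idem, hw, sub_self]

end IsSubalgProj

/-- The data of a point of the Poisson manifold: `p` and `q` are the projections to the
subalgebra and to the Cartan subalgebra, `K` is the inverse of the adjoint action of `u`,
and `r` is a solution of the modified classical Yang-Baxter equation. -/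
structure IsSliceData (br : V →L[ℂ] V →L[ℂ] V) (B : V →L[ℂ] V →L[ℂ] ℂ) (p q K r : V →L[ℂ] V)
    (u : V) : Prop where
  metrized : IsMetrized br B
  nondeg : ∀ x, (∀ y, B x y = 0) → x = 0
  proj : IsSubalgProj br B p
  qcomm : ∀ x y, br (q x) (q y) = 0
  ucomm : ∀ x, br u (q x) = 0
  skewK : ∀ x y, B (K x) y = -B x (K y)
  lieK : ∀ x, br u (K x) = x - q x
  commK : ∀ x y, K (br (q x) y) = br (q x) (K y)
  memr : ∀ x, p (r x) = r x
  skewr : ∀ x y, B (r x) y = -B x (r y)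
  mcybe : ∀ x y z, B z (br (r x) (r y)) + B x (br (r y) (r z)) + B y (br (r z) (r x)) =
    -4⁻¹ * B (p z) (br (p x) (p y))
  isUnit : IsUnit (phiDen (projBr br p u))

namespace IsSliceData

variable {p q K r : V →L[ℂ] V} {u : V}

/-- The part without `φ` and `r`, that is, the Jacobi identity for `π`. Substituting `x = [u, K x] +
q x` turns the terms with three `K` into the pairing of `u` with a Jacobi sum; the other terms
cancel because `K` is skew and commutes with `𝔱`. -/
theorem cyclic_adInv (h : IsSliceData br B p q K r u) {x y z x' y' z' : V} (hx : q x' = x')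
    (hy : q y' = y') (hz : q z' = z') :
    (B x (br (z' + K z) (y' + K y)) + B (K y) (br (q z) (K x))) +
      (B y (br (x' + K x) (z' + K z)) + B (K z) (br (q x) (K y))) +
      (B z (br (y' + K y) (x' + K x)) + B (K x) (br (q y) (K z))) = 0 := by
  have m := h.metrized
  have c0 : ∀ {a b}, q a = a → q b = b → br a b = 0 := fun {a b} ha hb ↦ by
    rw [← ha, ← hb, h.qcomm]
  have pair : ∀ x y s, q s = s → B x (br s (K y)) + B y (br (K x) s) = 0 := fun x y s hs ↦ by
    have e : br s (K y) = K (br s y) := by rw [← hs, h.commK]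
    have e2 := h.skewK x (br s y)
    rw [e, ← neg_eq_iff_eq_neg.2 e2, m.rotate (K x), m.rotate s, neg_add_cancel]
  have expand : ∀ x a b, B x (br (K a) (K b)) =
      B u (br (K x) (br (K a) (K b))) + B (q x) (br (K a) (K b)) := fun x a b ↦ by
    have e : x = br u (K x) + q x := by rw [h.lieK]; abel
    conv_lhs => rw [e]
    rw [map_add, _root_.add_apply, m.skew u, map_neg, _root_.neg_apply, m.inv, neg_neg]
  have jac : br (K x) (br (K z) (K y)) + br (K y) (br (K x) (K z)) +
      br (K z) (br (K y) (K x)) = 0 := by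
    have e1 : br (K x) (br (K z) (K y)) = -br (K x) (br (K y) (K z)) := by
      rw [m.skew (K z) (K y), map_neg]
    have e2 : br (K z) (br (K y) (K x)) = br (br (K x) (K y)) (K z) := by
      rw [m.skew (K z), m.skew (K y) (K x), map_neg, _root_.neg_apply, neg_neg]
    rw [e1, e2, m.jacobi (K x) (K y) (K z)]
    abel
  have jac' := congrArg (B u) jac
  simp only [map_add, map_zero] at jac'
  have p1 := pair x y z' hz
  have p2 := pair y z x' hx
  have p3 := pair z x y' hy
  have r1 := m.swap (q x) (K y) (K z)
  have r2 := m.swap (q y) (K z) (K x)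
  have r3 := m.swap (q z) (K x) (K y)
  have s1 := m.rotate (K z) (q x) (K y)
  have s2 := m.rotate (K x) (q y) (K z)
  have s3 := m.rotate (K y) (q z) (K x)
  simp only [map_add, _root_.add_apply, c0 hx hy, c0 hy hx, c0 hx hz, c0 hz hx, c0 hy hz, c0 hz hy,
    map_zero]
  rw [expand x z y, expand y x z, expand z y x]
  linear_combination jac' + p1 + p2 + p3 + r1 + r2 + r3 + s1 + s2 + s3

/-- The mixed terms cancel for an arbitrary map `f`, by invariance of the trilinear form alone. -/
theorem cyclic_linear (m : IsMetrized br B) (f : V → V) (x y z a b c : V) :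
    (B x (br (f z) b) + B x (br c (f y)) + B y (br c (f x)) + B (f y) (br c x)) +
      (B y (br (f x) c) + B y (br a (f z)) + B z (br a (f y)) + B (f z) (br a y)) +
      (B z (br (f y) a) + B z (br b (f x)) + B x (br b (f z)) + B (f x) (br b z)) = 0 := by
  have e1 := m.swap y (f x) c
  have e2 := m.swap z (f y) a
  have e3 := m.swap x (f z) b
  have r1 := m.rotate x c (f y)
  have r2 := m.rotate y a (f z)
  have r3 := m.rotate z b (f x)
  have t1 := m.rotate (f y) c x
  have t2 := m.rotate (f z) a y
  have t3 := m.rotate (f x) b z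
  have u1 := m.swap c (f y) x
  have u2 := m.swap a (f z) y
  have u3 := m.swap b (f x) z
  linear_combination e1 + e2 + e3 + r1 + r2 + r3 + t1 + t2 + t3 + u1 + u2 + u3

/-- The dynamical equation for `φ` carries `+1/4` of the invariant trilinear form on the subalgebra,
and the modified equation for `r` carries `-1/4`; these constants cancel. -/
theorem cyclic_quadratic (h : IsSliceData br B p q K r u) (x y z : V) :
    let F := phi (projBr br p u)
    let f := fun x ↦ F x - r x
    let S := phiDeriv (projBr br p) u
    (B x (br (f z) (f y)) + B y (br (f z) (f x)) + B (f y) (br (f z) x) + B y (S z x) -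
        B (F y) (br (f z) x) - B y (br (f z) (F x))) +
      (B y (br (f x) (f z)) + B z (br (f x) (f y)) + B (f z) (br (f x) y) + B z (S x y) -
        B (F z) (br (f x) y) - B z (br (f x) (F y))) +
      (B z (br (f y) (f x)) + B x (br (f y) (f z)) + B (f x) (br (f y) z) + B x (S y z) -
        B (F x) (br (f y) z) - B x (br (f y) (F z))) = 0 := by
  intro F f S
  have m := h.metrized
  have g1 : ∀ x y z, B (f y) (br (f z) x) = -B x (br (f z) (f y)) := fun x y z ↦ by
    rw [m.rotate (f y), m.rotate (f z), m.swap]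
  have g2 : ∀ x y z, B (F y) (br (f z) x) = -B x (br (f z) (F y)) := fun x y z ↦ by
    rw [m.rotate (F y), m.rotate (f z), m.swap]
  have hc := cdybe_eq_zero (h.proj.isMetrized m) h.isUnit x y z
  have hF : ∀ x, p (F x) = F x := fun x ↦ h.proj.proj_phi h.isUnit x
  simp only [cdybe, projBr_apply] at hc
  change B z (br (p (F x)) (p (F y))) + B x (br (p (F y)) (p (F z))) +
    B y (br (p (F z)) (p (F x))) - B y (S z x) - B z (S x y) - B x (S y z) +
    (4⁻¹ : ℂ) • B z (br (p x) (p y)) = 0 at hc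
  have hp : B z (br (p x) (p y)) = B (p z) (br (p x) (p y)) := by
    rw [h.proj.symm, h.proj.lie]
  simp only [hF, hp, smul_eq_mul] at hc
  have hm := h.mcybe x y z
  simp only [g1, g2]
  simp only [f, map_sub, _root_.sub_apply]
  have w1 := m.swap x (F z) (F y)
  have w2 := m.swap y (F x) (F z)
  have w3 := m.swap z (F y) (F x)
  have v1 := m.swap x (r z) (F y)
  have v2 := m.swap y (r x) (F z)
  have v3 := m.swap z (r y) (F x)
  linear_combination -hc + hm + w1 + w2 + w3 - v1 - v2 - v3

/-- The derivative of the endomorphism `K + φ(ad u) - r` along the Hamiltonian vector field with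
components `c` and `-q z`. -/
def thetaDeriv (br : V →L[ℂ] V →L[ℂ] V) (p q K r : V →L[ℂ] V) (u c z w : V) : V :=
  K (br (q z) (K w)) - br c (phi (projBr br p u) w - r w) +
    (phi (projBr br p u) (br c w) - r (br c w)) +
    phiDeriv (projBr br p) u (br c u - q z) w

/-- The pointwise content of the Jacobi identity, with `c` the left component of a Hamiltonian
vector and `thetaDeriv` the variation of the tensor along it. -/
theorem cyclic_sum (h : IsSliceData br B p q K r u) {x y z x' y' z' : V} (hx : q x' = x')
    (hy : q y' = y') (hz : q z' = z') :
    let c := fun x' x ↦ x' + K x + (phi (projBr br p u) x - r x)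
    (B x (br (c z' z) (c y' y)) - B y (thetaDeriv br p q K r u (c z' z) z x)) +
      (B y (br (c x' x) (c z' z)) - B z (thetaDeriv br p q K r u (c x' x) x y)) +
      (B z (br (c y' y) (c x' x)) - B x (thetaDeriv br p q K r u (c y' y) y z)) = 0 := by
  intro c
  have m := h.metrized
  set F := phi (projBr br p u) with hF
  set f : V → V := fun x ↦ F x - r x with hf
  set S := phiDeriv (projBr br p) u with hS
  have hpF : ∀ x, p (F x) = F x := fun x ↦ h.proj.proj_phi h.isUnit x
  have hpf : ∀ x, p (f x) = f x := fun x ↦ by rw [hf, map_sub, hpF, h.memr]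
  have hFskew : ∀ x y, B (F x) y = -B x (F y) :=
    phi_skewAdjoint (fun a b ↦ (h.proj.isMetrized m).inv u a b) h.isUnit
  have hfskew : ∀ x y, B y (f x) = -B (f y) x := fun x y ↦ by
    rw [hf, map_sub, map_sub, _root_.sub_apply, hFskew, h.skewr]; ring
  have hSadd : ∀ v w, S (v + w) = S v + S w := fun v w ↦ by
    rw [hS, phiDeriv, map_add, map_add]; rfl
  have hSneg : ∀ v, S (-v) = -S v := fun v ↦ by rw [hS, phiDeriv, map_neg, map_neg]; rfl
  -- Directions tangent to the adjoint orbit need no derivative of `φ`: equivariance evaluates it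
  -- algebraically.
  have hSbr : ∀ w x, S (br u (f w)) x = F (br (f w) (p x)) - br (f w) (F x) := fun w x ↦ by
    have e1 : projBr br p (br u (f w)) = projBr br p (projBr br p u (f w)) := by
      ext x
      rw [projBr_apply, projBr_apply, projBr_apply, h.proj.projBr_br m h.nondeg (hpf w), hpf,
        ← hpf w, h.proj.lie]
    have e2 := phiDeriv_bracket (h.proj.isMetrized m) h.isUnit (f w) x
    rw [hS, phiDeriv, e1]
    refine e2.trans ?_
    rw [projBr_apply, projBr_apply, hpf, hpF]
  have hFp : ∀ w x y, B (F y) (br (f w) (p x)) = B (F y) (br (f w) x) := fun w x y ↦ by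
    rw [m.rotate (F y), m.rotate (F y), m.rotate (f w), m.rotate (f w), h.proj.symm, ← hpF y,
      ← hpf w, h.proj.lie]
  have expand : ∀ x y z y' z', q z' = z' →
      B x (br (c z' z) (c y' y)) - B y (thetaDeriv br p q K r u (c z' z) z x) =
      (B x (br (z' + K z) (y' + K y)) + B (K y) (br (q z) (K x))) +
      (B x (br (f z) (y' + K y)) + B x (br (z' + K z) (f y)) + B y (br (z' + K z) (f x)) +
        B (f y) (br (z' + K z) x)) +
      (B x (br (f z) (f y)) + B y (br (f z) (f x)) + B (f y) (br (f z) x) + B y (S z x) -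
        B (F y) (br (f z) x) - B y (br (f z) (F x))) := by
    intro x y z y' z' hz
    have e1 : br (c z' z) u - q z = -(z + br u (f z)) := by
      have e2 : br u z' = 0 := by rw [← hz, h.ucomm]
      rw [m.skew]
      change -br u (z' + K z + f z) - q z = _
      rw [map_add, map_add, e2, h.lieK]
      abel
    have e3 : c z' z = (z' + K z) + f z := rfl
    have e4 : c y' y = (y' + K y) + f y := rfl
    have e5 : ∀ w, F w - r w = f w := fun _ ↦ rfl
    rw [thetaDeriv, ← hF, ← hS, e1, hSneg, hSadd, e5, e5, e3, e4]
    generalize z' + K z = b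
    generalize y' + K y = d
    have e6 := h.skewK y (br (q z) (K x))
    have e7 := hfskew (br (b + f z) x) y
    have e8 := hFskew y (br (f z) (p x))
    have e9 := hFp z x y
    simp only [map_add, map_sub, _root_.add_apply, _root_.neg_apply, hSbr, map_neg] at e7 ⊢
    linear_combination -e6 - e7 + e8 - e9
  rw [expand x y z y' z' hz, expand y z x z' x' hx, expand z x y x' y' hy]
  have k1 := h.cyclic_adInv (x := x) (y := y) (z := z) hx hy hz
  have k2 := cyclic_linear m f x y z (x' + K x) (y' + K y) (z' + K z)
  have k3 := h.cyclic_quadratic x y z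
  simp only at k3
  linear_combination k1 + k2 + k3

end IsSliceData

end JacobiCore

/-! ### Functions on the product of a Lie group and a vector space -/

section FrameDerivative

open Filter Topology

variable {E G T : Type*} [NormedAddCommGroup E] [NormedSpace ℂ E] [FiniteDimensional ℂ E]
  [CompleteSpace E] [TopologicalSpace G] [ChartedSpace E G] [Group G] [LieGroup 𝓘(ℂ, E) ω G]
  [NormedAddCommGroup T] [NormedSpace ℂ T] [CompleteSpace T]

/-- The derivative of `f` along the left invariant frame of `G`. -/
def leftDeriv (f : G × T → ℂ) (p : G × T) : E →L[ℂ] ℂ :=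
  fderiv ℂ (fun y : E ↦ f (p.1 * par y, p.2)) (org E G)

/-- The derivative of `f` along the second factor. -/
def vertDeriv (f : G × T → ℂ) (p : G × T) : T →L[ℂ] ℂ := fderiv ℂ (fun s ↦ f (p.1, s)) p.2

/-- The parametrization of a neighbourhood of `(g, t)`. -/
def locParam (g : G) (v : E × T) : G × T := (g * par v.1, v.2)

/-- The chart inverse to `locParam`. -/
def locChart (g : G) (p : G × T) : E × T := (cht E (g⁻¹ * p.1), p.2)

theorem locParam_org (g : G) (t : T) : locParam g (org E G, t) = (g, t) := by
  simp [locParam, par_org]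

theorem contMDiffAt_locParam (g : G) (t : T) :
    ContMDiffAt 𝓘(ℂ, E × T) (𝓘(ℂ, E).prod 𝓘(ℂ, T)) ω (locParam g) (org E G, t) := by
  have h1 : ContMDiffAt 𝓘(ℂ, E × T) 𝓘(ℂ, E) ω (fun v : E × T ↦ (par v.1 : G)) (org E G, t) :=
    ContMDiffAt.comp (x := (org E G, t)) (g := (par : E → G)) (f := fun v : E × T ↦ v.1)
      contMDiffAt_par contDiffAt_fst.contMDiffAt
  exact (contMDiffAt_const.mul h1).prodMk contDiffAt_snd.contMDiffAt

theorem contMDiffAt_locChart (g : G) (t : T) :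
    ContMDiffAt (𝓘(ℂ, E).prod 𝓘(ℂ, T)) 𝓘(ℂ, E × T) ω (locChart (E := E) g) (g, t) := by
  have h1 : ContMDiffAt (𝓘(ℂ, E).prod 𝓘(ℂ, T)) 𝓘(ℂ, E) ω (fun p : G × T ↦ g⁻¹ * p.1) (g, t) :=
    contMDiffAt_const.mul contMDiffAt_fst
  have h2 := ContMDiffAt.comp_of_eq (contMDiffAt_cht (E := E) (G := G)) h1 (by simp)
  exact ContMDiffAt.prodMk_space h2 contMDiffAt_snd

theorem eventually_locParam_locChart (g : G) (t : T) :
    ∀ᶠ p in 𝓝 (g, t), locParam (E := E) g (locChart g p) = p := by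
  have h1 : Tendsto (fun p : G × T ↦ g⁻¹ * p.1) (𝓝 (g, t)) (𝓝 1) := by
    have h2 : ContMDiffAt (𝓘(ℂ, E).prod 𝓘(ℂ, T)) 𝓘(ℂ, E) ω (fun p : G × T ↦ g⁻¹ * p.1) (g, t) :=
      contMDiffAt_const.mul contMDiffAt_fst
    simpa using h2.continuousAt.tendsto
  filter_upwards [h1.eventually (eventually_par_cht (E := E))] with p hp
  rw [locParam, locChart, hp, mul_inv_cancel_left]

theorem locChart_self (g : G) (t : T) : locChart (E := E) g (g, t) = (org E G, t) := by
  simp [locChart, cht_one]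

/-- A function is analytic in the chart if and only if it is analytic on the manifold. -/
theorem contMDiffAt_iff_analyticAt_locParam {f : G × T → ℂ} {g : G} {t : T} :
    ContMDiffAt (𝓘(ℂ, E).prod 𝓘(ℂ, T)) 𝓘(ℂ, ℂ) ω f (g, t) ↔
      AnalyticAt ℂ (fun v : E × T ↦ f (locParam g v)) (org E G, t) := by
  constructor
  · intro hf
    have h := ContMDiffAt.comp_of_eq hf (contMDiffAt_locParam g t) (locParam_org g t)
    exact (contMDiffAt_iff_contDiffAt.1 h).analyticAt
  · intro h
    have h1 : ContMDiffAt 𝓘(ℂ, E × T) 𝓘(ℂ, ℂ) ω (fun v : E × T ↦ f (locParam g v)) (org E G, t) :=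
      h.contDiffAt.contMDiffAt
    refine (ContMDiffAt.comp_of_eq h1 (contMDiffAt_locChart g t)
      (locChart_self g t)).congr_of_eventuallyEq ?_
    filter_upwards [eventually_locParam_locChart (E := E) g t] with p hp
    rw [Function.comp_apply, hp]

theorem eventually_leftDeriv_eq {f : G × T → ℂ} {g : G} {t : T}
    (hf : AnalyticAt ℂ (fun v : E × T ↦ f (locParam g v)) (org E G, t)) :
    ∀ᶠ v in 𝓝 (org E G, t), leftDeriv f (locParam g v) =
      ((fderiv ℂ (fun v : E × T ↦ f (locParam g v)) v).comp
        (ContinuousLinearMap.inl ℂ E T)).comp (leftFrame G v.1) := by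
  have hmul : ∀ᶠ x in 𝓝 (org E G), ∀ᶠ y in 𝓝 (org E G),
      (par (locMul G (x, y)) : G) = par x * par y := by
    have h2 : ∀ᶠ x in 𝓝 (org E G), ∀ᶠ v in 𝓝 (x, org E G),
        (par (locMul G v) : G) = par v.1 * par v.2 :=
      (Continuous.prodMk_left (org E G)).continuousAt.eventually
        (eventually_par_locMul (E := E) (G := G)).eventually_nhds
    filter_upwards [h2] with x hx
    exact (Continuous.prodMk_right x).continuousAt.eventually hx
  have hx : ∀ᶠ x in 𝓝 (org E G), (∀ᶠ y in 𝓝 (org E G),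
      (par (locMul G (x, y)) : G) = par x * par y) ∧ locMul G (x, org E G) = x ∧
      AnalyticAt ℂ (locMul G) (x, org E G) :=
    hmul.and (locMul_org_right.and (eventually_slice analyticAt_locMul))
  filter_upwards [(continuousAt_fst (p := (org E G, t))).eventually hx,
    hf.eventually_analyticAt] with v ⟨h1, h2, h3⟩ h4
  have h5 : HasFDerivAt (fun y ↦ locMul G (v.1, y)) (leftFrame G v.1) (org E G) :=
    (hasFDerivAt_partial_right h3).differentiableAt.hasFDerivAt
  have h6 : HasFDerivAt (fun v : E × T ↦ f (locParam g v))
      (fderiv ℂ (fun v : E × T ↦ f (locParam g v)) v) (locMul G (v.1, org E G), v.2) := by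
    rw [h2]; exact h4.differentiableAt.hasFDerivAt
  have h7 : HasFDerivAt (fun y ↦ f (locParam g (locMul G (v.1, y), v.2))) _ (org E G) :=
    HasFDerivAt.comp (g := fun v : E × T ↦ f (locParam g v))
      (f := fun y ↦ (locMul G (v.1, y), v.2)) (org E G) h6
      (h5.prodMk (hasFDerivAt_const v.2 (org E G)))
  have h8 : (fun y : E ↦ f ((locParam g v).1 * par y, (locParam g v).2)) =ᶠ[𝓝 (org E G)]
      fun y ↦ f (locParam g (locMul G (v.1, y), v.2)) := by
    filter_upwards [h1] with y hy
    simp only [locParam, hy, mul_assoc]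
  rw [leftDeriv, h8.fderiv_eq, h7.fderiv]
  ext w
  simp

theorem eventually_vertDeriv_eq {f : G × T → ℂ} {g : G} {t : T}
    (hf : AnalyticAt ℂ (fun v : E × T ↦ f (locParam g v)) (org E G, t)) :
    ∀ᶠ v in 𝓝 (org E G, t), vertDeriv f (locParam (E := E) g v) =
      (fderiv ℂ (fun v : E × T ↦ f (locParam g v)) v).comp (ContinuousLinearMap.inr ℂ E T) := by
  filter_upwards [hf.eventually_analyticAt] with v h4
  have h7 : HasFDerivAt (fun s ↦ f (locParam g (v.1, s))) _ v.2 :=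
    HasFDerivAt.comp (g := fun v : E × T ↦ f (locParam g v)) (f := fun s ↦ (v.1, s)) v.2
      h4.differentiableAt.hasFDerivAt (hasFDerivAt_prodMk_right v.1 v.2)
  exact h7.fderiv

theorem leftDeriv_apply_eq {f : G × T → ℂ} {g : G} {t : T}
    (hf : AnalyticAt ℂ (fun v : E × T ↦ f (locParam g v)) (org E G, t)) (x : E) :
    leftDeriv f (g, t) x = fderiv ℂ (fun v : E × T ↦ f (locParam g v)) (org E G, t) (x, 0) := by
  have := (eventually_leftDeriv_eq hf).self_of_nhds
  rw [locParam_org] at this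
  rw [this]
  simp [leftFrame_org]

theorem vertDeriv_apply_eq {f : G × T → ℂ} {g : G} {t : T}
    (hf : AnalyticAt ℂ (fun v : E × T ↦ f (locParam g v)) (org E G, t)) (s : T) :
    vertDeriv f (g, t) s = fderiv ℂ (fun v : E × T ↦ f (locParam g v)) (org E G, t) (0, s) := by
  have := (eventually_vertDeriv_eq hf).self_of_nhds
  rw [locParam_org] at this
  rw [this]
  simp

theorem analyticAt_leftDeriv {f : G × T → ℂ} {g : G} {t : T}
    (hf : AnalyticAt ℂ (fun v : E × T ↦ f (locParam g v)) (org E G, t)) :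
    AnalyticAt ℂ (fun v : E × T ↦ (leftDeriv f (locParam g v) : E →L[ℂ] ℂ)) (org E G, t) := by
  refine AnalyticAt.congr ?_ (EventuallyEq.symm (eventually_leftDeriv_eq hf))
  have h1 : AnalyticAt ℂ (fun v : E × T ↦ leftFrame G v.1) (org E G, t) :=
    AnalyticAt.fun_comp (g := leftFrame G) (f := Prod.fst) analyticAt_leftFrame analyticAt_fst
  have h2 : AnalyticAt ℂ (fun v ↦ (fderiv ℂ (fun v : E × T ↦ f (locParam g v)) v).comp
      (ContinuousLinearMap.inl ℂ E T)) (org E G, t) :=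
    AnalyticAt.fun_comp (((ContinuousLinearMap.compL ℂ E (E × T) ℂ).flip
      (ContinuousLinearMap.inl ℂ E T)).analyticAt _) hf.fderiv
  exact AnalyticAt.comp₂ (h := fun z : (E →L[ℂ] ℂ) × (E →L[ℂ] E) ↦ z.1.comp z.2)
    ((ContinuousLinearMap.compL ℂ E E ℂ).analyticAt_bilinear _) h2 h1

theorem analyticAt_vertDeriv {f : G × T → ℂ} {g : G} {t : T}
    (hf : AnalyticAt ℂ (fun v : E × T ↦ f (locParam g v)) (org E G, t)) :
    AnalyticAt ℂ (fun v : E × T ↦ vertDeriv f (locParam g v)) (org E G, t) := by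
  refine AnalyticAt.congr ?_ (EventuallyEq.symm (eventually_vertDeriv_eq hf))
  exact AnalyticAt.fun_comp (((ContinuousLinearMap.compL ℂ T (E × T) ℂ).flip
    (ContinuousLinearMap.inr ℂ E T)).analyticAt _) hf.fderiv

/-- The frame derivatives do not commute: the defect is the Lie bracket. -/
theorem frame_antisymm {f : G × T → ℂ} {g : G} {t : T}
    (hf : AnalyticAt ℂ (fun v : E × T ↦ f (locParam g v)) (org E G, t)) (x y : E) (s r : T) :
    (fderiv ℂ (fun v : E × T ↦ (leftDeriv f (locParam g v) : E →L[ℂ] ℂ)) (org E G, t) (x, s) y +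
      fderiv ℂ (fun v : E × T ↦ vertDeriv f (locParam g v)) (org E G, t) (x, s) r) -
    (fderiv ℂ (fun v : E × T ↦ (leftDeriv f (locParam g v) : E →L[ℂ] ℂ)) (org E G, t) (y, r) x +
      fderiv ℂ (fun v : E × T ↦ vertDeriv f (locParam g v)) (org E G, t) (y, r) s) =
    leftDeriv f (g, t) (toModel E G ⁅(toModel E G).symm x, (toModel E G).symm y⁆) := by
  set v0 : E × T := (org E G, t) with hv0
  set F := fun v : E × T ↦ f (locParam g v) with hF
  have hd2 : HasFDerivAt (fderiv ℂ F) (fderiv ℂ (fderiv ℂ F) v0) v0 :=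
    hf.fderiv.differentiableAt.hasFDerivAt
  have hsym : ∀ a b, fderiv ℂ (fderiv ℂ F) v0 a b = fderiv ℂ (fderiv ℂ F) v0 b a := by
    have := hf.contDiffAt (n := ω) |>.isSymmSndFDerivAt (by simp)
    exact fun a b ↦ this a b
  have hfr : HasFDerivAt (fun v : E × T ↦ leftFrame G v.1) _ v0 :=
    HasFDerivAt.comp (g := leftFrame G) (f := fun v : E × T ↦ v.1) v0
      (analyticAt_leftFrame (E := E) (G := G)).differentiableAt.hasFDerivAt hasFDerivAt_fst
  -- Each frame derivative is a second derivative in the chart plus a first-order term from the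
  -- motion of the frame; after antisymmetrization only the latter survive and form the bracket.
  have h1 : ∀ (w : E × T) (y : E),
      fderiv ℂ (fun v : E × T ↦ (leftDeriv f (locParam g v) : E →L[ℂ] ℂ)) v0 w y =
      fderiv ℂ (fderiv ℂ F) v0 w (y, 0) +
        fderiv ℂ F v0 (fderiv ℂ (leftFrame G) (org E G) w.1 y, 0) := fun w y ↦ by
    have e1 := (analyticAt_leftDeriv hf).differentiableAt.hasFDerivAt.clm_apply
      (hasFDerivAt_const y v0)
    have e2 : HasFDerivAt (fun v : E × T ↦ (leftFrame G v.1 y, (0 : T))) _ v0 :=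
      (hfr.clm_apply (hasFDerivAt_const y v0)).prodMk (hasFDerivAt_const (0 : T) v0)
    have e3 := hd2.clm_apply e2
    have e4 : (fun v : E × T ↦ leftDeriv f (locParam g v) y) =ᶠ[𝓝 v0]
        fun v ↦ fderiv ℂ F v (leftFrame G v.1 y, 0) := by
      filter_upwards [eventually_leftDeriv_eq hf] with v hv
      rw [hv]; rfl
    have e5 := DFunLike.congr_fun (e1.unique (e3.congr_of_eventuallyEq e4)) w
    simp [hv0, leftFrame_org] at e5
    rw [e5, add_comm]
  have h2 : ∀ (w : E × T) (r : T),
      fderiv ℂ (fun v : E × T ↦ vertDeriv f (locParam (E := E) g v)) v0 w r =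
      fderiv ℂ (fderiv ℂ F) v0 w (0, r) := fun w r ↦ by
    have e1 := (analyticAt_vertDeriv hf).differentiableAt.hasFDerivAt.clm_apply
      (hasFDerivAt_const r v0)
    have e3 := hd2.clm_apply (hasFDerivAt_const ((0 : E), r) v0)
    have e4 : (fun v : E × T ↦ vertDeriv f (locParam (E := E) g v) r) =ᶠ[𝓝 v0]
        fun v ↦ fderiv ℂ F v (0, r) := by
      filter_upwards [eventually_vertDeriv_eq hf] with v hv
      rw [hv]; rfl
    have e5 := DFunLike.congr_fun (e1.unique (e3.congr_of_eventuallyEq e4)) w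
    simpa using e5
  have h3 : ∀ (w : E × T) (y : E) (r : T), fderiv ℂ (fderiv ℂ F) v0 w (y, 0) +
      fderiv ℂ (fderiv ℂ F) v0 w (0, r) = fderiv ℂ (fderiv ℂ F) v0 w (y, r) := fun w y r ↦ by
    rw [← map_add]; simp
  have h4 : ∀ a b : E, fderiv ℂ F v0 (a, 0) - fderiv ℂ F v0 (b, 0) = fderiv ℂ F v0 (a - b, 0) :=
    fun a b ↦ by rw [← map_sub]; simp
  rw [leftDeriv_apply_eq hf, toModel_lie, LinearEquiv.apply_symm_apply,
    LinearEquiv.apply_symm_apply, ← h4, h1, h1, h2, h2]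
  linear_combination h3 (x, s) y r - h3 (y, r) x s + hsym (x, s) (y, r)

end FrameDerivative

/-! ### Differentials composed with left, right and vertical translations. -/

section TangentMaps

open Filter Topology

variable {E G : Type*} [NormedAddCommGroup E] [NormedSpace ℂ E] [FiniteDimensional ℂ E]
  [CompleteSpace E] [TopologicalSpace G] [ChartedSpace E G] [Group G] [LieGroup 𝓘(ℂ, E) ω G]

theorem mfderiv_one_apply {φ : G → ℂ} (hφ : MDifferentiableAt 𝓘(ℂ, E) 𝓘(ℂ, ℂ) φ 1)
    (x : GroupLieAlgebra 𝓘(ℂ, E) G) :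
    (mfderiv 𝓘(ℂ, E) 𝓘(ℂ, ℂ) φ 1 x : ℂ) =
      fderiv ℂ (fun y : E ↦ φ (par y)) (org E G) (toModel E G x) := by
  have e : writtenInExtChartAt 𝓘(ℂ, E) 𝓘(ℂ, ℂ) 1 φ = fun y ↦ φ (par y) := by
    ext y
    rfl
  have h2 : fderivWithin ℂ (writtenInExtChartAt 𝓘(ℂ, E) 𝓘(ℂ, ℂ) 1 φ)
      (Set.range 𝓘(ℂ, E)) (org E G) (toModel E G x) =
      fderiv ℂ (fun y : E ↦ φ (par y)) (org E G) (toModel E G x) := by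
    rw [e, modelWithCornersSelf_coe, Set.range_id, fderivWithin_univ]
  exact (DFunLike.congr_fun hφ.mfderiv _).trans h2

variable (𝔱 : LieSubalgebra ℂ (GroupLieAlgebra 𝓘(ℂ, E) G))

theorem differential_leftT {f : G × space 𝔱 → ℂ} {p : G × space 𝔱}
    (hf : MDifferentiableAt (𝓘(ℂ, E).prod 𝓘(ℂ, space 𝔱)) 𝓘(ℂ, ℂ) f p)
    (x : GroupLieAlgebra 𝓘(ℂ, E) G) :
    differential (𝓘(ℂ, E).prod 𝓘(ℂ, space 𝔱)) f p (leftT 𝔱 p x) =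
      leftDeriv f p (toModel E G x) := by
  have hg : MDifferentiableAt 𝓘(ℂ, E) (𝓘(ℂ, E).prod 𝓘(ℂ, space 𝔱))
      (fun h : G ↦ (p.1 * h, p.2)) 1 :=
    ((contMDiffAt_const.mul contMDiffAt_id).prodMk contMDiffAt_const :
      ContMDiffAt 𝓘(ℂ, E) (𝓘(ℂ, E).prod 𝓘(ℂ, space 𝔱)) ω (fun h : G ↦ (p.1 * h, p.2)) (1 : G)).mdifferentiableAt (by simp)
  have hp : (fun h : G ↦ (p.1 * h, p.2)) (1 : G) = p := by simp
  have h1 := mfderiv_comp_of_eq hf hg hp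
  have h2 := mfderiv_one_apply (MDifferentiableAt.comp_of_eq 1 hf hg hp) x
  have h8 : ∀ z, z = p → ∀ u : E × space 𝔱,
      (mfderiv (𝓘(ℂ, E).prod 𝓘(ℂ, space 𝔱)) 𝓘(ℂ, ℂ) f z u : ℂ) =
      mfderiv (𝓘(ℂ, E).prod 𝓘(ℂ, space 𝔱)) 𝓘(ℂ, ℂ) f p u := by rintro _ rfl u; rfl
  exact (h8 _ hp _).symm.trans ((DFunLike.congr_fun h1 x).symm.trans h2)

/-- Since `h g = g (g⁻¹ h g)`, right translation by `g` is left translation after `Ad_{g⁻¹}`. -/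
theorem differential_rightT {f : G × space 𝔱 → ℂ} {p : G × space 𝔱}
    (hf : MDifferentiableAt (𝓘(ℂ, E).prod 𝓘(ℂ, space 𝔱)) 𝓘(ℂ, ℂ) f p)
    (x : GroupLieAlgebra 𝓘(ℂ, E) G) :
    differential (𝓘(ℂ, E).prod 𝓘(ℂ, space 𝔱)) f p (rightT 𝔱 p x) =
      leftDeriv f p (adj p.1⁻¹ (toModel E G x)) := by
  have hg : MDifferentiableAt 𝓘(ℂ, E) (𝓘(ℂ, E).prod 𝓘(ℂ, space 𝔱))
      (fun h : G ↦ (h * p.1, p.2)) 1 :=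
    ((contMDiffAt_id.mul contMDiffAt_const).prodMk contMDiffAt_const :
      ContMDiffAt 𝓘(ℂ, E) (𝓘(ℂ, E).prod 𝓘(ℂ, space 𝔱)) ω (fun h : G ↦ (h * p.1, p.2)) (1 : G)).mdifferentiableAt (by simp)
  have hg' : MDifferentiableAt 𝓘(ℂ, E) (𝓘(ℂ, E).prod 𝓘(ℂ, space 𝔱))
      (fun h : G ↦ (p.1 * h, p.2)) 1 :=
    ((contMDiffAt_const.mul contMDiffAt_id).prodMk contMDiffAt_const :
      ContMDiffAt 𝓘(ℂ, E) (𝓘(ℂ, E).prod 𝓘(ℂ, space 𝔱)) ω (fun h : G ↦ (p.1 * h, p.2)) (1 : G)).mdifferentiableAt (by simp)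
  have hp : (fun h : G ↦ (h * p.1, p.2)) (1 : G) = p := by simp
  have hp' : (fun h : G ↦ (p.1 * h, p.2)) (1 : G) = p := by simp
  have h1 := mfderiv_comp_of_eq hf hg hp
  have h2 := mfderiv_one_apply (MDifferentiableAt.comp_of_eq 1 hf hg hp) x
  have h8 : ∀ z, z = p → ∀ u : E × space 𝔱,
      (mfderiv (𝓘(ℂ, E).prod 𝓘(ℂ, space 𝔱)) 𝓘(ℂ, ℂ) f z u : ℂ) =
      mfderiv (𝓘(ℂ, E).prod 𝓘(ℂ, space 𝔱)) 𝓘(ℂ, ℂ) f p u := by rintro _ rfl u; rfl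
  refine (h8 _ hp _).symm.trans ((DFunLike.congr_fun h1 x).symm.trans (h2.trans ?_))
  have hφ : MDifferentiableAt 𝓘(ℂ, E) 𝓘(ℂ, ℂ) (f ∘ fun h : G ↦ (p.1 * h, p.2)) 1 :=
    MDifferentiableAt.comp_of_eq 1 hf hg' hp'
  have h3 : ContMDiffAt 𝓘(ℂ, E) 𝓘(ℂ, E) ω (par : E → G) (org E G) := contMDiffAt_par
  have h4 : MDifferentiableAt 𝓘(ℂ, E) 𝓘(ℂ, ℂ)
      ((f ∘ fun h : G ↦ (p.1 * h, p.2)) ∘ par) (org E G) :=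
    MDifferentiableAt.comp_of_eq _ hφ (h3.mdifferentiableAt (by simp)) par_org
  have hco : cht E (p.1⁻¹ * par (org E G) * p.1⁻¹⁻¹) = org E G := by simp [par_org, cht_one]
  have h5 : HasFDerivAt (fun y : E ↦ f (p.1 * par y, p.2)) (leftDeriv f p)
      (cht E (p.1⁻¹ * par (org E G) * p.1⁻¹⁻¹)) := by
    rw [hco]
    exact (mdifferentiableAt_iff_differentiableAt.1 h4).hasFDerivAt
  have h6 : HasFDerivAt (fun y : E ↦ f (p.1 * par (cht E (p.1⁻¹ * par y * p.1⁻¹⁻¹)), p.2)) _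
      (org E G) :=
    HasFDerivAt.comp (g := fun y : E ↦ f (p.1 * par y, p.2))
      (f := fun y : E ↦ cht E (p.1⁻¹ * par y * p.1⁻¹⁻¹)) (org E G) h5
      (differentiableAt_conj (E := E) p.1⁻¹).hasFDerivAt
  have h7 : (fun y : E ↦ (f ∘ fun h : G ↦ (h * p.1, p.2)) (par y)) =ᶠ[𝓝 (org E G)]
      fun y : E ↦ f (p.1 * par (cht E (p.1⁻¹ * par y * p.1⁻¹⁻¹)), p.2) := by
    filter_upwards [(tendsto_conj (E := E) p.1⁻¹).eventually (eventually_par_cht (E := E))] with y hy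
    rw [hy, Function.comp_apply]
    congr 2
    group
  rw [h7.fderiv_eq, h6.fderiv]
  rfl

theorem differential_vertT {f : G × space 𝔱 → ℂ} {p : G × space 𝔱}
    (hf : MDifferentiableAt (𝓘(ℂ, E).prod 𝓘(ℂ, space 𝔱)) 𝓘(ℂ, ℂ) f p) (s : 𝔱) :
    differential (𝓘(ℂ, E).prod 𝓘(ℂ, space 𝔱)) f p (vertT 𝔱 p s) =
      vertDeriv f p ((spaceEquiv 𝔱).symm s) := by
  have hg : MDifferentiableAt 𝓘(ℂ, space 𝔱) (𝓘(ℂ, E).prod 𝓘(ℂ, space 𝔱))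
      (fun s : space 𝔱 ↦ (p.1, s)) p.2 :=
    (contMDiffAt_const.prodMk contMDiffAt_id :
      ContMDiffAt 𝓘(ℂ, space 𝔱) (𝓘(ℂ, E).prod 𝓘(ℂ, space 𝔱)) ω (fun s : space 𝔱 ↦ (p.1, s)) p.2).mdifferentiableAt (by simp)
  have h1 := mfderiv_comp p.2 hf hg
  have h2 : (mfderiv 𝓘(ℂ, space 𝔱) 𝓘(ℂ, ℂ) (f ∘ fun s : space 𝔱 ↦ (p.1, s)) p.2
      ((spaceEquiv 𝔱).symm s) : ℂ) = vertDeriv f p ((spaceEquiv 𝔱).symm s) := by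
    rw [mfderiv_eq_fderiv]; rfl
  exact (DFunLike.congr_fun h1 ((spaceEquiv 𝔱).symm s)).symm.trans h2

end TangentMaps

/-! ### Equivariance and infinitesimal invariance under the adjoint action. -/

section AdjointAction

open Filter Topology

variable {E G : Type*} [NormedAddCommGroup E] [NormedSpace ℂ E] [FiniteDimensional ℂ E]
  [CompleteSpace E] [TopologicalSpace G] [ChartedSpace E G] [Group G] [LieGroup 𝓘(ℂ, E) ω G]

variable (E G) in
/-- The Lie bracket on the model space. -/
def brModel : E →L[ℂ] E →L[ℂ] E :=
  fderiv ℂ (fun x : E ↦ (adj (par x : G) : E →L[ℂ] E)) (org E G)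

theorem brModel_apply (v w : GroupLieAlgebra 𝓘(ℂ, E) G) :
    brModel E G (toModel E G v) (toModel E G w) = toModel E G ⁅v, w⁆ := fderiv_adj_par v w

theorem hasFDerivAt_adj_par : HasFDerivAt (fun x : E ↦ (adj (par x : G) : E →L[ℂ] E))
    (brModel E G) (org E G) :=
  analyticAt_adj_par.differentiableAt.hasFDerivAt

theorem adj_par_org : (adj (par (org E G) : G) : E →L[ℂ] E) = ContinuousLinearMap.id ℂ E := by
  rw [par_org, adj_one]

/-- Differentiate `Ad_g Ad_x = Ad_{g x g⁻¹} Ad_g` in `x` at the identity. -/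
theorem adj_brModel (g : G) (x y : E) :
    adj g (brModel E G x y) = brModel E G (adj g x) (adj g y) := by
  have hco : cht E (g * par (org E G) * g⁻¹) = org E G := by simp [par_org, cht_one]
  have h1 : HasFDerivAt (fun x : E ↦ (adj (par x : G) : E →L[ℂ] E)) (brModel E G)
      (cht E (g * par (org E G) * g⁻¹)) := by rw [hco]; exact hasFDerivAt_adj_par
  have h2 : HasFDerivAt (fun x : E ↦ (adj (par (cht E (g * par x * g⁻¹)) : G) : E →L[ℂ] E)) _
      (org E G) :=
    HasFDerivAt.comp (g := fun x : E ↦ (adj (par x : G) : E →L[ℂ] E))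
      (f := fun x : E ↦ cht E (g * par x * g⁻¹)) (org E G) h1
      (differentiableAt_conj (E := E) g).hasFDerivAt
  have h3 := h2.clm_apply (hasFDerivAt_const (adj g y) (org E G))
  have h4 := ((adj g : E →L[ℂ] E).hasFDerivAt (x := (adj (par (org E G) : G) : E →L[ℂ] E) y)).comp
    (org E G) ((hasFDerivAt_adj_par (E := E) (G := G)).clm_apply (hasFDerivAt_const y (org E G)))
  have h5 : (fun x : E ↦ (adj g : E →L[ℂ] E) ((adj (par x : G) : E →L[ℂ] E) y)) =ᶠ[𝓝 (org E G)]
      fun x : E ↦ (adj (par (cht E (g * par x * g⁻¹)) : G) : E →L[ℂ] E) (adj g y) := by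
    filter_upwards [(tendsto_conj (E := E) g).eventually (eventually_par_cht (E := E))] with x hx
    rw [hx, ← ContinuousLinearMap.comp_apply, ← adj_mul, ← ContinuousLinearMap.comp_apply,
      ← adj_mul]
    congr 2
    group
  have h6 := DFunLike.congr_fun (h4.unique (h3.congr_of_eventuallyEq h5)) x
  simp at h6
  exact h6

/-- The derivative at the identity of the invariance of `B` under `Ad`. -/
theorem brModel_inv {B : E →L[ℂ] E →L[ℂ] ℂ} (hB : ∀ (g : G) x y, B (adj g x) (adj g y) = B x y)
    (x y z : E) : B (brModel E G x y) z = -B y (brModel E G x z) := by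
  have h1 := (hasFDerivAt_adj_par (E := E) (G := G)).clm_apply (hasFDerivAt_const y (org E G))
  have h2 := (hasFDerivAt_adj_par (E := E) (G := G)).clm_apply (hasFDerivAt_const z (org E G))
  have h3 := (((B.hasFDerivAt).comp (org E G) h1).clm_apply h2)
  have h4 : (fun v ↦ ((⇑B ∘ fun x : E ↦ (adj (par x : G) : E →L[ℂ] E) y) v)
      ((adj (par v : G) : E →L[ℂ] E) z)) = fun _ ↦ B y z := by
    ext v
    exact hB _ _ _
  rw [h4] at h3
  have h5 := DFunLike.congr_fun (h3.unique (hasFDerivAt_const _ _)) x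
  simp [adj_par_org] at h5
  linear_combination h5

end AdjointAction

/-! ### The Poisson bracket in the model space -/

section Model

open Filter Topology

variable {E T : Type*} [NormedAddCommGroup E] [NormedSpace ℂ E] [FiniteDimensional ℂ E]
  [CompleteSpace E] [NormedAddCommGroup T] [NormedSpace ℂ T] [CompleteSpace T]

/-- The Lie-theoretic data on the model space: `j` is the inclusion of the Cartan subalgebra, `qT`
the orthogonal projection to it, `p` the projection to a subalgebra and `r` a solution of the
modified classical Yang-Baxter equation with values in this subalgebra. -/
structure IsModel (G : Type*) [TopologicalSpace G] [ChartedSpace E G] [Group G]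
    [LieGroup 𝓘(ℂ, E) ω G] (B : E →L[ℂ] E →L[ℂ] ℂ) (p r : E →L[ℂ] E) (j : T →L[ℂ] E)
    (qT : E →L[ℂ] T) (shp : (E →L[ℂ] ℂ) →L[ℂ] E) : Prop where
  symm : ∀ x y, B x y = B y x
  shp_apply : ∀ ξ x, B (shp ξ) x = ξ x
  shp_form : ∀ x, shp (B x) = x
  inv : ∀ (g : G) x y, B (adj g x) (adj g y) = B x y
  proj_incl : ∀ s, qT (j s) = s
  proj_symm : ∀ x y, B (j (qT x)) y = B x (j (qT y))
  comm : ∀ s s', brModel E G (j s) (j s') = 0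
  proj : IsSubalgProj (brModel E G) B p
  memr : ∀ x, p (r x) = r x
  skewr : ∀ x y, B (r x) y = -B x (r y)
  mcybe : ∀ x y z, B z (brModel E G (r x) (r y)) + B x (brModel E G (r y) (r z)) +
    B y (brModel E G (r z) (r x)) = -4⁻¹ * B (p z) (brModel E G (p x) (p y))

variable {G : Type*} [TopologicalSpace G] [ChartedSpace E G] [Group G] [LieGroup 𝓘(ℂ, E) ω G]

theorem brModel_skew (x y : E) : brModel E G x y = -brModel E G y x := by
  have h1 := brModel_apply (G := G) ((toModel E G).symm x) ((toModel E G).symm y)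
  have h2 := brModel_apply (G := G) ((toModel E G).symm y) ((toModel E G).symm x)
  simp only [LinearEquiv.apply_symm_apply] at h1 h2
  rw [h1, h2, ← lie_skew, map_neg]

theorem brModel_jacobi (x y z : E) : brModel E G x (brModel E G y z) =
    brModel E G (brModel E G x y) z + brModel E G y (brModel E G x z) := by
  obtain ⟨x, rfl⟩ := (toModel E G).surjective x
  obtain ⟨y, rfl⟩ := (toModel E G).surjective y
  obtain ⟨z, rfl⟩ := (toModel E G).surjective z
  simp only [brModel_apply]
  rw [leibniz_lie, map_add]

/-- The operator `ad_s + q`, which is invertible for regular `s`. -/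
def regOp (G : Type*) [TopologicalSpace G] [ChartedSpace E G] [Group G] [LieGroup 𝓘(ℂ, E) ω G]
    (j : T →L[ℂ] E) (qT : E →L[ℂ] T) (s : T) : E →L[ℂ] E :=
  brModel E G (j s) + j.comp qT

/-- The inverse of `ad_s` on the complement of its kernel. -/
def adInvModel (G : Type*) [TopologicalSpace G] [ChartedSpace E G] [Group G]
    [LieGroup 𝓘(ℂ, E) ω G] (j : T →L[ℂ] E) (qT : E →L[ℂ] T) (s : T) : E →L[ℂ] E :=
  Ring.inverse (regOp G j qT s) - j.comp qT

/-- The function `φ(ad u) - r` pulled back by the adjoint action. -/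
def dynPart (p r : E →L[ℂ] E) (j : T →L[ℂ] E) (P : G × T) : E →L[ℂ] E :=
  adj P.1⁻¹ * (phi (projBr (brModel E G) p (adj P.1 (j P.2))) - r) * adj P.1

/-- The endomorphism describing the Poisson tensor in the left invariant frame. -/
def theta (p r : E →L[ℂ] E) (j : T →L[ℂ] E) (qT : E →L[ℂ] T) (P : G × T) : E →L[ℂ] E :=
  adInvModel G j qT P.2 + dynPart p r j P

/-- The Poisson bracket in terms of the left invariant frame. -/
def modelBracket (p r : E →L[ℂ] E) (j : T →L[ℂ] E) (qT : E →L[ℂ] T)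
    (shp : (E →L[ℂ] ℂ) →L[ℂ] E) (f h : G × T → ℂ) (P : G × T) : ℂ :=
  vertDeriv f P (qT (shp (leftDeriv h P))) - vertDeriv h P (qT (shp (leftDeriv f P))) +
    leftDeriv h P (theta p r j qT P (shp (leftDeriv f P)))

/-- The points at which all the ingredients are defined. -/
def IsRegular (p : E →L[ℂ] E) (j : T →L[ℂ] E) (qT : E →L[ℂ] T) (P : G × T) : Prop :=
  IsUnit (regOp G j qT P.2) ∧ IsUnit (phiDen (projBr (brModel E G) p (adj P.1 (j P.2))))

theorem adj_unit (g : G) : (adj g : E →L[ℂ] E) * adj g⁻¹ = 1 := by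
  ext x; exact adj_adj_inv g x

theorem adj_unit' (g : G) : (adj g⁻¹ : E →L[ℂ] E) * adj g = 1 := by
  ext x; exact adj_inv_adj g x

theorem ringInverse_adj (g : G) : Ring.inverse (adj g : E →L[ℂ] E) = adj g⁻¹ :=
  Ring.inverse_unit (⟨adj g, adj g⁻¹, adj_unit g, adj_unit' g⟩ : (E →L[ℂ] E)ˣ)

namespace IsModel

variable {B : E →L[ℂ] E →L[ℂ] ℂ} {p r : E →L[ℂ] E} {j : T →L[ℂ] E} {qT : E →L[ℂ] T}
  {shp : (E →L[ℂ] ℂ) →L[ℂ] E}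

theorem metrized (h : IsModel G B p r j qT shp) : IsMetrized (brModel E G) B :=
  ⟨brModel_skew, brModel_jacobi, h.symm, brModel_inv h.inv⟩

theorem nondeg (h : IsModel G B p r j qT shp) (x : E) (hx : ∀ y, B x y = 0) : x = 0 := by
  rw [← h.shp_form x, show B x = 0 from ContinuousLinearMap.ext hx, map_zero]

theorem proj_lie (h : IsModel G B p r j qT shp) (s : T) (x : E) :
    j (qT (brModel E G (j s) x)) = 0 :=
  h.nondeg _ fun y ↦ by
    rw [h.proj_symm, h.metrized.inv, h.comm, map_zero, neg_zero]

section AdInvModel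

variable {s : T}

theorem proj_inverse_regOp (h : IsModel G B p r j qT shp) (hs : IsUnit (regOp G j qT s)) (x : E) :
    j (qT (Ring.inverse (regOp G j qT s) x)) = j (qT x) := by
  have h1 : ∀ y, j (qT (regOp G j qT s y)) = j (qT y) := fun y ↦ by
    change j (qT (brModel E G (j s) y + j (qT y))) = _
    rw [map_add, map_add, h.proj_lie, h.proj_incl, zero_add]
  rw [← h1, ← mul_apply_eq_comp, Ring.mul_inverse_cancel _ hs]
  rfl

theorem adInvModel_apply (x : E) :
    adInvModel G j qT s x = Ring.inverse (regOp G j qT s) x - j (qT x) := rfl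

theorem proj_adInvModel (h : IsModel G B p r j qT shp) (hs : IsUnit (regOp G j qT s)) (x : E) :
    j (qT (adInvModel G j qT s x)) = 0 := by
  rw [adInvModel_apply, map_sub, map_sub, h.proj_inverse_regOp hs, h.proj_incl, sub_self]

theorem lie_adInvModel (h : IsModel G B p r j qT shp) (hs : IsUnit (regOp G j qT s)) (x : E) :
    brModel E G (j s) (adInvModel G j qT s x) = x - j (qT x) := by
  have h1 : regOp G j qT s (Ring.inverse (regOp G j qT s) x) = x := by
    rw [← mul_apply_eq_comp, Ring.mul_inverse_cancel _ hs]; rfl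
  have h2 : regOp G j qT s (Ring.inverse (regOp G j qT s) x) =
    brModel E G (j s) (Ring.inverse (regOp G j qT s) x) +
      j (qT (Ring.inverse (regOp G j qT s) x)) := rfl
  rw [h.proj_inverse_regOp hs, h1] at h2
  rw [adInvModel_apply, map_sub, h.comm, sub_zero, eq_sub_iff_add_eq]
  exact h2.symm

theorem adInvModel_comm (h : IsModel G B p r j qT shp) (hs : IsUnit (regOp G j qT s)) (s' : T)
    (x : E) : adInvModel G j qT s (brModel E G (j s') x) =
      brModel E G (j s') (adInvModel G j qT s x) := by
  have h1 : regOp G j qT s * brModel E G (j s') = brModel E G (j s') * regOp G j qT s := by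
    ext y
    change brModel E G (j s) (brModel E G (j s') y) + j (qT (brModel E G (j s') y)) =
      brModel E G (j s') (brModel E G (j s) y + j (qT y))
    rw [h.proj_lie, map_add, h.comm, brModel_jacobi, h.comm]
    simp
  have h2 : Ring.inverse (regOp G j qT s) * brModel E G (j s') =
      brModel E G (j s') * Ring.inverse (regOp G j qT s) := by
    have h3 := congrArg (fun z ↦ Ring.inverse (regOp G j qT s) * z *
      Ring.inverse (regOp G j qT s)) h1
    rw [← mul_assoc, Ring.inverse_mul_cancel _ hs, one_mul, ← mul_assoc,
      mul_assoc _ (regOp G j qT s), Ring.mul_inverse_cancel _ hs, mul_one] at h3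
    exact h3.symm
  have h3 := DFunLike.congr_fun h2 x
  rw [mul_apply_eq_comp, mul_apply_eq_comp] at h3
  rw [adInvModel_apply, adInvModel_apply, h3, h.proj_lie, map_sub, h.comm]

/-- Write `y = [s, K y] + q y`. The image of `K` is orthogonal to `𝔱`, and `ad_s` can be moved
across the form. -/
theorem adInvModel_skew (h : IsModel G B p r j qT shp) (hs : IsUnit (regOp G j qT s)) (x y : E) :
    B (adInvModel G j qT s x) y = -B x (adInvModel G j qT s y) := by
  have e1 : y = brModel E G (j s) (adInvModel G j qT s y) + j (qT y) := by
    rw [h.lie_adInvModel hs]; abel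
  conv_lhs => rw [e1]
  rw [map_add, ← h.proj_symm, h.proj_adInvModel hs, map_zero, _root_.zero_apply, add_zero,
    ← neg_neg (B _ (brModel E G _ _)), ← h.metrized.inv, h.lie_adInvModel hs, map_sub,
    _root_.sub_apply, h.proj_symm, h.proj_adInvModel hs, map_zero, sub_zero]

end AdInvModel

theorem adj_swap (h : IsModel G B p r j qT shp) (g : G) (x y : E) :
    B (adj g⁻¹ x) y = B x (adj g y) := by
  rw [← h.inv g, adj_adj_inv]

theorem dynPart_apply (P : G × T) (x : E) : dynPart p r j P x =
    adj P.1⁻¹ (phi (projBr (brModel E G) p (adj P.1 (j P.2))) (adj P.1 x) - r (adj P.1 x)) := rfl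

theorem dynPart_skew (h : IsModel G B p r j qT shp) {P : G × T}
    (hP : IsRegular p j qT P) (x y : E) : B (dynPart p r j P x) y = -B x (dynPart p r j P y) := by
  have h1 := phi_skewAdjoint (fun a b ↦ (h.proj.isMetrized h.metrized).inv _ a b) hP.2
  rw [dynPart_apply, dynPart_apply, h.adj_swap, h.symm x, h.adj_swap, h.symm _ (adj P.1 x),
    map_sub, map_sub, _root_.sub_apply, h1, h.skewr]
  ring

theorem theta_skew (h : IsModel G B p r j qT shp) {P : G × T}
    (hP : IsRegular p j qT P) (x y : E) : B (theta p r j qT P x) y = -B x (theta p r j qT P y) := by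
  rw [theta, _root_.add_apply, _root_.add_apply, map_add, map_add, _root_.add_apply,
    h.adInvModel_skew hP.1, h.dynPart_skew hP]
  ring

theorem modelBracket_skew (h : IsModel G B p r j qT shp) {P : G × T}
    (hP : IsRegular p j qT P) (f k : G × T → ℂ) :
    modelBracket p r j qT shp f k P = -modelBracket p r j qT shp k f P := by
  have h1 := h.theta_skew hP (shp (leftDeriv f P)) (shp (leftDeriv k P))
  rw [h.symm, h.shp_apply, h.shp_apply] at h1
  rw [modelBracket, modelBracket, h1]
  ring

/-- The slice data obtained by transport to the right trivialization. -/
theorem isSliceData (h : IsModel G B p r j qT shp) {P : G × T} (hP : IsRegular p j qT P) :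
    IsSliceData (brModel E G) B p (adj P.1 * j.comp qT * adj P.1⁻¹)
      (adj P.1 * adInvModel G j qT P.2 * adj P.1⁻¹) r (adj P.1 (j P.2)) where
  metrized := h.metrized
  nondeg := h.nondeg
  proj := h.proj
  qcomm x y := by
    change brModel E G (adj P.1 (j (qT (adj P.1⁻¹ x)))) (adj P.1 (j (qT (adj P.1⁻¹ y)))) = 0
    rw [← adj_brModel, h.comm, map_zero]
  ucomm x := by
    change brModel E G (adj P.1 (j P.2)) (adj P.1 (j (qT (adj P.1⁻¹ x)))) = 0
    rw [← adj_brModel, h.comm, map_zero]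
  skewK x y := by
    change B (adj P.1 (adInvModel G j qT P.2 (adj P.1⁻¹ x))) y =
      -B x (adj P.1 (adInvModel G j qT P.2 (adj P.1⁻¹ y)))
    rw [← h.adj_swap P.1 x, ← h.adInvModel_skew hP.1, h.symm _ y, ← h.adj_swap, h.symm]
  lieK x := by
    change brModel E G (adj P.1 (j P.2)) (adj P.1 (adInvModel G j qT P.2 (adj P.1⁻¹ x))) =
      x - adj P.1 (j (qT (adj P.1⁻¹ x)))
    rw [← adj_brModel, h.lie_adInvModel hP.1, map_sub, adj_adj_inv]
  commK x y := by
    change adj P.1 (adInvModel G j qT P.2 (adj P.1⁻¹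
      (brModel E G (adj P.1 (j (qT (adj P.1⁻¹ x)))) y))) =
      brModel E G (adj P.1 (j (qT (adj P.1⁻¹ x)))) (adj P.1 (adInvModel G j qT P.2 (adj P.1⁻¹ y)))
    rw [adj_brModel, adj_inv_adj, h.adInvModel_comm hP.1, adj_brModel]
  memr := h.memr
  skewr := h.skewr
  mcybe := h.mcybe
  isUnit := hP.2

end IsModel
end Model

/-! ### Local expressions and derivatives of the operator `theta`. -/

section ModelJacobi

open Filter Topology

variable {E T : Type*} [NormedAddCommGroup E] [NormedSpace ℂ E] [FiniteDimensional ℂ E]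
  [CompleteSpace E] [NormedAddCommGroup T] [NormedSpace ℂ T] [CompleteSpace T]
variable {G : Type*} [TopologicalSpace G] [ChartedSpace E G] [Group G] [LieGroup 𝓘(ℂ, E) ω G]
variable {B : E →L[ℂ] E →L[ℂ] ℂ} {p r : E →L[ℂ] E} {j : T →L[ℂ] E} {qT : E →L[ℂ] T}
  {shp : (E →L[ℂ] ℂ) →L[ℂ] E}

theorem _root_.AnalyticAt.clm_apply_apply {W V V' : Type*} [NormedAddCommGroup W] [NormedSpace ℂ W]
    [NormedAddCommGroup V] [NormedSpace ℂ V] [NormedAddCommGroup V'] [NormedSpace ℂ V']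
    {f : W → V →L[ℂ] V'} {a : W → V} {x : W} (hf : AnalyticAt ℂ f x) (ha : AnalyticAt ℂ a x) :
    AnalyticAt ℂ (fun w ↦ f w (a w)) x :=
  AnalyticAt.comp₂ (h := fun z : (V →L[ℂ] V') × V ↦ z.1 z.2)
    ((ContinuousLinearMap.id ℂ (V →L[ℂ] V')).analyticAt_bilinear _) hf ha

/-- Product rule for conjugation by a family equal to one at the point, where the derivative of the
inverse is minus the derivative. -/
theorem fderiv_add_conj {𝔸 W : Type*} [NormedRing 𝔸] [NormedAlgebra ℂ 𝔸] [CompleteSpace 𝔸]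
    [NormedAddCommGroup W] [NormedSpace ℂ W] {K A M : W → 𝔸} {K' A' M' : W →L[ℂ] 𝔸} {x : W}
    (hK : HasFDerivAt K K' x) (hA : HasFDerivAt A A' x) (hM : HasFDerivAt M M' x) (h1 : A x = 1)
    (b d : 𝔸) (w : W) :
    fderiv ℂ (fun v ↦ K v + Ring.inverse (A v) * (b * M v * d) * A v) x w =
      K' w + (-(A' w * (b * M x * d)) + b * M' w * d + b * M x * d * A' w) := by
  have hi := hasFDerivAt_ringInverse (𝕜 := ℂ) (1 : 𝔸ˣ)
  rw [show ((1 : 𝔸ˣ) : 𝔸) = A x from h1.symm] at hi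
  have h := hK.add (((hi.comp x hA).mul' (((hasFDerivAt_const b x).mul' hM).mul'
    (hasFDerivAt_const d x))).mul' hA)
  have h' : HasFDerivAt (fun v ↦ K v + Ring.inverse (A v) * (b * M v * d) * A v) _ x := h
  rw [h'.fderiv]
  simp [h1]
  noncomm_ring

theorem adj_mul_eq (g k : G) : (adj (g * k) : E →L[ℂ] E) = adj g * adj k := by
  ext x; rw [adj_mul]; rfl

theorem adj_locParam (g : G) (v : E × T) :
    (adj (locParam g v).1 : E →L[ℂ] E) = adj g * adj (par v.1 : G) := adj_mul_eq _ _

theorem adj_locParam_inv (g : G) (v : E × T) :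
    (adj (locParam g v).1⁻¹ : E →L[ℂ] E) = Ring.inverse (adj (par v.1 : G) : E →L[ℂ] E) *
      adj g⁻¹ := by
  rw [ringInverse_adj, ← adj_mul_eq, locParam, mul_inv_rev]

/-- The element `Ad_g s` in a neighbourhood of a point. -/
def momentLoc (j : T →L[ℂ] E) (g : G) (v : E × T) : E := adj g (adj (par v.1 : G) (j v.2))

theorem momentLoc_eq (g : G) (v : E × T) :
    adj (locParam g v).1 (j (locParam (E := E) g v).2) = momentLoc j g v := by
  rw [adj_locParam]; rfl

theorem analyticAt_adj_par_fst (t : T) :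
    AnalyticAt ℂ (fun v : E × T ↦ (adj (par v.1 : G) : E →L[ℂ] E)) (org E G, t) :=
  AnalyticAt.fun_comp (g := fun x : E ↦ (adj (par x : G) : E →L[ℂ] E)) (f := Prod.fst)
    analyticAt_adj_par analyticAt_fst

theorem hasFDerivAt_adj_par_fst (t : T) :
    HasFDerivAt (fun v : E × T ↦ (adj (par v.1 : G) : E →L[ℂ] E))
      ((brModel E G).comp (ContinuousLinearMap.fst ℂ E T)) (org E G, t) :=
  HasFDerivAt.comp (g := fun x : E ↦ (adj (par x : G) : E →L[ℂ] E)) (f := Prod.fst) (org E G, t)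
    hasFDerivAt_adj_par hasFDerivAt_fst

theorem analyticAt_momentLoc (g : G) (t : T) :
    AnalyticAt ℂ (momentLoc (E := E) j g) (org E G, t) := by
  have h1 : AnalyticAt ℂ (fun v : E × T ↦ j v.2) (org E G, t) :=
    (j.analyticAt _).fun_comp analyticAt_snd
  exact ((adj g : E →L[ℂ] E).analyticAt _).fun_comp ((analyticAt_adj_par_fst t).clm_apply_apply h1)

theorem momentLoc_org (g : G) (t : T) : momentLoc (E := E) j g (org E G, t) = adj g (j t) := by
  rw [momentLoc, adj_par_org]; rfl

theorem fderiv_momentLoc (g : G) (t : T) (c : E) (s : T) :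
    fderiv ℂ (momentLoc (E := E) j g) (org E G, t) (c, s) =
      adj g (brModel E G c (j t) + j s) := by
  have h1 : HasFDerivAt (fun v : E × T ↦ j v.2) (j.comp (ContinuousLinearMap.snd ℂ E T))
    (org E G, t) := (j.comp (ContinuousLinearMap.snd ℂ E T)).hasFDerivAt
  have h2 : HasFDerivAt (momentLoc (E := E) j g) _ (org E G, t) :=
    ((adj g : E →L[ℂ] E).hasFDerivAt).comp _ ((hasFDerivAt_adj_par_fst t).clm_apply h1)
  rw [h2.fderiv]
  simp [adj_par_org, add_comm]

theorem analyticAt_regOp (x : E × T) : AnalyticAt ℂ (fun v : E × T ↦ regOp G j qT v.2) x := by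
  have h1 : AnalyticAt ℂ (fun v : E × T ↦ brModel E G (j v.2)) x :=
    ((brModel E G).analyticAt _).fun_comp ((j.analyticAt _).fun_comp analyticAt_snd)
  exact h1.add analyticAt_const

theorem hasFDerivAt_regOp (x : E × T) : HasFDerivAt (fun v : E × T ↦ regOp G j qT v.2)
    ((brModel E G).comp (j.comp (ContinuousLinearMap.snd ℂ E T))) x :=
  ((brModel E G).comp (j.comp (ContinuousLinearMap.snd ℂ E T))).hasFDerivAt.add_const _

theorem analyticAt_adInvModel {x : E} {t : T} (ht : IsUnit (regOp G j qT t)) :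
    AnalyticAt ℂ (fun v : E × T ↦ adInvModel G j qT v.2) (x, t) := by
  have hi : AnalyticAt ℂ Ring.inverse (regOp G j qT t) := analyticAt_inverse (𝕜 := ℂ) ht.unit
  exact (AnalyticAt.fun_comp (f := fun v : E × T ↦ regOp G j qT v.2) hi
    (analyticAt_regOp (x, t))).sub analyticAt_const

/-- The difference of the two r-matrices at `Ad_g s`, in a neighbourhood of a point. -/
def phiLoc (G : Type*) [TopologicalSpace G] [ChartedSpace E G] [Group G] [LieGroup 𝓘(ℂ, E) ω G]
    (p r : E →L[ℂ] E) (u : E) : E →L[ℂ] E :=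
  phi (projBr (brModel E G) p u) - r

theorem analyticAt_phiLoc {u : E} (hu : IsUnit (phiDen (projBr (brModel E G) p u))) :
    AnalyticAt ℂ (phiLoc G p r) u :=
  ((analyticAt_phi hu).fun_comp ((projBr (brModel E G) p).analyticAt u)).sub analyticAt_const

theorem fderiv_phiLoc {u : E} (hu : IsUnit (phiDen (projBr (brModel E G) p u))) (v : E) :
    fderiv ℂ (phiLoc G p r) u v = phiDeriv (projBr (brModel E G) p) u v := by
  have h1 : HasFDerivAt (phiLoc G p r) _ u :=
    (HasFDerivAt.comp (f := projBr (brModel E G) p) u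
      (analyticAt_phi hu).differentiableAt.hasFDerivAt
      (projBr (brModel E G) p).hasFDerivAt).sub_const r
  rw [h1.fderiv]; rfl

theorem dynPart_locParam (g : G) (v : E × T) : dynPart p r j (locParam g v) =
    Ring.inverse (adj (par v.1 : G) : E →L[ℂ] E) * (adj g⁻¹ * phiLoc G p r (momentLoc j g v) *
      adj g) * adj (par v.1 : G) := by
  rw [dynPart, momentLoc_eq, adj_locParam, adj_locParam_inv, phiLoc]
  noncomm_ring

theorem theta_locParam (g : G) (v : E × T) : theta p r j qT (locParam g v) =
    adInvModel G j qT v.2 + Ring.inverse (adj (par v.1 : G) : E →L[ℂ] E) *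
      (adj g⁻¹ * phiLoc G p r (momentLoc j g v) * adj g) * adj (par v.1 : G) := by
  rw [theta, dynPart_locParam]; rfl

theorem analyticAt_inverse_adj_par (t : T) :
    AnalyticAt ℂ (fun v : E × T ↦ Ring.inverse (adj (par v.1 : G) : E →L[ℂ] E)) (org E G, t) := by
  have hi : AnalyticAt ℂ Ring.inverse (adj (par (org E G) : G) : E →L[ℂ] E) := by
    rw [adj_par_org]; exact analyticAt_inverse (𝕜 := ℂ) 1
  exact AnalyticAt.fun_comp (f := fun v : E × T ↦ (adj (par v.1 : G) : E →L[ℂ] E)) hi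
    (analyticAt_adj_par_fst t)

theorem analyticAt_dynPart {g : G} {t : T}
    (hu : IsUnit (phiDen (projBr (brModel E G) p (adj g (j t))))) :
    AnalyticAt ℂ (fun v : E × T ↦ dynPart p r j (locParam g v)) (org E G, t) := by
  simp only [dynPart_locParam]
  have h1 : AnalyticAt ℂ (phiLoc G p r) (momentLoc (E := E) j g (org E G, t)) := by
    rw [momentLoc_org]; exact analyticAt_phiLoc hu
  have h2 := AnalyticAt.fun_comp h1 (analyticAt_momentLoc (j := j) g t)
  exact ((analyticAt_inverse_adj_par t).mul
    ((analyticAt_const.mul h2).mul analyticAt_const)).mul (analyticAt_adj_par_fst t)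

theorem analyticAt_theta {g : G} {t : T} (hP : IsRegular p j qT (g, t)) :
    AnalyticAt ℂ (fun v : E × T ↦ theta p r j qT (locParam g v)) (org E G, t) :=
  (analyticAt_adInvModel hP.1).add (analyticAt_dynPart hP.2)

theorem fderiv_adInvModel {x c : E} {t s : T} (ht : IsUnit (regOp G j qT t)) :
    fderiv ℂ (fun v : E × T ↦ adInvModel G j qT v.2) (x, t) (c, s) =
      -(Ring.inverse (regOp G j qT t) * brModel E G (j s) * Ring.inverse (regOp G j qT t)) := by
  have hi := hasFDerivAt_ringInverse (𝕜 := ℂ) ht.unit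
  rw [IsUnit.unit_spec] at hi
  have h := (HasFDerivAt.comp (f := fun v : E × T ↦ regOp G j qT v.2) (x, t) hi
    (hasFDerivAt_regOp (x, t))).sub_const (j.comp qT)
  have h2 : HasFDerivAt (fun v : E × T ↦ adInvModel G j qT v.2) _ (x, t) := h
  rw [h2.fderiv]
  have h3 : ((ht.unit⁻¹ : (E →L[ℂ] E)ˣ) : E →L[ℂ] E) = Ring.inverse (regOp G j qT t) := by
    rw [← Ring.inverse_unit, IsUnit.unit_spec]
  simp [h3]

/-- The three sources of variation: `ad_t⁻¹` moves with `t`, conjugation by `Ad` contributes a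
commutator with `ad c`, and the argument `Ad_g t` of `φ` moves by `Ad_g ([c, t] + s)`. -/
theorem fderiv_theta {g : G} {t : T} (hP : IsRegular p j qT (g, t)) (c : E) (s : T) :
    fderiv ℂ (fun v : E × T ↦ theta p r j qT (locParam g v)) (org E G, t) (c, s) =
      -(Ring.inverse (regOp G j qT t) * brModel E G (j s) * Ring.inverse (regOp G j qT t)) +
      (-(brModel E G c * dynPart p r j (g, t)) +
        adj g⁻¹ * phiDeriv (projBr (brModel E G) p) (adj g (j t))
          (adj g (brModel E G c (j t) + j s)) * adj g +
        dynPart p r j (g, t) * brModel E G c) := by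
  have h1 : AnalyticAt ℂ (phiLoc G p r) (momentLoc (E := E) j g (org E G, t)) := by
    rw [momentLoc_org]; exact analyticAt_phiLoc hP.2
  have h2 := HasFDerivAt.comp (f := momentLoc (E := E) j g) (org E G, t)
    h1.differentiableAt.hasFDerivAt (analyticAt_momentLoc g t).differentiableAt.hasFDerivAt
  have h3 := fderiv_add_conj (analyticAt_adInvModel (x := org E G) hP.1).differentiableAt.hasFDerivAt
    (hasFDerivAt_adj_par_fst t) h2 adj_par_org (adj g⁻¹) (adj g) (c, s)
  have h4 : (fun v : E × T ↦ theta p r j qT (locParam g v)) = _ := funext (theta_locParam g)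
  have e1 : dynPart p r j (g, t) = adj g⁻¹ * phiLoc G p r (momentLoc (E := E) j g (org E G, t)) *
      adj g := by rw [momentLoc_org]; rfl
  rw [h4]
  refine h3.trans ?_
  rw [fderiv_adInvModel hP.1, e1]
  congr 2
  congr 2
  congr 1
  change fderiv ℂ (phiLoc G p r) (momentLoc (E := E) j g (org E G, t))
    (fderiv ℂ (momentLoc (E := E) j g) (org E G, t) (c, s)) = _
  rw [momentLoc_org, fderiv_momentLoc, fderiv_phiLoc hP.2]

end ModelJacobi

/-! ### The Jacobi identity in the model space. -/

section ModelJacobi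

open Filter Topology

variable {E T : Type*} [NormedAddCommGroup E] [NormedSpace ℂ E] [FiniteDimensional ℂ E]
  [CompleteSpace E] [NormedAddCommGroup T] [NormedSpace ℂ T] [CompleteSpace T]
variable {G : Type*} [TopologicalSpace G] [ChartedSpace E G] [Group G] [LieGroup 𝓘(ℂ, E) ω G]
variable {B : E →L[ℂ] E →L[ℂ] ℂ} {p r : E →L[ℂ] E} {j : T →L[ℂ] E} {qT : E →L[ℂ] T}
  {shp : (E →L[ℂ] ℂ) →L[ℂ] E}

theorem eventually_of_locParam {Q : G × T → Prop} {g : G} {t : T}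
    (h : ∀ᶠ v : E × T in 𝓝 (org E G, t), Q (locParam g v)) : ∀ᶠ P in 𝓝 (g, t), Q P := by
  have h2 := (contMDiffAt_locChart (E := E) g t).continuousAt.tendsto
  rw [locChart_self] at h2
  filter_upwards [h2.eventually h, eventually_locParam_locChart (E := E) g t] with P' a b
  rwa [b] at a

/-- Regularity is an open condition. -/
theorem IsRegular.eventually {P : G × T} (hP : IsRegular p j qT P) :
    ∀ᶠ P' in 𝓝 P, IsRegular p j qT P' := by
  obtain ⟨g, t⟩ := P
  have e1 : ∀ᶠ v : E × T in 𝓝 (org E G, t), IsUnit (regOp G j qT v.2) :=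
    (analyticAt_regOp (org E G, t)).continuousAt.eventually (Units.isOpen.mem_nhds hP.1)
  have e2 := ((projBr (brModel E G) p).continuous.continuousAt.comp
    (analyticAt_momentLoc (j := j) g t).continuousAt).eventually (eventually_isUnit_phiDen (by
      rw [Function.comp_apply, momentLoc_org]; exact hP.2))
  refine eventually_of_locParam (E := E) ?_
  filter_upwards [e1, e2] with v h1 h2
  refine ⟨h1, ?_⟩
  rw [momentLoc_eq]
  exact h2

theorem leftDeriv_congr {f f' : G × T → ℂ} {P : G × T} (h : f =ᶠ[𝓝 P] f') :
    (leftDeriv f P : E →L[ℂ] ℂ) = leftDeriv f' P := by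
  refine Filter.EventuallyEq.fderiv_eq ?_
  have h1 : ContinuousAt (fun y : E ↦ ((P.1 * par y, P.2) : G × T)) (org E G) :=
    ((contMDiffAt_locParam (E := E) P.1 P.2).continuousAt).comp (x := org E G)
      (f := fun y : E ↦ ((y, P.2) : E × T)) (by fun_prop)
  have h2 := h1.tendsto
  simp only [par_org, mul_one] at h2
  exact h2.eventually h

theorem vertDeriv_congr {f f' : G × T → ℂ} {P : G × T} (h : f =ᶠ[𝓝 P] f') :
    vertDeriv f P = vertDeriv f' P := by
  refine Filter.EventuallyEq.fderiv_eq ?_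
  have h1 : ContinuousAt (fun s : T ↦ ((P.1, s) : G × T)) P.2 := by fun_prop
  exact h1.tendsto.eventually h

theorem modelBracket_congr {f f' k k' : G × T → ℂ} {P : G × T} (h : f =ᶠ[𝓝 P] f')
    (h' : k =ᶠ[𝓝 P] k') :
    modelBracket p r j qT shp f k P = modelBracket p r j qT shp f' k' P := by
  simp only [modelBracket, leftDeriv_congr h, vertDeriv_congr h, leftDeriv_congr h',
    vertDeriv_congr h']

theorem analyticAt_modelBracket {f k : G × T → ℂ} {g : G} {t : T}
    (hP : IsRegular p j qT (g, t))
    (hf : AnalyticAt ℂ (fun v : E × T ↦ f (locParam g v)) (org E G, t))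
    (hk : AnalyticAt ℂ (fun v : E × T ↦ k (locParam g v)) (org E G, t)) :
    AnalyticAt ℂ (fun v : E × T ↦ modelBracket p r j qT shp f k (locParam g v))
      (org E G, t) := by
  have c {x : E × T} {w : E × T → E →L[ℂ] ℂ} (hw : AnalyticAt ℂ w x) :
      AnalyticAt ℂ (fun v ↦ qT (shp (w v))) x := ((qT.comp shp).analyticAt _).fun_comp hw
  have d {x : E × T} {w : E × T → E →L[ℂ] ℂ} (hw : AnalyticAt ℂ w x) :
      AnalyticAt ℂ (fun v ↦ shp (w v)) x := (shp.analyticAt _).fun_comp hw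
  exact (((analyticAt_vertDeriv hf).clm_apply_apply (c (analyticAt_leftDeriv hk))).sub
    ((analyticAt_vertDeriv hk).clm_apply_apply (c (analyticAt_leftDeriv hf)))).add
    ((analyticAt_leftDeriv hk).clm_apply_apply
      ((analyticAt_theta hP).clm_apply_apply (d (analyticAt_leftDeriv hf))))

namespace IsModel

/-- The component along `G` of the Hamiltonian vector field of `f`. -/
def hamLeft (p r : E →L[ℂ] E) (j : T →L[ℂ] E) (qT : E →L[ℂ] T)
    (shp : (E →L[ℂ] ℂ) →L[ℂ] E) (f : G × T → ℂ) (P : G × T) : E :=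
  shp ((vertDeriv f P).comp qT) + theta p r j qT P (shp (leftDeriv f P))

theorem shp_comp (h : IsModel G B p r j qT shp) (η : T →L[ℂ] ℂ) :
    j (qT (shp (η.comp qT))) = shp (η.comp qT) := by
  rw [← sub_eq_zero]
  refine h.nondeg _ fun y ↦ ?_
  rw [map_sub, _root_.sub_apply, h.proj_symm, h.shp_apply, h.shp_apply]
  simp [h.proj_incl]

theorem apply_proj_shp (h : IsModel G B p r j qT shp) (η : T →L[ℂ] ℂ) (β : E →L[ℂ] ℂ) :
    η (qT (shp β)) = β (shp (η.comp qT)) := by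
  rw [← h.shp_apply β, h.symm, h.shp_apply]; rfl

theorem apply_theta_shp (h : IsModel G B p r j qT shp) {P : G × T} (hP : IsRegular p j qT P)
    (α β : E →L[ℂ] ℂ) : α (theta p r j qT P (shp β)) = -β (theta p r j qT P (shp α)) := by
  rw [← h.shp_apply α, h.symm, h.theta_skew hP, h.shp_apply]

theorem modelBracket_eq (h : IsModel G B p r j qT shp) {P : G × T} (hP : IsRegular p j qT P)
    (f k : G × T → ℂ) : modelBracket p r j qT shp f k P =
      -(leftDeriv f P (hamLeft p r j qT shp k P) - vertDeriv f P (qT (shp (leftDeriv k P)))) := by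
  rw [modelBracket, h.apply_proj_shp (vertDeriv k P), h.apply_theta_shp hP, hamLeft, map_add]
  ring

/-- The second derivative of `f` in the left invariant frame. -/
def frameHess (f : G × T → ℂ) (g : G) (t : T) (w w' : E × T) : ℂ :=
  fderiv ℂ (fun v : E × T ↦ (leftDeriv f (locParam g v) : E →L[ℂ] ℂ)) (org E G, t) w w'.1 +
    fderiv ℂ (fun v : E × T ↦ vertDeriv f (locParam (E := E) g v)) (org E G, t) w w'.2

theorem frameHess_sub {f : G × T → ℂ} {g : G} {t : T}
    (hf : AnalyticAt ℂ (fun v : E × T ↦ f (locParam g v)) (org E G, t)) (w w' : E × T) :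
    frameHess f g t w w' - frameHess f g t w' w =
      leftDeriv f (g, t) (brModel E G w.1 w'.1) := by
  have h1 := frame_antisymm hf w.1 w'.1 w.2 w'.2
  rw [← brModel_apply, LinearEquiv.apply_symm_apply, LinearEquiv.apply_symm_apply] at h1
  exact h1

/-- The Hamiltonian vector field of `f`, up to sign. -/
def hamVec (p r : E →L[ℂ] E) (j : T →L[ℂ] E) (qT : E →L[ℂ] T)
    (shp : (E →L[ℂ] ℂ) →L[ℂ] E) (f : G × T → ℂ) (P : G × T) : E × T :=
  (hamLeft p r j qT shp f P, -qT (shp (leftDeriv f P)))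

/-- By skewness of `θ`, the terms with second derivatives regroup into Hessians of one function
paired with the Hamiltonian vector of the other; only the variation of `θ` is left over. -/
theorem fderiv_modelBracket (h : IsModel G B p r j qT shp) {f k : G × T → ℂ} {g : G} {t : T}
    (hP : IsRegular p j qT (g, t))
    (hf : AnalyticAt ℂ (fun v : E × T ↦ f (locParam g v)) (org E G, t))
    (hk : AnalyticAt ℂ (fun v : E × T ↦ k (locParam g v)) (org E G, t)) (w : E × T) :
    fderiv ℂ (fun v : E × T ↦ modelBracket p r j qT shp f k (locParam g v)) (org E G, t) w =
      frameHess k g t w (hamVec p r j qT shp f (g, t)) -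
      frameHess f g t w (hamVec p r j qT shp k (g, t)) +
      leftDeriv k (g, t) (fderiv ℂ (fun v : E × T ↦ theta p r j qT (locParam g v)) (org E G, t) w
        (shp (leftDeriv f (g, t)))) := by
  have f1 := (analyticAt_leftDeriv hf).differentiableAt.hasFDerivAt
  have f2 := (analyticAt_vertDeriv hf).differentiableAt.hasFDerivAt
  have k1 := (analyticAt_leftDeriv hk).differentiableAt.hasFDerivAt
  have k2 := (analyticAt_vertDeriv hk).differentiableAt.hasFDerivAt
  have th := (analyticAt_theta (r := r) hP).differentiableAt.hasFDerivAt
  have f3 := shp.hasFDerivAt.comp (org E G, t) f1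
  have f4 := (qT.comp shp).hasFDerivAt.comp (org E G, t) f1
  have k4 := (qT.comp shp).hasFDerivAt.comp (org E G, t) k1
  have hd : HasFDerivAt (fun v : E × T ↦ modelBracket p r j qT shp f k (locParam g v)) _
    (org E G, t) := ((f2.clm_apply k4).sub (k2.clm_apply f4)).add (k1.clm_apply (th.clm_apply f3))
  rw [hd.fderiv]
  simp only [_root_.add_apply, _root_.sub_apply, ContinuousLinearMap.comp_apply,
    ContinuousLinearMap.flip_apply, Function.comp_apply, locParam_org, frameHess, hamVec, hamLeft,
    map_add, map_neg, h.apply_proj_shp, h.apply_theta_shp hP (leftDeriv k (g, t))]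
  ring

theorem modelBracket_modelBracket (h : IsModel G B p r j qT shp) {f k l : G × T → ℂ} {g : G}
    {t : T} (hP : IsRegular p j qT (g, t))
    (hf : AnalyticAt ℂ (fun v : E × T ↦ f (locParam g v)) (org E G, t))
    (hk : AnalyticAt ℂ (fun v : E × T ↦ k (locParam g v)) (org E G, t)) :
    modelBracket p r j qT shp (modelBracket p r j qT shp f k) l (g, t) =
      -(frameHess k g t (hamVec p r j qT shp l (g, t)) (hamVec p r j qT shp f (g, t)) -
      frameHess f g t (hamVec p r j qT shp l (g, t)) (hamVec p r j qT shp k (g, t)) +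
      leftDeriv k (g, t) (fderiv ℂ (fun v : E × T ↦ theta p r j qT (locParam g v)) (org E G, t)
        (hamVec p r j qT shp l (g, t)) (shp (leftDeriv f (g, t))))) := by
  have hb := analyticAt_modelBracket (r := r) (shp := shp) hP hf hk
  rw [h.modelBracket_eq hP, ← h.fderiv_modelBracket hP hf hk, leftDeriv_apply_eq hb,
    vertDeriv_apply_eq hb, sub_eq_add_neg, ← map_neg, ← map_add]
  simp [hamVec]

/-- Conjugation by `Ad_g` moves the variation of `θ` to the right trivialization, where `φ(ad u)`
and `r` appear without conjugation and the algebraic identity was proved. -/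
theorem adj_fderiv_theta (h : IsModel G B p r j qT shp) {g : G} {t : T}
    (hP : IsRegular p j qT (g, t)) (c z w : E) :
    adj g (fderiv ℂ (fun v : E × T ↦ theta p r j qT (locParam g v)) (org E G, t) (c, -qT z) w) =
      IsSliceData.thetaDeriv (brModel E G) p (adj g * j.comp qT * adj g⁻¹)
        (adj g * adInvModel G j qT t * adj g⁻¹) r (adj g (j t)) (adj g c) (adj g z) (adj g w) := by
  have h1 : Ring.inverse (regOp G j qT t) (brModel E G (j (qT z))
      (Ring.inverse (regOp G j qT t) w)) =
      adInvModel G j qT t (brModel E G (j (qT z)) (adInvModel G j qT t w)) := by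
    have e : ∀ x, Ring.inverse (regOp G j qT t) x = adInvModel G j qT t x + j (qT x) := fun x ↦ by
      rw [adInvModel_apply, sub_add_cancel]
    rw [e w, map_add, h.comm, add_zero, e, h.proj_lie, add_zero]
  rw [fderiv_theta hP]
  simp only [IsSliceData.thetaDeriv, _root_.add_apply, _root_.neg_apply, mul_apply_eq_comp, dynPart_apply,
    ContinuousLinearMap.comp_apply, map_add, map_neg, map_sub, h1, adj_inv_adj, adj_adj_inv,
    adj_brModel, neg_neg, _root_.sub_apply]
  abel_nf

theorem jacobi (h : IsModel G B p r j qT shp) {f k l : G × T → ℂ} {g : G}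
    {t : T} (hP : IsRegular p j qT (g, t))
    (hf : AnalyticAt ℂ (fun v : E × T ↦ f (locParam g v)) (org E G, t))
    (hk : AnalyticAt ℂ (fun v : E × T ↦ k (locParam g v)) (org E G, t))
    (hl : AnalyticAt ℂ (fun v : E × T ↦ l (locParam g v)) (org E G, t)) :
    modelBracket p r j qT shp (modelBracket p r j qT shp f k) l (g, t) +
      modelBracket p r j qT shp (modelBracket p r j qT shp k l) f (g, t) +
      modelBracket p r j qT shp (modelBracket p r j qT shp l f) k (g, t) = 0 := by
  rw [h.modelBracket_modelBracket hP hf hk, h.modelBracket_modelBracket hP hk hl,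
    h.modelBracket_modelBracket hP hl hf]
  have ff := frameHess_sub hf (hamVec p r j qT shp l (g, t)) (hamVec p r j qT shp k (g, t))
  have fk := frameHess_sub hk (hamVec p r j qT shp f (g, t)) (hamVec p r j qT shp l (g, t))
  have fl := frameHess_sub hl (hamVec p r j qT shp k (g, t)) (hamVec p r j qT shp f (g, t))
  have hc : ∀ η : T →L[ℂ] ℂ, (adj g * j.comp qT * adj g⁻¹ : E →L[ℂ] E)
      (adj g (shp (η.comp qT))) = adj g (shp (η.comp qT)) := fun η ↦ by
    change adj g (j (qT (adj g⁻¹ (adj g _)))) = _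
    rw [adj_inv_adj, h.shp_comp]
  have hs := (h.isSliceData hP).cyclic_sum (x := adj g (shp (leftDeriv f (g, t))))
    (y := adj g (shp (leftDeriv k (g, t)))) (z := adj g (shp (leftDeriv l (g, t))))
    (hc (vertDeriv f (g, t))) (hc (vertDeriv k (g, t))) (hc (vertDeriv l (g, t)))
  have hham : ∀ f : G × T → ℂ, adj g (shp ((vertDeriv f (g, t)).comp qT)) +
      (adj g * adInvModel G j qT t * adj g⁻¹ : E →L[ℂ] E) (adj g (shp (leftDeriv f (g, t)))) +
      (phi (projBr (brModel E G) p (adj g (j t))) (adj g (shp (leftDeriv f (g, t)))) -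
        r (adj g (shp (leftDeriv f (g, t))))) = adj g (hamLeft p r j qT shp f (g, t)) := fun f ↦ by
    rw [hamLeft, theta, _root_.add_apply, map_add, map_add, dynPart_apply, adj_adj_inv,
      mul_apply_eq_comp, mul_apply_eq_comp, adj_inv_adj, add_assoc]
  simp only [hham, ← h.adj_fderiv_theta hP, ← adj_brModel, h.inv, h.shp_apply] at hs
  simp only [hamVec] at ff fk fl ⊢
  -- The six Hessian terms pair into three antisymmetrizations, each a bracket of Hamiltonian
  -- vectors; these and the variations of `θ` form the cyclic sum.
  linear_combination hs + ff + fk + fl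

end IsModel
end ModelJacobi

/-! ### The bivector field in the model space -/

section Sharp

variable {𝔨 : Type*} [LieRing 𝔨] [LieAlgebra ℂ 𝔨] [FiniteDimensional ℂ 𝔨]

theorem sharp_eq {B : LinearMap.BilinForm ℂ 𝔨} (hB : B.Nondegenerate) {ξ : Module.Dual ℂ 𝔨} {x : 𝔨}
    (hx : B x = ξ) : sharp B ξ = x := by
  rw [← sub_eq_zero, ← Module.forall_dual_apply_eq_zero_iff ℂ]
  intro η
  have h1 := dualDistrib_map_casimir hB LinearMap.id LinearMap.id ξ η (x := x) (by rw [hx]; rfl)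
  rw [TensorProduct.map_id, LinearMap.id_apply, dualDistrib_eq_contract] at h1
  rw [map_sub, sub_eq_zero]
  exact h1

theorem IsMetricReductive.nondegenerate_restrictForm {B : LinearMap.BilinForm ℂ 𝔨}
    {𝔱 𝔞 : LieSubalgebra ℂ 𝔨} (h : IsMetricReductive B 𝔱)
    (ha : ∀ x ∈ 𝔞, (∀ y ∈ 𝔞, B x y = 0) → x = 0) : (restrictForm B 𝔞).Nondegenerate :=
  ⟨fun x hx ↦ Subtype.ext (ha x x.2 fun y hy ↦ hx ⟨y, hy⟩),
    fun x hx ↦ Subtype.ext (ha x x.2 fun y hy ↦ (h.symm _ _).trans (hx ⟨y, hy⟩))⟩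

theorem IsMetricReductive.nondegenerate_cartan {B : LinearMap.BilinForm ℂ 𝔨}
    {𝔱 : LieSubalgebra ℂ 𝔨} (h : IsMetricReductive B 𝔱) : (restrictForm B 𝔱).Nondegenerate :=
  h.nondegenerate_restrictForm fun _ hx ↦ h.nondeg_cartan hx

end Sharp

/-! ### Comparison of the Lie-algebraic data with the model. -/

section Link

open Filter Topology

variable {E G : Type*} [NormedAddCommGroup E] [NormedSpace ℂ E] [FiniteDimensional ℂ E]
  [CompleteSpace E] [TopologicalSpace G] [ChartedSpace E G] [Group G] [LieGroup 𝓘(ℂ, E) ω G]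

/-- An endomorphism of the Lie algebra as an operator on the model space. -/
def modelEnd (f : GroupLieAlgebra 𝓘(ℂ, E) G →ₗ[ℂ] GroupLieAlgebra 𝓘(ℂ, E) G) : E →L[ℂ] E :=
  LinearMap.toContinuousLinearMap
    ((toModel E G).toLinearMap ∘ₗ f ∘ₗ (toModel E G).symm.toLinearMap)

theorem modelEnd_apply (f : GroupLieAlgebra 𝓘(ℂ, E) G →ₗ[ℂ] GroupLieAlgebra 𝓘(ℂ, E) G)
    (x : GroupLieAlgebra 𝓘(ℂ, E) G) : modelEnd f (toModel E G x) = toModel E G (f x) := rfl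

/-- A bilinear form on the Lie algebra as a continuous bilinear form on the model space. -/
def modelForm (B : LinearMap.BilinForm ℂ (GroupLieAlgebra 𝓘(ℂ, E) G)) : E →L[ℂ] E →L[ℂ] ℂ :=
  LinearMap.toContinuousLinearMap ((LinearMap.toContinuousLinearMap :
    (E →ₗ[ℂ] ℂ) ≃ₗ[ℂ] (E →L[ℂ] ℂ)).toLinearMap ∘ₗ
      LinearMap.compl₁₂ B (toModel E G).symm.toLinearMap (toModel E G).symm.toLinearMap)

theorem modelForm_apply (B : LinearMap.BilinForm ℂ (GroupLieAlgebra 𝓘(ℂ, E) G))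
    (x y : GroupLieAlgebra 𝓘(ℂ, E) G) : modelForm B (toModel E G x) (toModel E G y) = B x y := rfl

theorem Ad_toModel (g : G) (x : GroupLieAlgebra 𝓘(ℂ, E) G) :
    toModel E G (Ad g x) = adj g (toModel E G x) := Ad_apply g (toModel E G x)

theorem modelForm_adj {B : LinearMap.BilinForm ℂ (GroupLieAlgebra 𝓘(ℂ, E) G)}
    (hBinv : ∀ (g : G) (x y : GroupLieAlgebra 𝓘(ℂ, E) G), B (Ad g x) (Ad g y) = B x y)
    (g : G) (x y : E) : modelForm B (adj g x) (adj g y) = modelForm B x y := by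
  obtain ⟨x, rfl⟩ := (toModel E G).surjective x
  obtain ⟨y, rfl⟩ := (toModel E G).surjective y
  rw [← Ad_toModel, ← Ad_toModel, modelForm_apply, modelForm_apply, hBinv]

theorem isMetricReductive_of_Ad_invariant (hred : IsReductive (GroupLieAlgebra 𝓘(ℂ, E) G))
    {B : LinearMap.BilinForm ℂ (GroupLieAlgebra 𝓘(ℂ, E) G)}
    (hBsymm : B.IsSymm) (hBnondeg : B.Nondegenerate)
    (hBinv : ∀ (g : G) (x y : GroupLieAlgebra 𝓘(ℂ, E) G), B (Ad g x) (Ad g y) = B x y)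
    {𝔱 : LieSubalgebra ℂ (GroupLieAlgebra 𝓘(ℂ, E) G)} (h𝔱 : IsCartan 𝔱) :
    IsMetricReductive B 𝔱 where
  reductive := hred
  symm := hBsymm.eq
  nondeg x hx := hBnondeg.1 x hx
  inv x y z := by
    have h1 := brModel_inv (modelForm_adj hBinv) (toModel E G x) (toModel E G y) (toModel E G z)
    rwa [brModel_apply, brModel_apply, modelForm_apply, modelForm_apply] at h1
  cartan := h𝔱

theorem exists_inverse_modelForm {B : LinearMap.BilinForm ℂ (GroupLieAlgebra 𝓘(ℂ, E) G)}
    (hB : ∀ x, (∀ y, B x y = 0) → x = 0) : ∃ shp : (E →L[ℂ] ℂ) →L[ℂ] E,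
      (∀ ξ x, modelForm B (shp ξ) x = ξ x) ∧ ∀ x, shp (modelForm B x) = x := by
  have hi : Function.Injective (modelForm B).toLinearMap := by
    rw [← LinearMap.ker_eq_bot, LinearMap.ker_eq_bot']
    intro x hx
    exact hB x fun y ↦ DFunLike.congr_fun hx (toModel E G y)
  have hd : Module.finrank ℂ E = Module.finrank ℂ (E →L[ℂ] ℂ) := by
    rw [← (LinearMap.toContinuousLinearMap : (E →ₗ[ℂ] ℂ) ≃ₗ[ℂ] (E →L[ℂ] ℂ)).finrank_eq]
    exact Subspace.dual_finrank_eq.symm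
  let F := LinearEquiv.ofInjectiveOfFinrankEq _ hi hd
  refine ⟨LinearMap.toContinuousLinearMap F.symm.toLinearMap, fun ξ x ↦ ?_,
    fun x ↦ F.symm_apply_apply x⟩
  exact DFunLike.congr_fun (F.apply_symm_apply ξ) x

variable {B : LinearMap.BilinForm ℂ (GroupLieAlgebra 𝓘(ℂ, E) G)}
  {𝔱 : LieSubalgebra ℂ (GroupLieAlgebra 𝓘(ℂ, E) G)}
  {p q : GroupLieAlgebra 𝓘(ℂ, E) G →ₗ[ℂ] GroupLieAlgebra 𝓘(ℂ, E) G} {lam : 𝔱}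
  {P : Set (Module.Dual ℂ 𝔱)} {e : Module.Dual ℂ 𝔱 → GroupLieAlgebra 𝓘(ℂ, E) G}

/-- The orthogonal projection to the Cartan subalgebra. -/
def modelProj (hq : IsOrthProj B 𝔱.toSubmodule q) : E →L[ℂ] space 𝔱 :=
  (modelEnd q).codRestrict (space 𝔱) hq.mem

theorem subtypeL_modelProj (hq : IsOrthProj B 𝔱.toSubmodule q)
    (x : GroupLieAlgebra 𝓘(ℂ, E) G) :
    (space 𝔱).subtypeL (modelProj hq (toModel E G x)) = toModel E G (q x) := rfl

theorem toModel_spaceEquiv (s : space 𝔱) :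
    toModel E G (spaceEquiv 𝔱 s) = (space 𝔱).subtypeL s := rfl

theorem isModel (h : IsMetricReductive B 𝔱)
    (hBinv : ∀ (g : G) (x y : GroupLieAlgebra 𝓘(ℂ, E) G), B (Ad g x) (Ad g y) = B x y)
    (hP : IsPositiveSystem 𝔱 P) (he : IsRootVectors B 𝔱 e)
    (hp : IsOrthProj B (leviDerived (lam : GroupLieAlgebra 𝓘(ℂ, E) G)).toSubmodule p)
    (hq : IsOrthProj B 𝔱.toSubmodule q) {shp : (E →L[ℂ] ℂ) →L[ℂ] E}
    (h1 : ∀ ξ x, modelForm B (shp ξ) x = ξ x) (h2 : ∀ x, shp (modelForm B x) = x) :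
    IsModel G (modelForm B) (modelEnd p) (modelEnd (rStdEnd B 𝔱 P e lam)) (space 𝔱).subtypeL
      (modelProj hq) shp where
  symm x y := h.symm x y
  shp_apply := h1
  shp_form := h2
  inv := modelForm_adj hBinv
  proj_incl s := Subtype.ext (hq.apply_of_mem (w := (spaceEquiv 𝔱 s).1) (spaceEquiv 𝔱 s).2)
  proj_symm x y := hq.selfAdjoint h.symm x y
  comm s s' := by
    rw [← toModel_spaceEquiv, ← toModel_spaceEquiv, brModel_apply,
      h.cartan.lie_eq_zero (spaceEquiv 𝔱 s).2 (spaceEquiv 𝔱 s').2, map_zero]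
  proj := by
    refine ⟨fun x y ↦ hp.selfAdjoint h.symm x y, fun x ↦ hp.idem x, fun x y ↦ ?_⟩
    obtain ⟨x, rfl⟩ := (toModel E G).surjective x
    obtain ⟨y, rfl⟩ := (toModel E G).surjective y
    rw [modelEnd_apply, modelEnd_apply, brModel_apply, modelEnd_apply]
    exact congrArg _ (hp.apply_of_mem
      ((leviDerived (lam : GroupLieAlgebra 𝓘(ℂ, E) G)).lie_mem (hp.mem x) (hp.mem y)))
  memr x := hp.apply_of_mem (rStdEnd_mem h hP he ((toModel E G).symm x))
  skewr x y := rStdEnd_skew h hP ((toModel E G).symm x) ((toModel E G).symm y)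
  mcybe x y z := by
    obtain ⟨x, rfl⟩ := (toModel E G).surjective x
    obtain ⟨y, rfl⟩ := (toModel E G).surjective y
    obtain ⟨z, rfl⟩ := (toModel E G).surjective z
    simp only [modelEnd_apply, brModel_apply, modelForm_apply]
    exact h.mcybe hP he hp x y z

theorem regOp_toModel (hq : IsOrthProj B 𝔱.toSubmodule q) (s : space 𝔱)
    (x : GroupLieAlgebra 𝓘(ℂ, E) G) : regOp G (space 𝔱).subtypeL (modelProj hq) s (toModel E G x) =
      toModel E G (⁅(spaceEquiv 𝔱 s : GroupLieAlgebra 𝓘(ℂ, E) G), x⁆ + q x) := by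
  change brModel E G (toModel E G (spaceEquiv 𝔱 s)) (toModel E G x) + toModel E G (q x) = _
  rw [brModel_apply, map_add]

theorem isUnit_regOp (h : IsMetricReductive B 𝔱) (hq : IsOrthProj B 𝔱.toSubmodule q)
    {s : space 𝔱} (hs : spaceEquiv 𝔱 s ∈ tPrime 𝔱) :
    IsUnit (regOp G (space 𝔱).subtypeL (modelProj hq) s) :=
  isUnit_of_injective fun x hx ↦ by
    obtain ⟨x, rfl⟩ := (toModel E G).surjective x
    rw [regOp_toModel, LinearEquiv.map_eq_zero_iff] at hx
    rw [LinearEquiv.map_eq_zero_iff]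
    exact (injective_iff_map_eq_zero _).1 (h.bijective_ad_add_proj hq hs).1 x hx

theorem adInvModel_toModel (h : IsMetricReductive B 𝔱) (hq : IsOrthProj B 𝔱.toSubmodule q)
    {s : space 𝔱} (hs : spaceEquiv 𝔱 s ∈ tPrime 𝔱) (x : GroupLieAlgebra 𝓘(ℂ, E) G) :
    adInvModel G (space 𝔱).subtypeL (modelProj hq) s (toModel E G x) =
      toModel E G (adInv B (spaceEquiv 𝔱 s : GroupLieAlgebra 𝓘(ℂ, E) G) x) := by
  obtain ⟨y, rfl⟩ := (h.bijective_ad_add_proj hq hs).2 x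
  rw [LinearMap.add_apply, LieAlgebra.ad_apply, h.adInv_apply_add hq hs, IsModel.adInvModel_apply,
    ← regOp_toModel hq, ← mul_apply_eq_comp, Ring.inverse_mul_cancel _ (isUnit_regOp h hq hs),
    regOp_toModel, subtypeL_modelProj, map_add q, h.proj_cartan_lie hq, zero_add, hq.idem, map_sub]
  rfl

/-- The projection to the derived algebra of the Levi subalgebra. -/
def projLevi (hp : IsOrthProj B (leviDerived (lam : GroupLieAlgebra 𝓘(ℂ, E) G)).toSubmodule p) :
    GroupLieAlgebra 𝓘(ℂ, E) G →ₗ[ℂ] leviDerived (lam : GroupLieAlgebra 𝓘(ℂ, E) G) :=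
  p.codRestrict (leviDerived (lam : GroupLieAlgebra 𝓘(ℂ, E) G)).toSubmodule hp.mem

theorem restrictForm_projLevi
    (hp : IsOrthProj B (leviDerived (lam : GroupLieAlgebra 𝓘(ℂ, E) G)).toSubmodule p)
    (x : GroupLieAlgebra 𝓘(ℂ, E) G) :
    restrictForm B (leviDerived (lam : GroupLieAlgebra 𝓘(ℂ, E) G)) (projLevi hp x) =
      (B x).comp ((leviDerived (lam : GroupLieAlgebra 𝓘(ℂ, E) G)).incl :
        leviDerived (lam : GroupLieAlgebra 𝓘(ℂ, E) G) →ₗ[ℂ] GroupLieAlgebra 𝓘(ℂ, E) G) :=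
  LinearMap.ext fun y ↦ hp.pairing x y y.2

theorem sharp_momentRestr (h : IsMetricReductive B 𝔱)
    (hp : IsOrthProj B (leviDerived (lam : GroupLieAlgebra 𝓘(ℂ, E) G)).toSubmodule p)
    (x : G × space 𝔱) :
    sharp (restrictForm B (leviDerived (lam : GroupLieAlgebra 𝓘(ℂ, E) G)))
      (momentRestr B 𝔱 lam x) = projLevi hp (Ad x.1 (spaceEquiv 𝔱 x.2)) :=
  sharp_eq (h.nondegenerate_restrictForm hp.nondeg) (restrictForm_projLevi hp _)

/-- The operator `ad` of the projected element on `𝔤₁`, extended by zero to `𝔤`, is the projected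
bracket; so both the domain and the value of the r-matrix can be read off on the model space. -/
theorem phiEnd_link (h : IsMetricReductive B 𝔱)
    (hp : IsOrthProj B (leviDerived (lam : GroupLieAlgebra 𝓘(ℂ, E) G)).toSubmodule p)
    (x : G × space 𝔱) :
    (IsUnit (phiDen (projBr (brModel E G) (modelEnd p) (adj x.1 ((space 𝔱).subtypeL x.2)))) ↔
      momentRestr B 𝔱 lam x ∈
        domAM (restrictForm B (leviDerived (lam : GroupLieAlgebra 𝓘(ℂ, E) G)))) ∧
    (IsUnit (phiDen (projBr (brModel E G) (modelEnd p) (adj x.1 ((space 𝔱).subtypeL x.2)))) →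
      ∀ v, phi (projBr (brModel E G) (modelEnd p) (adj x.1 ((space 𝔱).subtypeL x.2)))
        (toModel E G v) = toModel E G (phiEnd (LieAlgebra.ad ℂ
          (leviDerived (lam : GroupLieAlgebra 𝓘(ℂ, E) G))
          (sharp (restrictForm B (leviDerived (lam : GroupLieAlgebra 𝓘(ℂ, E) G)))
            (momentRestr B 𝔱 lam x))) (projLevi hp v))) := by
  have h1 := phiEnd_conj ((toModel E G).toLinearMap ∘ₗ
      ((leviDerived (lam : GroupLieAlgebra 𝓘(ℂ, E) G)).incl :
        leviDerived (lam : GroupLieAlgebra 𝓘(ℂ, E) G) →ₗ[ℂ] GroupLieAlgebra 𝓘(ℂ, E) G))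
    (projLevi hp ∘ₗ (toModel E G).symm.toLinearMap)
    (fun w ↦ Subtype.ext (hp.apply_of_mem w.2))
    (LieAlgebra.ad ℂ (leviDerived (lam : GroupLieAlgebra 𝓘(ℂ, E) G))
      (sharp (restrictForm B (leviDerived (lam : GroupLieAlgebra 𝓘(ℂ, E) G)))
        (momentRestr B 𝔱 lam x)))
    (projBr (brModel E G) (modelEnd p) (adj x.1 ((space 𝔱).subtypeL x.2))) (fun v ↦ by
      obtain ⟨v, rfl⟩ := (toModel E G).surjective v
      rw [sharp_momentRestr h hp, projBr_apply, ← toModel_spaceEquiv, ← Ad_toModel,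
        modelEnd_apply, modelEnd_apply, brModel_apply]
      rfl)
  exact ⟨h1.1, fun hu v ↦ h1.2 hu (toModel E G v)⟩

theorem mem_domG1_iff (h : IsMetricReductive B 𝔱)
    (hp : IsOrthProj B (leviDerived (lam : GroupLieAlgebra 𝓘(ℂ, E) G)).toSubmodule p)
    {x : G × space 𝔱} : x ∈ domG1 B 𝔱 lam ↔ spaceEquiv 𝔱 x.2 ∈ tPrime 𝔱 ∧
      IsUnit (phiDen (projBr (brModel E G) (modelEnd p)
        (adj x.1 ((space 𝔱).subtypeL x.2)))) := by
  rw [(phiEnd_link h hp x).1]; rfl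

theorem isRegular_of_mem_domG1 (h : IsMetricReductive B 𝔱)
    (hp : IsOrthProj B (leviDerived (lam : GroupLieAlgebra 𝓘(ℂ, E) G)).toSubmodule p)
    (hq : IsOrthProj B 𝔱.toSubmodule q) {x : G × space 𝔱} (hx : x ∈ domG1 B 𝔱 lam) :
    IsRegular (modelEnd p) (space 𝔱).subtypeL (modelProj hq) x :=
  ⟨isUnit_regOp h hq ((mem_domG1_iff h hp).1 hx).1, ((mem_domG1_iff h hp).1 hx).2⟩

set_option maxHeartbeats 1000000 in
/-- The bracket defined by the bivector field, computed in the left invariant frame. -/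
theorem bracket_piG1 (h : IsMetricReductive B 𝔱)
    (hBinv : ∀ (g : G) (x y : GroupLieAlgebra 𝓘(ℂ, E) G), B (Ad g x) (Ad g y) = B x y)
    (hP : IsPositiveSystem 𝔱 P) (he : IsRootVectors B 𝔱 e)
    (hp : IsOrthProj B (leviDerived (lam : GroupLieAlgebra 𝓘(ℂ, E) G)).toSubmodule p)
    (hq : IsOrthProj B 𝔱.toSubmodule q) {shp : (E →L[ℂ] ℂ) →L[ℂ] E}
    (h1 : ∀ ξ x, modelForm B (shp ξ) x = ξ x) (h2 : ∀ x, shp (modelForm B x) = x)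
    {x : G × space 𝔱} (hx : x ∈ domG1 B 𝔱 lam) {f k : G × space 𝔱 → ℂ}
    (hf : MDifferentiableAt (𝓘(ℂ, E).prod 𝓘(ℂ, space 𝔱)) 𝓘(ℂ, ℂ) f x)
    (hk : MDifferentiableAt (𝓘(ℂ, E).prod 𝓘(ℂ, space 𝔱)) 𝓘(ℂ, ℂ) k x) :
    bracket (𝓘(ℂ, E).prod 𝓘(ℂ, space 𝔱)) (piG1 B 𝔱 P e lam) f k x =
      modelBracket (modelEnd p) (modelEnd (rStdEnd B 𝔱 P e lam)) (space 𝔱).subtypeL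
        (modelProj hq) shp f k x := by
  have hM := isModel h hBinv hP he hp hq h1 h2
  -- `X` and `X'` are the vectors dual to the left and vertical derivatives of `f`. From them come
  -- the dual vectors needed to contract each of the five tensors that make up the bivector.
  obtain ⟨X, hX⟩ := (toModel E G).surjective (shp (leftDeriv f x))
  obtain ⟨X', hX'⟩ := (toModel E G).surjective (shp ((vertDeriv f x).comp (modelProj hq)))
  have hdL : ∀ v, leftDeriv f x (toModel E G v) = B X v := fun v ↦ by
    rw [← h1 (leftDeriv f x), ← hX, modelForm_apply]
  have hX'q : q X' = X' := (toModel E G).injective (by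
    rw [← subtypeL_modelProj hq, hX', hM.shp_comp])
  have hX't : X' ∈ 𝔱 := by rw [← hX'q]; exact hq.mem X'
  have e1 : restrictForm B 𝔱 ⟨X', hX't⟩ =
      differential (𝓘(ℂ, E).prod 𝓘(ℂ, space 𝔱)) f x ∘ₗ vertT 𝔱 x := LinearMap.ext fun s ↦ by
    refine Eq.trans ?_ (differential_vertT 𝔱 hf s).symm
    have h3 := h1 ((vertDeriv f x).comp (modelProj hq)) (toModel E G s)
    rw [← hX', modelForm_apply] at h3
    refine h3.trans ?_
    rw [ContinuousLinearMap.comp_apply]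
    congr 1
    exact hM.proj_incl ((spaceEquiv 𝔱).symm s)
  have e2 : restrictForm B 𝔱 ⟨q X, hq.mem X⟩ =
      differential (𝓘(ℂ, E).prod 𝓘(ℂ, space 𝔱)) f x ∘ₗ (leftT 𝔱 x ∘ₗ
        (𝔱.incl : 𝔱 →ₗ[ℂ] GroupLieAlgebra 𝓘(ℂ, E) G)) := LinearMap.ext fun s ↦ by
    refine Eq.trans ?_ (differential_leftT 𝔱 hf (s : GroupLieAlgebra 𝓘(ℂ, E) G)).symm
    rw [hdL]
    exact hq.pairing X s s.2
  have e3 : B X = differential (𝓘(ℂ, E).prod 𝓘(ℂ, space 𝔱)) f x ∘ₗ leftT 𝔱 x :=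
    LinearMap.ext fun v ↦ by
      refine Eq.trans ?_ (differential_leftT 𝔱 hf v).symm
      rw [hdL]
  have e4 : B (Ad x.1 X) = differential (𝓘(ℂ, E).prod 𝓘(ℂ, space 𝔱)) f x ∘ₗ rightT 𝔱 x :=
    LinearMap.ext fun v ↦ by
      refine Eq.trans ?_ (differential_rightT 𝔱 hf v).symm
      rw [← Ad_toModel, hdL, ← hBinv x.1 X]
      congr 1
      apply (toModel E G).injective
      rw [Ad_toModel, Ad_toModel, adj_adj_inv]
  have e5 : restrictForm B (leviDerived (lam : GroupLieAlgebra 𝓘(ℂ, E) G))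
      (projLevi hp (Ad x.1 X)) = differential (𝓘(ℂ, E).prod 𝓘(ℂ, space 𝔱)) f x ∘ₗ (rightT 𝔱 x ∘ₗ
        ((leviDerived (lam : GroupLieAlgebra 𝓘(ℂ, E) G)).incl :
        leviDerived (lam : GroupLieAlgebra 𝓘(ℂ, E) G) →ₗ[ℂ] GroupLieAlgebra 𝓘(ℂ, E) G)) := by
    rw [restrictForm_projLevi, e4]; rfl
  have hxt := ((mem_domG1_iff h hp).1 hx).1
  have hxu := ((mem_domG1_iff h hp).1 hx).2
  have n1 := h.nondegenerate
  have n2 := h.nondegenerate_restrictForm hp.nondeg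
  rw [bracket, piG1, piSlice, map_sub, map_add, map_add, map_sub,
    dualDistrib_map_casimir h.nondegenerate_cartan _ _ _ _ e1,
    dualDistrib_map_casimir h.nondegenerate_cartan _ _ _ _ e2,
    dualDistrib_map_lTensor_casimir n1 _ _ _ _ _ e3, rAM,
    dualDistrib_map_lTensor_casimir n2 _ _ _ _ _ e5,
    dualDistrib_map_rStd h hP _ _ _ e4]
  have d1 := differential_leftT 𝔱 hk X'
  have d2 := differential_vertT 𝔱 hk ⟨q X, hq.mem X⟩
  have d3 := differential_leftT 𝔱 hk
    (adInv B (spaceEquiv 𝔱 x.2 : GroupLieAlgebra 𝓘(ℂ, E) G) X)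
  have d4 := differential_rightT 𝔱 hk (phiEnd (LieAlgebra.ad ℂ
          (leviDerived (lam : GroupLieAlgebra 𝓘(ℂ, E) G))
          (sharp (restrictForm B (leviDerived (lam : GroupLieAlgebra 𝓘(ℂ, E) G)))
            (momentRestr B 𝔱 lam x))) (projLevi hp (Ad x.1 X)))
  have d5 := differential_rightT 𝔱 hk (rStdEnd B 𝔱 P e lam (Ad x.1 X))
  rw [← (phiEnd_link h hp x).2 hxu, Ad_toModel] at d4
  rw [← modelEnd_apply, Ad_toModel] at d5
  rw [← adInvModel_toModel h hq hxt] at d3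
  rw [modelBracket, hM.apply_proj_shp, theta, _root_.add_apply, map_add, ← hX, ← hX',
    IsModel.dynPart_apply, map_sub, map_sub, ← d1, ← d3, ← d4, ← d5]
  have d2' : vertDeriv k x (modelProj hq (toModel E G X)) = _ := d2.symm
  rw [d2']
  have h5 : ∀ a b c d e : ℂ, a - b + c + d - e = a - b + (c + (d - e)) := fun _ _ _ _ _ ↦ by ring
  exact h5 _ _ _ _ _

end Link

/-! ### From the model bracket to the tensor: Poisson property and nondegeneracy. -/

section Abstract

open Filter Topology

variable {E T : Type*} [NormedAddCommGroup E] [NormedSpace ℂ E] [FiniteDimensional ℂ E]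
  [CompleteSpace E] [NormedAddCommGroup T] [NormedSpace ℂ T] [CompleteSpace T]
  [FiniteDimensional ℂ T]
variable {G : Type*} [TopologicalSpace G] [ChartedSpace E G] [Group G] [LieGroup 𝓘(ℂ, E) ω G]

/-- A linear function in the chart `locChart g`. -/
def coordFun (g : G) (l : E × T →L[ℂ] ℂ) (P : G × T) : ℂ := l (locChart g P)

theorem eventually_locChart_locParam (g : G) (t : T) :
    ∀ᶠ v : E × T in 𝓝 (org E G, t), locChart g (locParam g v) = v := by
  filter_upwards [(continuousAt_fst (p := (org E G, t))).eventually
    (eventually_cht_par (E := E) (G := G))] with v hv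
  rw [locChart, locParam, inv_mul_cancel_left, hv]

theorem coordFun_locParam (g : G) (t : T) (l : E × T →L[ℂ] ℂ) :
    (fun v : E × T ↦ coordFun g l (locParam g v)) =ᶠ[𝓝 (org E G, t)] l := by
  filter_upwards [eventually_locChart_locParam (E := E) g t] with v hv
  rw [coordFun, hv]

theorem analyticAt_coordFun (g : G) (t : T) (l : E × T →L[ℂ] ℂ) :
    AnalyticAt ℂ (fun v : E × T ↦ coordFun g l (locParam g v)) (org E G, t) :=
  (l.analyticAt _).congr (coordFun_locParam g t l).symm

theorem leftDeriv_coordFun (g : G) (t : T) (l : E × T →L[ℂ] ℂ) (x : E) :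
    leftDeriv (coordFun g l) (g, t) x = l (x, 0) := by
  rw [leftDeriv_apply_eq (analyticAt_coordFun g t l), (coordFun_locParam g t l).fderiv_eq,
    ContinuousLinearMap.fderiv]

theorem vertDeriv_coordFun (g : G) (t : T) (l : E × T →L[ℂ] ℂ) (s : T) :
    vertDeriv (coordFun (E := E) g l) (g, t) s = l (0, s) := by
  rw [vertDeriv_apply_eq (analyticAt_coordFun g t l), (coordFun_locParam g t l).fderiv_eq,
    ContinuousLinearMap.fderiv]

theorem mdifferentiableAt_of_analyticAt {f : G × T → ℂ} {g : G} {t : T}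
    (hf : AnalyticAt ℂ (fun v : E × T ↦ f (locParam g v)) (org E G, t)) :
    MDifferentiableAt (𝓘(ℂ, E).prod 𝓘(ℂ, T)) 𝓘(ℂ, ℂ) f (g, t) :=
  (contMDiffAt_iff_analyticAt_locParam.2 hf).mdifferentiableAt (by simp)

theorem mfderiv_locParam_locChart (g : G) (t : T)
    (w : TangentSpace (𝓘(ℂ, E).prod 𝓘(ℂ, T)) ((g, t) : G × T)) :
    (mfderiv 𝓘(ℂ, E × T) (𝓘(ℂ, E).prod 𝓘(ℂ, T)) (locParam g) (org E G, t)
      (mfderiv (𝓘(ℂ, E).prod 𝓘(ℂ, T)) 𝓘(ℂ, E × T) (locChart (E := E) g) (g, t) w) : E × T) = w := by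
  have h1 : MDifferentiableAt 𝓘(ℂ, E × T) (𝓘(ℂ, E).prod 𝓘(ℂ, T)) (locParam g) (org E G, t) :=
    (contMDiffAt_locParam g t).mdifferentiableAt (by simp)
  have h2 : MDifferentiableAt (𝓘(ℂ, E).prod 𝓘(ℂ, T)) 𝓘(ℂ, E × T) (locChart (E := E) g) (g, t) :=
    (contMDiffAt_locChart g t).mdifferentiableAt (by simp)
  have h3 := mfderiv_comp_of_eq h1 h2 (locChart_self g t)
  have h4 : (locParam (E := E) g ∘ locChart g) =ᶠ[𝓝 ((g, t) : G × T)] id :=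
    eventually_locParam_locChart g t
  have h5 := h4.mfderiv_eq (I := 𝓘(ℂ, E).prod 𝓘(ℂ, T)) (I' := 𝓘(ℂ, E).prod 𝓘(ℂ, T))
  have h6 := DFunLike.congr_fun h3 w
  have h7 := DFunLike.congr_fun h5 w
  have h8 : ∀ z, z = (org E G, t) → ∀ u : E × T,
      (mfderiv 𝓘(ℂ, E × T) (𝓘(ℂ, E).prod 𝓘(ℂ, T)) (locParam g : E × T → G × T) z u : E × T) =
      mfderiv 𝓘(ℂ, E × T) (𝓘(ℂ, E).prod 𝓘(ℂ, T)) (locParam g) (org E G, t) u := by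
    rintro _ rfl u; rfl
  refine (h8 _ (locChart_self g t) _).symm.trans (h6.symm.trans (h7.trans ?_))
  rw [mfderiv_id]
  rfl

/-- Every covector at a point is the differential of a function holomorphic near it, so pointwise
statements about the tensor follow from statements about brackets. -/
theorem exists_differential_coordFun (g : G) (t : T)
    (ξ : Module.Dual ℂ (TangentSpace (𝓘(ℂ, E).prod 𝓘(ℂ, T)) ((g, t) : G × T))) :
    ∃ l : E × T →L[ℂ] ℂ, differential (𝓘(ℂ, E).prod 𝓘(ℂ, T)) (coordFun g l) (g, t) = ξ := by
  let ξ' : (E × T) →ₗ[ℂ] ℂ := ξ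
  let L : (E × T) →ₗ[ℂ] (E × T) :=
    (mfderiv 𝓘(ℂ, E × T) (𝓘(ℂ, E).prod 𝓘(ℂ, T)) (locParam g) (org E G, t)).toLinearMap
  let l : E × T →L[ℂ] ℂ := LinearMap.toContinuousLinearMap (ξ' ∘ₗ L)
  refine ⟨l, LinearMap.ext fun w ↦ ?_⟩
  have h2 : MDifferentiableAt (𝓘(ℂ, E).prod 𝓘(ℂ, T)) 𝓘(ℂ, E × T) (locChart (E := E) g) (g, t) :=
    (contMDiffAt_locChart g t).mdifferentiableAt (by simp)
  have h1 : MDifferentiableAt 𝓘(ℂ, E × T) 𝓘(ℂ, ℂ) l (locChart g (g, t)) :=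
    l.differentiableAt.mdifferentiableAt
  have h3 := DFunLike.congr_fun (mfderiv_comp (g, t) h1 h2) w
  refine h3.trans ?_
  have h4 : ∀ u : E × T, (mfderiv 𝓘(ℂ, E × T) 𝓘(ℂ, ℂ) l (locChart g (g, t)) u : ℂ) = l u :=
    fun u ↦ by
      rw [mfderiv_eq_fderiv, ContinuousLinearMap.fderiv]; rfl
  refine (h4 _).trans ?_
  exact congrArg ξ' (mfderiv_locParam_locChart g t w)

variable {B : E →L[ℂ] E →L[ℂ] ℂ} {p r : E →L[ℂ] E} {j : T →L[ℂ] E} {qT : E →L[ℂ] T}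
  {shp : (E →L[ℂ] ℂ) →L[ℂ] E}
  {π : ∀ x : G × T, TangentSpace (𝓘(ℂ, E).prod 𝓘(ℂ, T)) x ⊗[ℂ]
    TangentSpace (𝓘(ℂ, E).prod 𝓘(ℂ, T)) x} {D : Set (G × T)}

instance finiteDimensional_tangentSpace_prod (x : G × T) :
    FiniteDimensional ℂ (TangentSpace (𝓘(ℂ, E).prod 𝓘(ℂ, T)) x) :=
  inferInstanceAs (FiniteDimensional ℂ (E × T))

/-- The operator whose invertibility at `x` is equivalent to nondegeneracy. -/
def nondegOp (p r : E →L[ℂ] E) (j : T →L[ℂ] E) (x : G × T) : E →L[ℂ] E :=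
  1 + brModel E G (j x.2) * dynPart p r j x

/-- The bracket of `π` on `D` is the model bracket. -/
structure IsModelled (p r : E →L[ℂ] E) (j : T →L[ℂ] E) (qT : E →L[ℂ] T)
    (shp : (E →L[ℂ] ℂ) →L[ℂ] E) (π : ∀ x : G × T, TangentSpace (𝓘(ℂ, E).prod 𝓘(ℂ, T)) x ⊗[ℂ]
    TangentSpace (𝓘(ℂ, E).prod 𝓘(ℂ, T)) x) (D : Set (G × T)) : Prop where
  regular : ∀ x ∈ D, IsRegular p j qT x
  bracket_eq : ∀ x ∈ D, ∀ f k : G × T → ℂ,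
    MDifferentiableAt (𝓘(ℂ, E).prod 𝓘(ℂ, T)) 𝓘(ℂ, ℂ) f x →
    MDifferentiableAt (𝓘(ℂ, E).prod 𝓘(ℂ, T)) 𝓘(ℂ, ℂ) k x →
    bracket (𝓘(ℂ, E).prod 𝓘(ℂ, T)) π f k x = modelBracket p r j qT shp f k x

namespace IsModelled

theorem contMDiffAt (hm : IsModelled p r j qT shp π D) {V : Set (G × T)} (hV : V ⊆ D)
    (hVo : IsOpen V) {f k : G × T → ℂ}
    (hf : ContMDiffOn (𝓘(ℂ, E).prod 𝓘(ℂ, T)) 𝓘(ℂ, ℂ) ω f V)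
    (hk : ContMDiffOn (𝓘(ℂ, E).prod 𝓘(ℂ, T)) 𝓘(ℂ, ℂ) ω k V) {x : G × T} (hx : x ∈ V) :
    ContMDiffAt (𝓘(ℂ, E).prod 𝓘(ℂ, T)) 𝓘(ℂ, ℂ) ω
      (bracket (𝓘(ℂ, E).prod 𝓘(ℂ, T)) π f k) x ∧
    bracket (𝓘(ℂ, E).prod 𝓘(ℂ, T)) π f k =ᶠ[𝓝 x] modelBracket p r j qT shp f k := by
  have h1 : bracket (𝓘(ℂ, E).prod 𝓘(ℂ, T)) π f k =ᶠ[𝓝 x] modelBracket p r j qT shp f k := by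
    filter_upwards [hVo.mem_nhds hx] with y hy
    exact hm.bracket_eq y (hV hy) f k
      ((hf.contMDiffAt (hVo.mem_nhds hy)).mdifferentiableAt (by simp))
      ((hk.contMDiffAt (hVo.mem_nhds hy)).mdifferentiableAt (by simp))
  refine ⟨ContMDiffAt.congr_of_eventuallyEq ?_ h1, h1⟩
  have hf' := hf.contMDiffAt (hVo.mem_nhds hx)
  have hk' := hk.contMDiffAt (hVo.mem_nhds hx)
  obtain ⟨g, t⟩ := x
  rw [contMDiffAt_iff_analyticAt_locParam] at hf' hk' ⊢
  exact analyticAt_modelBracket (hm.regular _ (hV hx)) hf' hk'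

theorem dualDistrib_coordFun (hm : IsModelled p r j qT shp π D) {g : G} {t : T}
    (hx : (g, t) ∈ D) (l m : E × T →L[ℂ] ℂ) :
    TensorProduct.dualDistrib ℂ _ _
      (differential (𝓘(ℂ, E).prod 𝓘(ℂ, T)) (coordFun g l) (g, t) ⊗ₜ[ℂ]
        differential (𝓘(ℂ, E).prod 𝓘(ℂ, T)) (coordFun g m) (g, t)) (π (g, t)) =
      modelBracket p r j qT shp (coordFun g l) (coordFun g m) (g, t) :=
  hm.bracket_eq _ hx _ _ (mdifferentiableAt_of_analyticAt (analyticAt_coordFun g t l))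
    (mdifferentiableAt_of_analyticAt (analyticAt_coordFun g t m))

theorem isPoissonOn (h : IsModel G B p r j qT shp) (hm : IsModelled p r j qT shp π D) :
    IsPoissonOn (𝓘(ℂ, E).prod 𝓘(ℂ, T)) π D where
  skew x hx := by
    obtain ⟨g, t⟩ := x
    refine eq_of_dualDistrib_eq fun ξ η ↦ ?_
    obtain ⟨l, rfl⟩ := exists_differential_coordFun g t ξ
    obtain ⟨m, rfl⟩ := exists_differential_coordFun g t η
    rw [dualDistrib_comm, map_neg, hm.dualDistrib_coordFun hx, hm.dualDistrib_coordFun hx,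
      h.modelBracket_skew (hm.regular _ hx)]
  holomorphic V hV hVo f k hf hk x hx :=
    (hm.contMDiffAt hV hVo hf hk hx).1.contMDiffWithinAt
  jacobi V hV hVo f k l hf hk hl x hx := by
    have key : ∀ a b c : G × T → ℂ,
        ContMDiffOn (𝓘(ℂ, E).prod 𝓘(ℂ, T)) 𝓘(ℂ, ℂ) ω a V →
        ContMDiffOn (𝓘(ℂ, E).prod 𝓘(ℂ, T)) 𝓘(ℂ, ℂ) ω b V →
        ContMDiffOn (𝓘(ℂ, E).prod 𝓘(ℂ, T)) 𝓘(ℂ, ℂ) ω c V →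
        bracket (𝓘(ℂ, E).prod 𝓘(ℂ, T)) π (bracket (𝓘(ℂ, E).prod 𝓘(ℂ, T)) π a b) c x =
          modelBracket p r j qT shp (modelBracket p r j qT shp a b) c x :=
      fun a b c ha hb hc ↦ by
        have h1 := hm.contMDiffAt hV hVo ha hb hx
        rw [hm.bracket_eq x (hV hx) _ _ (h1.1.mdifferentiableAt (by simp))
          ((hc.contMDiffAt (hVo.mem_nhds hx)).mdifferentiableAt (by simp))]
        exact modelBracket_congr h1.2 EventuallyEq.rfl
    rw [key f k l hf hk hl, key k l f hk hl hf, key l f k hl hf hk]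
    have hf' := hf.contMDiffAt (hVo.mem_nhds hx)
    have hk' := hk.contMDiffAt (hVo.mem_nhds hx)
    have hl' := hl.contMDiffAt (hVo.mem_nhds hx)
    obtain ⟨g, t⟩ := x
    rw [contMDiffAt_iff_analyticAt_locParam] at hf' hk' hl'
    exact h.jacobi (hm.regular _ (hV hx)) hf' hk' hl'

/-- A covector in the kernel has vanishing Hamiltonian vector. Its second component says that `X`
has no part in `𝔱`; `ad_t` applied to the first gives `nondegOp X = 0`, because `ad_t` kills `𝔱` and
inverts `ad_t⁻¹` off `𝔱`. With `X = 0` the vertical part vanishes too, and equality of dimensions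
gives bijectivity. -/
theorem nondegenerateAt (h : IsModel G B p r j qT shp) (hm : IsModelled p r j qT shp π D)
    {x : G × T} (hx : x ∈ D)
    (hu : IsUnit (nondegOp p r j x)) :
    NondegenerateAt (𝓘(ℂ, E).prod 𝓘(ℂ, T)) π x := by
  obtain ⟨g, t⟩ := x
  have hreg := hm.regular _ hx
  let Φ : Module.Dual ℂ (TangentSpace (𝓘(ℂ, E).prod 𝓘(ℂ, T)) ((g, t) : G × T)) →ₗ[ℂ]
      TangentSpace (𝓘(ℂ, E).prod 𝓘(ℂ, T)) ((g, t) : G × T) :=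
    { toFun := fun ξ ↦ TensorProduct.lid ℂ _ (LinearMap.rTensor _ ξ (π (g, t)))
      map_add' := fun a b ↦ by rw [LinearMap.rTensor_add, LinearMap.add_apply, map_add]
      map_smul' := fun c a ↦ by
        rw [LinearMap.rTensor_smul, LinearMap.smul_apply, map_smul, RingHom.id_apply] }
  have hinj : Function.Injective Φ := by
    rw [injective_iff_map_eq_zero]
    intro ξ hξ
    obtain ⟨l, rfl⟩ := exists_differential_coordFun g t ξ
    have h1 : ∀ m : E × T →L[ℂ] ℂ,
        modelBracket p r j qT shp (coordFun g m) (coordFun g l) (g, t) = 0 := fun m ↦ by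
      rw [h.modelBracket_skew hreg, ← hm.dualDistrib_coordFun hx, dualDistrib_eq_contract]
      change -(differential (𝓘(ℂ, E).prod 𝓘(ℂ, T)) (coordFun g m) (g, t)) (Φ _) = 0
      rw [hξ, map_zero, neg_zero]
    have h2 : ∀ m : E × T →L[ℂ] ℂ, m (IsModel.hamVec p r j qT shp (coordFun g l) (g, t)) = 0 :=
      fun m ↦ by
        have h3 := h1 m
        rw [h.modelBracket_eq hreg, leftDeriv_coordFun, vertDeriv_coordFun, neg_eq_zero,
          ← map_sub] at h3
        rw [IsModel.hamVec]
        convert h3 using 2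
        simp
    have h3 : IsModel.hamVec p r j qT shp (coordFun g l) (g, t) = 0 :=
      (Module.forall_dual_apply_eq_zero_iff ℂ _).1 fun f ↦
        h2 (LinearMap.toContinuousLinearMap f)
    have h4 : IsModel.hamLeft p r j qT shp (coordFun g l) (g, t) = 0 := congrArg Prod.fst h3
    have h5 : qT (shp (leftDeriv (coordFun g l) (g, t))) = 0 :=
      neg_eq_zero.1 (congrArg Prod.snd h3)
    set X := shp (leftDeriv (coordFun g l) (g, t)) with hX
    rw [IsModel.hamLeft, theta, _root_.add_apply, ← hX] at h4
    have h6 : X = 0 := by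
      have h7 := congrArg (brModel E G (j t)) h4
      rw [map_add, map_add, ← h.shp_comp, h.comm, h.lie_adInvModel hreg.1, h5, map_zero, sub_zero,
        map_zero, zero_add] at h7
      have h8 : nondegOp p r j (g, t) X = 0 := h7
      have h9 := congrArg (fun y ↦ (Ring.inverse (nondegOp p r j (g, t)) : E →L[ℂ] E) y) h8
      simp only [← mul_apply_eq_comp, Ring.inverse_mul_cancel _ hu, map_zero] at h9
      exact h9
    rw [h6, map_zero, map_zero, add_zero, add_zero] at h4
    have hl : l = 0 := by
      ext v
      · have := h.shp_apply (leftDeriv (coordFun g l) (g, t)) v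
        rw [← hX, h6, map_zero, leftDeriv_coordFun] at this
        simpa using this.symm
      · have := h.shp_apply ((vertDeriv (coordFun g l) (g, t)).comp qT) (j v)
        rw [h4, map_zero, ContinuousLinearMap.comp_apply, h.proj_incl, vertDeriv_coordFun] at this
        simpa using this.symm
    have h10 : coordFun g l = fun _ : G × T ↦ (0 : ℂ) := by
      ext P; rw [coordFun, hl]; rfl
    rw [h10, differential, mfderiv_const]
    rfl
  exact ⟨hinj, (LinearMap.injective_iff_surjective_of_finrank_eq_finrank
    Subspace.dual_finrank_eq).1 hinj⟩

end IsModelled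
end Abstract

/-! ### Density of the nondegeneracy locus -/

section Density

open Filter Topology

theorem subset_closure_ne_zero {f : ℂ → ℂ} {U : Set ℂ} (hU : IsPreconnected U) (hUo : IsOpen U)
    (hf : AnalyticOnNhd ℂ f U) {z₀ : ℂ} (hz₀ : z₀ ∈ U) (hf₀ : f z₀ ≠ 0) :
    U ⊆ closure {z | z ∈ U ∧ f z ≠ 0} := by
  intro z hz
  rw [mem_closure_iff_frequently]
  intro hn
  refine hf₀ (hf.eqOn_zero_of_preconnected_of_eventuallyEq_zero hU hz ?_ hz₀)
  filter_upwards [hn, hUo.mem_nhds hz] with w h1 h2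
  by_contra h3
  exact h1 ⟨h2, h3⟩

variable {E T : Type*} [NormedAddCommGroup E] [NormedSpace ℂ E] [FiniteDimensional ℂ E]
  [CompleteSpace E] [NormedAddCommGroup T] [NormedSpace ℂ T] [CompleteSpace T]
variable {G : Type*} [TopologicalSpace G] [ChartedSpace E G] [Group G] [LieGroup 𝓘(ℂ, E) ω G]
variable {p r : E →L[ℂ] E} {j : T →L[ℂ] E}

theorem eventually_isUnit_nondegOp {x : G × T}
    (hu : IsUnit (phiDen (projBr (brModel E G) p (adj x.1 (j x.2)))))
    (hx : IsUnit (nondegOp p r j x)) : ∀ᶠ y in 𝓝 x, IsUnit (nondegOp p r j y) := by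
  obtain ⟨g, t⟩ := x
  refine eventually_of_locParam (E := E) ?_
  have h1 : AnalyticAt ℂ (fun v : E × T ↦ nondegOp p r j (locParam g v)) (org E G, t) :=
    analyticAt_const.add ((((brModel E G).analyticAt _).fun_comp
      ((j.analyticAt _).fun_comp analyticAt_snd)).mul (analyticAt_dynPart hu))
  refine h1.continuousAt.eventually (Units.isOpen.mem_nhds ?_)
  change IsUnit (nondegOp p r j (locParam g (org E G, t)))
  rw [locParam_org]
  exact hx

/-- Restrict to the complex line `z ↦ (g, z t)`. Neither operator involves `ad_t⁻¹`, so `z = 0` is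
allowed although it may lie outside the regular set, and there both operators are the identity. -/
theorem mem_closure_nondeg {S : Set T} (hS : IsOpen S) {x : G × T} (hx : x.2 ∈ S) :
    x ∈ closure {y : G × T | (y.2 ∈ S ∧ IsUnit (phiDen (projBr (brModel E G) p
      (adj y.1 (j y.2))))) ∧ IsUnit (nondegOp p r j y)} := by
  obtain ⟨g, t⟩ := x
  have hlin : ∀ z : ℂ, AnalyticAt ℂ (fun z : ℂ ↦ projBr (brModel E G) p (adj g (j (z • t)))) z :=
    fun z ↦ ((projBr (brModel E G) p).analyticAt _).fun_comp
      (((adj g : E →L[ℂ] E).analyticAt _).fun_comp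
        ((j.analyticAt _).fun_comp (analyticAt_id.smul analyticAt_const)))
  let d : ℂ → ℂ := fun z ↦ (phiDen (projBr (brModel E G) p (adj g (j (z • t))))).det
  let m : ℂ → ℂ := fun z ↦ (nondegOp p r j (g, z • t)).det
  have hd : ∀ z, AnalyticAt ℂ d z := fun z ↦
    (analyticAt_det _).fun_comp ((analyticAt_phiDen _).fun_comp (hlin z))
  have hd0 : d 0 ≠ 0 := by
    rw [← isUnit_iff_det_ne_zero]; simp
  have hpre := isPreconnected_setOf_ne_zero hd hd0
  have hopen : IsOpen {z | d z ≠ 0} :=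
    isOpen_ne.preimage (continuous_iff_continuousAt.2 fun z ↦ (hd z).continuousAt)
  have hm : AnalyticOnNhd ℂ m {z | d z ≠ 0} := fun z hz ↦ by
    have hphi : AnalyticAt ℂ
        (fun z : ℂ ↦ phi (projBr (brModel E G) p (adj g (j (z • t))))) z :=
      AnalyticAt.fun_comp (f := fun z : ℂ ↦ projBr (brModel E G) p (adj g (j (z • t))))
        (analyticAt_phi ((isUnit_iff_det_ne_zero _).2 hz)) (hlin z)
    have hdyn : AnalyticAt ℂ (fun z : ℂ ↦ dynPart p r j (g, z • t)) z :=
      ((analyticAt_const (v := (adj g⁻¹ : E →L[ℂ] E))).mul (hphi.sub (analyticAt_const (v := r)))).mul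
        (analyticAt_const (v := (adj g : E →L[ℂ] E)))
    have had : AnalyticAt ℂ (fun z : ℂ ↦ brModel E G (j (z • t))) z :=
      ((brModel E G).analyticAt _).fun_comp
        ((j.analyticAt _).fun_comp (analyticAt_id.smul analyticAt_const))
    have hop : AnalyticAt ℂ (fun z : ℂ ↦ nondegOp p r j (g, z • t)) z :=
      analyticAt_const.add (had.mul hdyn)
    exact (analyticAt_det _).fun_comp hop
  have hm0 : m 0 ≠ 0 := by
    rw [← isUnit_iff_det_ne_zero, nondegOp]; simp
  have h1 : (1 : ℂ) ∈ closure {z | d z ≠ 0} := by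
    have := subset_closure_ne_zero isPreconnected_univ isOpen_univ (fun z _ ↦ hd z)
      (Set.mem_univ 0) hd0 (Set.mem_univ (1 : ℂ))
    simpa using this
  -- The function `m` is analytic only where `d` is nonzero. Hence the identity theorem is used
  -- twice, first for `d` on the plane and then for `m` on the connected set `d ≠ 0`.
  have h2 : (1 : ℂ) ∈ closure {z | d z ≠ 0 ∧ m z ≠ 0} :=
    closure_minimal (subset_closure_ne_zero hpre hopen hm hd0 hm0) isClosed_closure h1
  have hc : Continuous fun z : ℂ ↦ ((g, z • t) : G × T) := by fun_prop
  have h3 : ∀ᶠ z : ℂ in 𝓝 1, z • t ∈ S := by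
    have hc2 : Continuous fun z : ℂ ↦ z • t := by fun_prop
    exact hc2.continuousAt.eventually (hS.mem_nhds (by simpa using hx))
  rw [mem_closure_iff_frequently] at h2 ⊢
  have h4 : Tendsto (fun z : ℂ ↦ ((g, z • t) : G × T)) (𝓝 1) (𝓝 (g, t)) := by
    have := hc.tendsto 1
    rwa [one_smul] at this
  refine h4.frequently ((h2.and_eventually h3).mono fun z ⟨⟨hz1, hz2⟩, hz3⟩ ↦ ?_)
  exact ⟨⟨hz3, (isUnit_iff_det_ne_zero _).2 hz1⟩, (isUnit_iff_det_ne_zero _).2 hz2⟩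

end Density

/-! ### Openness of the regular set, and restriction of Poisson structures. -/

section Assembly

open Filter Topology

theorem isClosed_two_pi_int : IsClosed (Set.range fun n : ℤ ↦ (2 * Real.pi * Complex.I * n : ℂ)) := by
  have h1 : IsClosed (Set.range ((↑) : ℤ → ℂ)) := Complex.isClosed_range_intCast
  have h2 : (2 * Real.pi * Complex.I : ℂ) ≠ 0 := Complex.two_pi_I_ne_zero
  have h3 := (Homeomorph.mulLeft₀ _ h2).isClosedMap _ h1
  rwa [← Set.range_comp] at h3

variable {E G : Type*} [NormedAddCommGroup E] [NormedSpace ℂ E] [FiniteDimensional ℂ E]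
  [CompleteSpace E] [TopologicalSpace G] [ChartedSpace E G] [Group G] [LieGroup 𝓘(ℂ, E) ω G]

theorem isOpen_tPrime {𝔱 : LieSubalgebra ℂ (GroupLieAlgebra 𝓘(ℂ, E) G)} (h𝔱 : IsCartan 𝔱) :
    IsOpen {s : space 𝔱 | spaceEquiv 𝔱 s ∈ tPrime 𝔱} := by
  have e : {s : space 𝔱 | spaceEquiv 𝔱 s ∈ tPrime 𝔱} = ⋂ α ∈ roots 𝔱,
      (fun s ↦ α (spaceEquiv 𝔱 s)) ⁻¹' (Set.range fun n : ℤ ↦ (2 * Real.pi * Complex.I * n : ℂ))ᶜ := by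
    ext s
    simp only [tPrime, Set.mem_ofPred_eq, Set.mem_iInter, Set.mem_preimage, Set.mem_compl_iff,
      Set.mem_range, not_exists]
    exact forall₃_congr fun _ _ _ ↦ ne_comm
  rw [e]
  refine h𝔱.finite_roots.isOpen_biInter fun α _ ↦ isClosed_two_pi_int.isOpen_compl.preimage ?_
  exact (α ∘ₗ (spaceEquiv 𝔱).toLinearMap).continuous_of_finiteDimensional

theorem IsPoissonOn.mono {F H M : Type*} [NormedAddCommGroup F] [NormedSpace ℂ F]
    [TopologicalSpace H] [TopologicalSpace M] [ChartedSpace H M] {I : ModelWithCorners ℂ F H}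
    {π : ∀ p : M, TangentSpace I p ⊗[ℂ] TangentSpace I p} {U V : Set M} (h : IsPoissonOn I π V)
    (hUV : U ⊆ V) : IsPoissonOn I π U :=
  ⟨fun x hx ↦ h.skew x (hUV hx), fun W hW ↦ h.holomorphic W (hW.trans hUV),
    fun W hW ↦ h.jacobi W (hW.trans hUV)⟩

end Assembly

end DynPoisson

end

open DynPoisson in
theorem mainTheorem11
    {E G : Type*} [NormedAddCommGroup E] [NormedSpace ℂ E] [FiniteDimensional ℂ E] [CompleteSpace E]
    [TopologicalSpace G] [ChartedSpace E G] [Group G] [LieGroup 𝓘(ℂ, E) ω G]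
    (hred : IsReductive (GroupLieAlgebra 𝓘(ℂ, E) G))
    (B : LinearMap.BilinForm ℂ (GroupLieAlgebra 𝓘(ℂ, E) G))
    (hBsymm : B.IsSymm) (hBnondeg : B.Nondegenerate)
    (hBinv : ∀ (g : G) (x y : GroupLieAlgebra 𝓘(ℂ, E) G), B (Ad g x) (Ad g y) = B x y)
    (𝔱 : LieSubalgebra ℂ (GroupLieAlgebra 𝓘(ℂ, E) G)) (h𝔱 : IsCartan 𝔱)
    (P : Set (Module.Dual ℂ 𝔱)) (hP : IsPositiveSystem 𝔱 P)
    (e : Module.Dual ℂ 𝔱 → GroupLieAlgebra 𝓘(ℂ, E) G) (he : IsRootVectors B 𝔱 e)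
    (lam : 𝔱) :
    IsOpen (domG1 B 𝔱 lam) ∧
    {p : G × space 𝔱 | spaceEquiv 𝔱 p.2 ∈ tPrime 𝔱} ⊆ closure (domG1 B 𝔱 lam) ∧
    IsPoissonOn (𝓘(ℂ, E).prod 𝓘(ℂ, space 𝔱)) (piG1 B 𝔱 P e lam) (domG1 B 𝔱 lam) ∧
    ∃ U ⊆ domG1 B 𝔱 lam, IsOpen U ∧
      {p : G × space 𝔱 | spaceEquiv 𝔱 p.2 ∈ tPrime 𝔱} ⊆ closure U ∧
      IsSymplecticOn (𝓘(ℂ, E).prod 𝓘(ℂ, space 𝔱)) (piG1 B 𝔱 P e lam) U := by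
  have h := isMetricReductive_of_Ad_invariant hred hBsymm hBnondeg hBinv h𝔱
  obtain ⟨p, hp⟩ := IsOrthProj.exists_of_nondeg
    (B := B) (W := (leviDerived (lam : GroupLieAlgebra 𝓘(ℂ, E) G)).toSubmodule)
    (fun _ hx ↦ h.nondeg_leviDerived lam hx)
  obtain ⟨q, hq⟩ := h.exists_proj_cartan
  obtain ⟨shp, h1, h2⟩ := exists_inverse_modelForm h.nondeg
  have hM := isModel h hBinv hP he hp hq h1 h2
  have hm : IsModelled (modelEnd p) (modelEnd (rStdEnd B 𝔱 P e lam)) (space 𝔱).subtypeL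
      (modelProj hq) shp (piG1 B 𝔱 P e lam) (domG1 B 𝔱 lam) :=
    ⟨fun x hx ↦ isRegular_of_mem_domG1 h hp hq hx,
      fun x hx f k hf hk ↦ bracket_piG1 h hBinv hP he hp hq h1 h2 hx hf hk⟩
  have hopen : IsOpen (domG1 B 𝔱 lam) := by
    rw [isOpen_iff_mem_nhds]
    intro x hx
    filter_upwards [(hm.regular x hx).eventually,
      continuous_snd.continuousAt.eventually ((isOpen_tPrime h𝔱).mem_nhds hx.1)] with y hy1 hy2
    exact (mem_domG1_iff h hp).2 ⟨hy2, hy1.2⟩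
  -- The open set sought is the part of the domain where `nondegOp` is invertible; its density
  -- contains that of the domain.
  have hsub : {x : G × space 𝔱 | spaceEquiv 𝔱 x.2 ∈ tPrime 𝔱} ⊆
      closure {x | x ∈ domG1 B 𝔱 lam ∧ IsUnit (nondegOp (modelEnd p)
        (modelEnd (rStdEnd B 𝔱 P e lam)) (space 𝔱).subtypeL x)} := fun x hx ↦ by
    simp only [mem_domG1_iff h hp]
    exact mem_closure_nondeg (isOpen_tPrime h𝔱) hx
  have hPois := hm.isPoissonOn hM
  refine ⟨hopen, hsub.trans (closure_mono fun x hx ↦ hx.1), hPois, _, fun x hx ↦ hx.1, ?_, hsub,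
    hPois.mono fun x hx ↦ hx.1, fun x hx ↦ hm.nondegenerateAt hM hx.1 hx.2⟩
  rw [isOpen_iff_mem_nhds]
  rintro x ⟨hx1, hx2⟩
  filter_upwards [hopen.mem_nhds hx1, eventually_isUnit_nondegOp (hm.regular x hx1).2 hx2]
    with y hy1 hy2
  exact ⟨hy1, hy2⟩
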